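/- Let $0<b\le \pi/2$. For an integer $n\ge 1$ put $q_n(x)=(n^2-\tfrac14)\tan^2x-\tfrac12$ on $(-\pi/2,\pi/2)$, and let $M_nw=w''-q_nw$ be the operator on $L^2(-\pi/2,\pi/2)$ (complex-valued functions) with its natural domain $$D(M_n)=\{w\in L^2(-\pi/2,\pi/2):\ w,\,w'\text{ locally absolutely continuous on }(-\pi/2,\pi/2),\ w''-q_nw\in L^2(-\pi/2,\pi/2)\},$$ equipped with the graph norm. Let $\mathcal P_n=\partial_t-\partial_x^2+q_n(x)$, so that $\mathcal P_ng=\partial_tg-M_ng$. (i) (Uniform Carleman estimate.) There exist a positive weight $\beta\in C^4([-\pi/2,\pi/2])$ and constants $C_0,C_1>0$ (depending only on $b$ and $\beta$) such that for every $T>0$, every $s\ge C_0(T+T^2)$, every integer $n\ge1$ and every $g\in C([0,T];L^2(-\pi/2,\pi/2))\cap C^2((0,T);D(M_n))$, $$C_1\int_0^T\!\!\int_{-\pi/2}^{\pi/2}\big(s\theta|\partial_xg|^2+s^3\theta^3|g|^2\big)e^{-2s\varphi}\,dx\,dt\ \le\ \int_0^T\!\!\int_{-b}^{b}s^3\theta^3|g|^2e^{-2s\varphi}\,dx\,dt+\int_0^T\!\!\int_{-\pi/2}^{\pi/2}|\mathcal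 P_ng|^2e^{-2s\varphi}\,dx\,dt,$$ where $\theta(t)=\frac1{t(T-t)}$ and $\varphi(t,x)=\theta(t)\beta(x)$; the integrals take values in $[0,+\infty]$. (ii) (Observability uniform in the Fourier mode.) For every $T>0$ there is a constant $C>0$, depending only on $T$ and $b$, such that for every integer $n\ge1$ and every $g\in C([0,T];L^2(-\pi/2,\pi/2))\cap C^2((0,T);D(M_n))$ with $\partial_tg=M_ng$ on $(0,T)$, $$\int_{-\pi/2}^{\pi/2}|g(T,x)|^2\,dx\ \le\ C\int_0^T\!\!\int_{-b}^{b}|g(t,x)|^2\,dx\,dt.$$ -/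

import Mathlib

open Real Set MeasureTheory

noncomputable section

namespace Carleman

/-- The interval `(-π/2, π/2)`. -/
def I : Set ℝ := Ioo (-(π / 2)) (π / 2)

/-- The complex Hilbert space `L²(-π/2, π/2)`. -/
abbrev L2 : Type := Lp ℂ 2 (volume.restrict I)

/-- The potential `q_n(x) = (n² - 1/4) tan² x - 1/2`. -/
def q (n : ℕ) (x : ℝ) : ℝ := ((n : ℝ) ^ 2 - 1 / 4) * tan x ^ 2 - 1 / 2

/-- `u` is locally absolutely continuous on `(-π/2, π/2)` with (almost everywhere, equivalently weak)
derivative `u'`. -/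
def HasLocACDeriv (u u' : ℝ → ℂ) : Prop :=
  LocallyIntegrableOn u' I ∧ ∀ x ∈ I, ∀ y ∈ I, ∫ z in x..y, u' z = u y - u x

lemma intervalIntegrable_of_mem {u' : ℝ → ℂ} (h : LocallyIntegrableOn u' I) {x y : ℝ}
    (hx : x ∈ I) (hy : y ∈ I) : IntervalIntegrable u' volume x y := by
  have hsub : uIcc x y ⊆ I := (convex_Ioo _ _).ordConnected.uIcc_subset hx hy
  exact (h.integrableOn_compact_subset hsub isCompact_uIcc).intervalIntegrable

lemma HasLocACDeriv.zero : HasLocACDeriv (fun _ => 0) (fun _ => 0) :=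
  ⟨(locallyIntegrable_const (0 : ℂ)).locallyIntegrableOn I, by simp⟩

lemma HasLocACDeriv.add {u u' v v' : ℝ → ℂ} (hu : HasLocACDeriv u u') (hv : HasLocACDeriv v v') :
    HasLocACDeriv (fun x => u x + v x) (fun x => u' x + v' x) := by
  refine ⟨hu.1.add hv.1, fun x hx y hy => ?_⟩
  rw [intervalIntegral.integral_add (intervalIntegrable_of_mem hu.1 hx hy)
    (intervalIntegrable_of_mem hv.1 hx hy), hu.2 x hx y hy, hv.2 x hx y hy]
  ring

lemma HasLocACDeriv.const_mul {u u' : ℝ → ℂ} (c : ℂ) (hu : HasLocACDeriv u u') :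
    HasLocACDeriv (fun x => c * u x) (fun x => c * u' x) := by
  refine ⟨?_, fun x hx y hy => ?_⟩
  · exact hu.1.smul c
  · rw [intervalIntegral.integral_const_mul, hu.2 x hx y hy]
    ring

/-- The graph of the operator `M_n w = w'' - q_n w` in `L²(-π/2, π/2)` on its natural (maximal) domain:
all `w ∈ L²` such that `w` and `w'` are locally absolutely continuous and `w'' - q_n w ∈ L²`.
Here `p = (w, M_n w)`, `w₁ = w'` and `w₂ = w''`.

For `n ≥ 1` both end points are of limit-point type, hence this is the self-adjoint realisation: every such
`w` automatically satisfies `w, w' → 0` at `±π/2`. It is conjugate, through `w = √(cos x) v`, to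
`v ↦ (cos x v')' / cos x - n² tan² x v` on `L²(cos x dx)`. -/
def graphM (n : ℕ) : Submodule ℂ (L2 × L2) where
  carrier := {p | ∃ w₁ : ℝ → ℂ, (∃ w : ℝ → ℂ, w =ᵐ[volume.restrict I] p.1 ∧ HasLocACDeriv w w₁) ∧
    ∃ w₂ : ℝ → ℂ, HasLocACDeriv w₁ w₂ ∧
      p.2 =ᵐ[volume.restrict I] fun x => w₂ x - (q n x : ℂ) * p.1 x}
  zero_mem' := by
    refine ⟨fun _ => 0, ⟨fun _ => 0, ?_, .zero⟩, fun _ => 0, .zero, ?_⟩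
    · filter_upwards [Lp.coeFn_zero ℂ 2 (volume.restrict I)] with x hx
      exact hx.symm
    · filter_upwards [Lp.coeFn_zero ℂ 2 (volume.restrict I)] with x hx
      rw [Prod.fst_zero, Prod.snd_zero, hx]
      simp
  add_mem' := by
    rintro a b ⟨a₁, ⟨a₀, ha, ha₁⟩, a₂, ha₂, ha₃⟩ ⟨b₁, ⟨b₀, hb, hb₁⟩, b₂, hb₂, hb₃⟩
    refine ⟨_, ⟨_, ?_, ha₁.add hb₁⟩, _, ha₂.add hb₂, ?_⟩
    · filter_upwards [ha, hb, Lp.coeFn_add a.1 b.1] with x h1 h2 h3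
      simp only [Prod.fst_add, h3, Pi.add_apply, h1, h2]
    · filter_upwards [ha₃, hb₃, Lp.coeFn_add a.1 b.1, Lp.coeFn_add a.2 b.2] with x h1 h2 h3 h4
      simp only [Prod.fst_add, Prod.snd_add, h3, h4, Pi.add_apply, h1, h2]
      ring
  smul_mem' := by
    rintro c a ⟨a₁, ⟨a₀, ha, ha₁⟩, a₂, ha₂, ha₃⟩
    refine ⟨_, ⟨_, ?_, ha₁.const_mul c⟩, _, ha₂.const_mul c, ?_⟩
    · filter_upwards [ha, Lp.coeFn_smul c a.1] with x h1 h2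
      simp only [Prod.smul_fst, h2, Pi.smul_apply, h1, smul_eq_mul]
    · filter_upwards [ha₃, Lp.coeFn_smul c a.1, Lp.coeFn_smul c a.2] with x h1 h2 h3
      simp only [Prod.smul_fst, Prod.smul_snd, h2, h3, Pi.smul_apply, h1, smul_eq_mul]
      ring

/-- The domain `D(M_n)` with the graph norm: an element `w` is represented by `(w, M_n w)`. -/
abbrev DomM (n : ℕ) : Type := graphM n

/-- `w ∈ D(M_n)` as an element of `L²`. -/
def DomM.toL2 {n : ℕ} (p : DomM n) : L2 := p.1.1

/-- `M_n w ∈ L²` for `w ∈ D(M_n)`. -/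
def DomM.op {n : ℕ} (p : DomM n) : L2 := p.1.2

/-- The derivative `w'` of `w ∈ D(M_n)` (unique almost everywhere on `(-π/2, π/2)`). -/
def DomM.dx {n : ℕ} (p : DomM n) : ℝ → ℂ := Classical.choose p.2

/-- `g` belongs to `C([0,T]; L²) ∩ C²((0,T); D(M_n))`; `G` is `g` on `(0,T)`, seen as a curve with
values in `D(M_n)`. -/
structure InClass (n : ℕ) (T : ℝ) (g : ℝ → L2) (G : ℝ → DomM n) : Prop where
  continuousOn : ContinuousOn g (Icc 0 T)
  contDiffOn : ContDiffOn ℝ 2 G (Ioo 0 T)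
  toL2_eq : ∀ t ∈ Ioo 0 T, (G t).toL2 = g t

/-- `𝒫_n g = ∂_t g - ∂_x² g + q_n g = ∂_t g - M_n g` at time `t`. -/
def opP {n : ℕ} (g : ℝ → L2) (G : ℝ → DomM n) (t : ℝ) : L2 := deriv g t - (G t).op

/-- `θ(t) = 1 / (t (T - t))`. -/
def theta (T t : ℝ) : ℝ := 1 / (t * (T - t))

/-- `φ(t,x) = θ(t) β(x)`. -/
def phi (β : ℝ → ℝ) (T t x : ℝ) : ℝ := theta T t * β x

end Carleman

end

open Carleman

open Real Set MeasureTheory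

noncomputable section

namespace Carleman

open Filter Topology
open scoped ENNReal BoundedContinuousFunction

/-! The estimate is a global Carleman estimate by conjugation. Put σ = sθ(t) and z = e^{-σβ} g. Then
e^{-σβ} 𝒫_n g = P + S, with P = (σ'β - σ²β'²) z - M_n z (`Weight.symmPart`) and S = z_t - σ(2β' z' +
β'' z) (`Weight.antiPart`). In ‖P + S‖² = ‖P‖² + 2⟨P, S⟩ + ‖S‖² the cross term contains ∂_t⟨P, z⟩,
the positive-order terms -4σ∫β''|z'|² - 4σ³∫β'²β''|z|², and lower-order errors. The weight
(`exists_weight`) grows away from the origin and is strictly concave outside a small interval around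
it, so these terms are coercive except where the observation takes place.

Uniformity in n: in the commutator the potential appears only through σ∫β' q_n'|z|², which is
nonnegative because β' and q_n' both have the sign of x, and is discarded (`RealRep.commutator`).
Elsewhere the constants use only q_n ≥ -1/2.

The potential is singular at ±π/2, so boundary terms need care. The ground state v = cos^{n+1/2}
solves v'' = (q_n - n) v. For w in the domain, ψ = v (w/v)' = w' + (n + 1/2) tan x · w tends to 0 at
the endpoints: otherwise w would grow like cos^{1/2-n}, which is not square integrable for n ≥ 1
(`RealRep.tendsto_psi_right`). Then w → 0 as well, and replacing w' by ψ - (n + 1/2) tan x · w shows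
that the singular part of each boundary term cancels or has a favourable sign (`boundary_form_ge`).

In the region where β'' has the wrong sign, the gradient is controlled by a Caccioppoli inequality
for P (`Weight.cutoff_term_le`), paid for by ‖P‖², so only |z|² is observed
(`Weight.conjugated_estimate`).

Integration in time needs ⟨P, z⟩ to vanish at the ends. Since g may be unbounded in D(M_n) near 0
and T, the estimate is proved on (ε, T - ε) with a weight singular at its own ends, and ε → 0 by
Fatou's lemma (`Weight.lintegral_lhsDensity_le_of_contDiffOn`). Observability follows by keeping the
middle third of (0, T) and using the growth bound `InClass.norm_sq_le`. -/

/-! ### Real locally absolutely continuous functions on the interval. -/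

lemma isOpen_I : IsOpen I := isOpen_Ioo

lemma measurableSet_I : MeasurableSet I := measurableSet_Ioo

lemma uIcc_subset_I {x y : ℝ} (hx : x ∈ I) (hy : y ∈ I) : uIcc x y ⊆ I :=
  (convex_Ioo _ _).ordConnected.uIcc_subset hx hy

lemma zero_mem_I : (0 : ℝ) ∈ I := by constructor <;> linarith [pi_pos]

lemma neg_mem_I {x : ℝ} (hx : x ∈ I) : -x ∈ I := by
  obtain ⟨h1, h2⟩ := hx
  constructor <;> linarith

instance isFiniteMeasure_restrict_I : IsFiniteMeasure (volume.restrict I) := by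
  unfold I; infer_instance

/-- The real function `u` is locally absolutely continuous on `I` with derivative `u'`. -/
structure ACD (u u' : ℝ → ℝ) : Prop where
  locInt : LocallyIntegrableOn u' I
  int_eq : ∀ x ∈ I, ∀ y ∈ I, ∫ z in x..y, u' z = u y - u x

namespace ACD

variable {u u' v v' : ℝ → ℝ}

lemma intervalIntegrable (h : ACD u u') {x y : ℝ} (hx : x ∈ I) (hy : y ∈ I) :
    IntervalIntegrable u' volume x y :=
  (h.locInt.integrableOn_compact_subset (uIcc_subset_I hx hy) isCompact_uIcc).intervalIntegrable

lemma continuousOn (h : ACD u u') : ContinuousOn u I := by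
  intro x hx
  obtain ⟨r, hr, hball⟩ := Metric.isOpen_iff.1 isOpen_I x hx
  set a := x - r / 2
  set b := x + r / 2
  have hab : a ≤ b := by simp only [a, b]; linarith
  have ha : a ∈ I := hball (by simp [a, abs_of_pos hr]; linarith)
  have hb : b ∈ I := hball (by simp [b, abs_of_pos hr]; linarith)
  have hint := h.intervalIntegrable ha hb
  have hc : ContinuousOn (fun z => u a + ∫ t in a..z, u' t) (uIcc a b) :=
    continuousOn_const.add
      (intervalIntegral.continuousOn_primitive_interval' hint left_mem_uIcc)
  rw [uIcc_of_le hab] at hc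
  have hx' : Icc a b ∈ 𝓝 x := Icc_mem_nhds (by simp only [a]; linarith) (by simp only [b]; linarith)
  have h1 : ContinuousAt u x := by
    refine (hc.continuousAt hx').congr ?_
    filter_upwards [hx'] with z hz
    have hzI : z ∈ I := uIcc_subset_I ha hb (by rwa [uIcc_of_le hab])
    rw [h.int_eq a ha z hzI]; ring
  exact h1.continuousWithinAt

lemma of_hasDerivAt (h : ∀ x ∈ I, HasDerivAt u (u' x) x) (hc : ContinuousOn u' I) : ACD u u' where
  locInt := hc.locallyIntegrableOn measurableSet_I
  int_eq := fun _ hx _ hy => intervalIntegral.integral_eq_sub_of_hasDerivAt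
    (fun z hz => h z (uIcc_subset_I hx hy hz))
    ((hc.mono (uIcc_subset_I hx hy)).intervalIntegrable)

lemma hasDerivAt (h : ACD u u') (hc : ContinuousOn u' I) {x : ℝ} (hx : x ∈ I) :
    HasDerivAt u (u' x) x := by
  have hm : StronglyMeasurableAtFilter u' (𝓝 x) volume :=
    hc.stronglyMeasurableAtFilter isOpen_I x hx
  have h1 := intervalIntegral.integral_hasDerivAt_right (h.intervalIntegrable zero_mem_I hx)
    hm (hc.continuousAt (isOpen_I.mem_nhds hx))
  refine (h1.const_add (u 0)).congr_of_eventuallyEq ?_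
  filter_upwards [isOpen_I.mem_nhds hx] with z hz
  rw [h.int_eq 0 zero_mem_I z hz]; ring

lemma congr_left (h : ACD u u') (hv : ∀ x ∈ I, u x = v x) : ACD v u' :=
  ⟨h.locInt, fun x hx y hy => by rw [h.int_eq x hx y hy, hv x hx, hv y hy]⟩

lemma congr_right_ae (h : ACD u u') (hv : u' =ᵐ[volume.restrict I] v') : ACD u v' := by
  rw [Filter.EventuallyEq, ae_restrict_iff' measurableSet_I] at hv
  refine ⟨?_, fun x hx y hy => ?_⟩
  · intro x hx
    obtain ⟨s, hs, hi⟩ := h.locInt x hx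
    refine ⟨s ∩ I, inter_mem hs self_mem_nhdsWithin, ?_⟩
    refine (hi.mono_set inter_subset_left).congr_fun_ae ?_
    exact (ae_restrict_of_ae_restrict_of_subset inter_subset_right
      ((ae_restrict_iff' measurableSet_I).2 hv))
  · rw [← h.int_eq x hx y hy]
    refine intervalIntegral.integral_congr_ae ?_
    filter_upwards [hv] with z hz hzI
    exact (hz (uIcc_subset_I hx hy (uIoc_subset_uIcc hzI))).symm

lemma congr_right (h : ACD u u') (hv : ∀ x ∈ I, u' x = v' x) : ACD u v' :=
  h.congr_right_ae ((ae_restrict_iff' measurableSet_I).2 (.of_forall hv))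

lemma add (hu : ACD u u') (hv : ACD v v') : ACD (fun x => u x + v x) (fun x => u' x + v' x) := by
  refine ⟨hu.1.add hv.1, fun x hx y hy => ?_⟩
  rw [intervalIntegral.integral_add (hu.intervalIntegrable hx hy)
    (hv.intervalIntegrable hx hy), hu.2 x hx y hy, hv.2 x hx y hy]
  ring

lemma const_mul (c : ℝ) (hu : ACD u u') : ACD (fun x => c * u x) (fun x => c * u' x) := by
  refine ⟨hu.1.smul c, fun x hx y hy => ?_⟩
  rw [intervalIntegral.integral_const_mul, hu.2 x hx y hy]
  ring

lemma sub (hu : ACD u u') (hv : ACD v v') : ACD (fun x => u x - v x) (fun x => u' x - v' x) := by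
  simpa [sub_eq_add_neg] using hu.add (hv.const_mul (-1))

/-- This product rule is the integration by parts behind all the integral identities below, each of
which integrates the derivative of a sum of products. -/
lemma mul (hu : ACD u u') (hv : ACD v v') :
    ACD (fun x => u x * v x) (fun x => u' x * v x + u x * v' x) := by
  refine ⟨?_, fun x hx y hy => ?_⟩
  · exact (hu.locInt.mul_continuousOn hv.continuousOn isOpen_I.isLocallyClosed).add
      (hv.locInt.continuousOn_mul hu.continuousOn isOpen_I.isLocallyClosed)
  · have hiu := hu.intervalIntegrable hx hy
    have hiv := hv.intervalIntegrable hx hy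
    -- The primitives of `u'` and `v'` agree with `u` and `v` on `I` and have these derivatives
    -- almost everywhere.
    set U : ℝ → ℝ := fun z => u x + ∫ t in x..z, u' t
    set V : ℝ → ℝ := fun z => v x + ∫ t in x..z, v' t
    have hU : AbsolutelyContinuousOnInterval U x y :=
      (ContDiffOn.absolutelyContinuousOnInterval contDiffOn_const).fun_add
        (hiu.absolutelyContinuousOnInterval_intervalIntegral left_mem_uIcc)
    have hV : AbsolutelyContinuousOnInterval V x y :=
      (ContDiffOn.absolutelyContinuousOnInterval contDiffOn_const).fun_add
        (hiv.absolutelyContinuousOnInterval_intervalIntegral left_mem_uIcc)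
    have hUe : ∀ z ∈ I, U z = u z := fun z hz => by
      simp only [U]; rw [hu.2 x hx z hz]; ring
    have hVe : ∀ z ∈ I, V z = v z := fun z hz => by
      simp only [V]; rw [hv.2 x hx z hz]; ring
    have key := hU.integral_deriv_mul_eq_sub hV
    rw [hUe x hx, hUe y hy, hVe x hx, hVe y hy] at key
    rw [← key]
    refine intervalIntegral.integral_congr_ae ?_
    filter_upwards [hiu.ae_hasDerivAt_integral, hiv.ae_hasDerivAt_integral] with z h1 h2 hz
    have hz' := uIoc_subset_uIcc hz
    have hzI := uIcc_subset_I hx hy hz'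
    rw [((h1 hz' x left_mem_uIcc).const_add (u x)).deriv,
      ((h2 hz' x left_mem_uIcc).const_add (v x)).deriv, hUe z hzI, hVe z hzI]

lemma comp_neg (hu : ACD u u') : ACD (fun x => u (-x)) (fun x => -u' (-x)) := by
  refine ⟨?_, fun x hx y hy => ?_⟩
  · rw [locallyIntegrableOn_iff isOpen_I.isLocallyClosed]
    intro k hk hkc
    have h1 : IntegrableOn u' (-k) :=
      hu.locInt.integrableOn_compact_subset
        (fun x hx => by simpa using neg_mem_I (hk (Set.mem_neg.1 hx))) hkc.neg
    have h2 := ((Measure.measurePreserving_neg (volume : Measure ℝ)).integrableOn_comp_preimage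
      (MeasurableEquiv.neg ℝ).measurableEmbedding (f := u') (s := -k)).2 h1
    have h3 : (Neg.neg ⁻¹' (-k) : Set ℝ) = k := by ext; simp
    rw [h3] at h2
    exact h2.neg
  · rw [intervalIntegral.integral_neg, intervalIntegral.integral_comp_neg,
      hu.2 (-y) (neg_mem_I hy) (-x) (neg_mem_I hx)]
    ring

end ACD

/-! ### Exhaustion of the interval by symmetric subintervals. -/

lemma aecover_I : AECover (volume.restrict I) (𝓝[<] (π / 2)) (fun c : ℝ => Ioc (-c) c) := by
  have h : Tendsto (fun c : ℝ => c) (𝓝[<] (π / 2)) (𝓝 (π / 2)) :=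
    tendsto_id.mono_left nhdsWithin_le_nhds
  exact aecover_Ioo_of_Ioc h.neg h

lemma eventually_mem_Ioo_right {a : ℝ} (ha : a < π / 2) : ∀ᶠ c in 𝓝[<] (π / 2), c ∈ Ioo a (π / 2) :=
  Ioo_mem_nhdsLT ha

lemma restrict_I_restrict_Ioc {c : ℝ} (hc : c ∈ Ioo 0 (π / 2)) :
    (volume.restrict I).restrict (Ioc (-c) c) = volume.restrict (Ioc (-c) c) := by
  rw [Measure.restrict_restrict measurableSet_Ioc, inter_eq_left.2]
  intro x hx
  exact ⟨by linarith [hx.1, hc.2], by linarith [hx.2, hc.2]⟩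

lemma tendsto_intervalIntegral_I {f : ℝ → ℝ} (hf : Integrable f (volume.restrict I)) :
    Tendsto (fun c => ∫ x in (-c)..c, f x) (𝓝[<] (π / 2)) (𝓝 (∫ x in I, f x)) := by
  refine (aecover_I.integral_tendsto_of_countably_generated hf).congr' ?_
  filter_upwards [eventually_mem_Ioo_right (a := 0) (by positivity)] with c hc
  rw [intervalIntegral.integral_of_le (by linarith [hc.1]), restrict_I_restrict_Ioc hc]

lemma mem_I_of_mem_Ioo {c : ℝ} (hc : c ∈ Ioo 0 (π / 2)) : c ∈ I :=
  ⟨by linarith [hc.1, pi_pos], hc.2⟩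

/-- A locally integrable nonnegative function on `I` with bounded integrals is integrable. -/
lemma integrable_of_intervalIntegral_bound {f : ℝ → ℝ} (hf : LocallyIntegrableOn f I)
    (h0 : ∀ x ∈ I, 0 ≤ f x) {K : ℝ} (hK : ∀ᶠ c in 𝓝[<] (π / 2), ∫ x in (-c)..c, f x ≤ K) :
    Integrable f (volume.restrict I) := by
  obtain ⟨u, -, hu, hlim⟩ := exists_seq_strictMono_tendsto' (show (0 : ℝ) < π / 2 by positivity)
  have hlim' : Tendsto u atTop (𝓝[<] (π / 2)) :=
    tendsto_nhdsWithin_of_tendsto_nhds_of_eventually_within _ hlim (.of_forall fun k => (hu k).2)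
  have hcov : AECover (volume.restrict I) atTop (fun k => Ioc (-u k) (u k)) :=
    aecover_Ioo_of_Ioc hlim.neg hlim
  refine hcov.integrable_of_integral_norm_bounded K (fun k => ?_) ?_
  · have hI := mem_I_of_mem_Ioo (hu k)
    rw [IntegrableOn, restrict_I_restrict_Ioc (hu k)]
    refine (hf.integrableOn_compact_subset (t := Icc (-u k) (u k)) ?_ isCompact_Icc).mono_set
      Ioc_subset_Icc_self
    rw [← uIcc_of_le (by linarith [(hu k).1])]
    exact uIcc_subset_I (neg_mem_I hI) hI
  · filter_upwards [hlim'.eventually hK] with k hKc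
    rw [intervalIntegral.integral_of_le (by linarith [(hu k).1])] at hKc
    rw [restrict_I_restrict_Ioc (hu k)]
    refine le_trans (le_of_eq (setIntegral_congr_fun measurableSet_Ioc ?_)) hKc
    intro x hx
    simp only [Real.norm_eq_abs]
    exact abs_of_nonneg (h0 x ⟨by linarith [hx.1, (hu k).2], by linarith [hx.2, (hu k).2]⟩)

/-! ### The potential and its ground state. -/

lemma cos_pos_of_mem_I {x : ℝ} (hx : x ∈ I) : 0 < cos x := cos_pos_of_mem_Ioo hx

lemma inv_cos_sq_of_mem_I {x : ℝ} (hx : x ∈ I) : 1 / cos x ^ 2 = 1 + tan x ^ 2 := by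
  have h := (cos_pos_of_mem_I hx).ne'
  rw [tan_eq_sin_div_cos]
  field_simp
  linarith [sin_sq_add_cos_sq x]

lemma hasDerivAt_tan_of_mem_I {x : ℝ} (hx : x ∈ I) : HasDerivAt tan (1 + tan x ^ 2) x := by
  rw [← inv_cos_sq_of_mem_I hx]
  exact Real.hasDerivAt_tan (cos_pos_of_mem_I hx).ne'

lemma continuousOn_tan_I : ContinuousOn tan I := fun _ hx =>
  (hasDerivAt_tan_of_mem_I hx).continuousAt.continuousWithinAt

/-- The derivative of the potential `q n`. -/
def q' (n : ℕ) (x : ℝ) : ℝ := ((n : ℝ) ^ 2 - 1 / 4) * (2 * tan x * (1 + tan x ^ 2))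

lemma hasDerivAt_q (n : ℕ) {x : ℝ} (hx : x ∈ I) : HasDerivAt (q n) (q' n x) x := by
  have h := (((hasDerivAt_tan_of_mem_I hx).pow 2).const_mul ((n : ℝ) ^ 2 - 1 / 4)).sub_const (1 / 2)
  refine h.congr_deriv ?_
  simp [q']

lemma continuousOn_q' (n : ℕ) : ContinuousOn (q' n) I := by
  unfold q'
  have := continuousOn_tan_I
  fun_prop

/-- Together with `q'_mul_nonneg`, this is the information on the potential on which the final
constants rest; neither fact depends on `n`. -/
lemma neg_half_le_q {n : ℕ} (hn : 1 ≤ n) (x : ℝ) : -(1 / 2) ≤ q n x := by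
  have h1 : (1 : ℝ) ≤ n := by exact_mod_cast hn
  have : 0 ≤ ((n : ℝ) ^ 2 - 1 / 4) * tan x ^ 2 := by
    apply mul_nonneg _ (sq_nonneg _); nlinarith
  unfold q; linarith

lemma tan_mul_nonneg {x y : ℝ} (hx : x ∈ I) (hy : 0 ≤ x * y) : 0 ≤ tan x * y := by
  rcases lt_trichotomy x 0 with h | h | h
  · have h1 : tan x < 0 := tan_neg_of_neg_of_pi_div_two_lt h hx.1
    have : y ≤ 0 := by by_contra! h2; nlinarith
    nlinarith
  · simp [h]
  · have h1 : 0 < tan x := tan_pos_of_pos_of_lt_pi_div_two h hx.2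
    have : 0 ≤ y := by by_contra! h2; nlinarith
    nlinarith

/-- The potential increases away from the origin, so a multiplier field pointing outwards produces a
term of good sign, however large `n` is. -/
lemma q'_mul_nonneg {n : ℕ} (hn : 1 ≤ n) {x y : ℝ} (hx : x ∈ I) (hy : 0 ≤ x * y) :
    0 ≤ q' n x * y := by
  have h1 : (1 : ℝ) ≤ n := by exact_mod_cast hn
  have h2 := tan_mul_nonneg hx hy
  have : q' n x * y = 2 * ((n : ℝ) ^ 2 - 1 / 4) * (1 + tan x ^ 2) * (tan x * y) := by
    unfold q'; ring
  rw [this]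
  have : 0 ≤ (n : ℝ) ^ 2 - 1 / 4 := by nlinarith
  positivity

/-- The function `cos^(n+1/2)`, a positive solution of `v'' = (q_n - n) v`. -/
def groundState (n : ℕ) (x : ℝ) : ℝ := cos x ^ n * √(cos x)

lemma groundState_pos (n : ℕ) {x : ℝ} (hx : x ∈ I) : 0 < groundState n x := by
  have := cos_pos_of_mem_I hx
  unfold groundState; positivity

lemma groundState_sq (n : ℕ) {x : ℝ} (hx : x ∈ I) : groundState n x ^ 2 = cos x ^ (2 * n + 1) := by
  have := cos_pos_of_mem_I hx
  unfold groundState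
  rw [mul_pow, sq_sqrt this.le]; ring

lemma hasDerivAt_groundState {n : ℕ} (hn : 1 ≤ n) {x : ℝ} (hx : x ∈ I) :
    HasDerivAt (groundState n) (-((n + 1 / 2) * tan x * groundState n x)) x := by
  obtain ⟨m, rfl⟩ := Nat.exists_eq_add_of_le' hn
  have hc := cos_pos_of_mem_I hx
  have h := ((Real.hasDerivAt_cos x).pow (m + 1)).mul ((Real.hasDerivAt_cos x).sqrt hc.ne')
  refine h.congr_deriv ?_
  unfold groundState
  rw [tan_eq_sin_div_cos]
  have hs : 0 < √(cos x) := sqrt_pos.2 hc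
  have hs2 : √(cos x) ^ 2 = cos x := sq_sqrt hc.le
  generalize √(cos x) = s at *
  rw [← hs2]
  push_cast
  simp only [Pi.pow_apply, ← hs2]
  field_simp
  ring

lemma groundState_le {n : ℕ} {x y : ℝ} (hx : 0 ≤ x) (hxy : x ≤ y) (hy : y ≤ π / 2) :
    groundState n y ≤ groundState n x := by
  have h1 : cos y ≤ cos x := cos_le_cos_of_nonneg_of_le_pi hx (by linarith [pi_pos]) hxy
  have h2 : 0 ≤ cos y := cos_nonneg_of_mem_Icc ⟨by linarith [pi_pos], hy⟩
  have h3 := h2.trans h1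
  unfold groundState
  gcongr

/-! ### Boundary behaviour of domain elements: the limit-point argument. -/

/-- `w` is a real element of the domain of `M_n`, with derivative `w₁` and `M_n w = f`. -/
structure RealRep (n : ℕ) (w w₁ f : ℝ → ℝ) : Prop where
  ac : ACD w w₁
  ac₁ : ACD w₁ (fun x => f x + q n x * w x)
  memLp : MemLp w 2 (volume.restrict I)
  memLp_op : MemLp f 2 (volume.restrict I)

/-- `w' + (n + 1/2) tan x w`, that is `v (w/v)'` for the ground state `v`. -/
def psi (n : ℕ) (w w₁ : ℝ → ℝ) (x : ℝ) : ℝ := w₁ x + (n + 1 / 2) * tan x * w x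

namespace RealRep

variable {n : ℕ} {w w₁ f : ℝ → ℝ}

lemma neg (h : RealRep n w w₁ f) :
    RealRep n (fun x => -w x) (fun x => -w₁ x) (fun x => -f x) where
  ac := by simpa using h.ac.const_mul (-1)
  ac₁ := (h.ac₁.const_mul (-1)).congr_left (by simp) |>.congr_right (fun x _ => by ring)
  memLp := h.memLp.neg
  memLp_op := h.memLp_op.neg

lemma measurePreserving_neg_I :
    MeasurePreserving (fun x : ℝ => -x) (volume.restrict I) (volume.restrict I) := by
  have h := (Measure.measurePreserving_neg (volume : Measure ℝ)).restrict_preimage measurableSet_I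
  have h3 : (Neg.neg ⁻¹' I : Set ℝ) = I := by
    ext x
    exact ⟨fun h => by simpa using neg_mem_I h, fun h => neg_mem_I h⟩
  rwa [h3] at h

lemma comp_neg (h : RealRep n w w₁ f) :
    RealRep n (fun x => w (-x)) (fun x => -w₁ (-x)) (fun x => f (-x)) where
  ac := h.ac.comp_neg
  ac₁ := (h.ac₁.comp_neg.const_mul (-1)).congr_left (by simp) |>.congr_right
    (fun x _ => by simp [q])
  memLp := h.memLp.comp_measurePreserving measurePreserving_neg_I
  memLp_op := h.memLp_op.comp_measurePreserving measurePreserving_neg_I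

lemma continuousOn (h : RealRep n w w₁ f) : ContinuousOn w I := h.ac.continuousOn

lemma continuousOn_deriv (h : RealRep n w w₁ f) : ContinuousOn w₁ I := h.ac₁.continuousOn

lemma hasDerivAt (h : RealRep n w w₁ f) {x : ℝ} (hx : x ∈ I) : HasDerivAt w (w₁ x) x :=
  h.ac.hasDerivAt h.continuousOn_deriv hx

/-- For the ground state v, the product v ψ is the Wronskian v w' - v' w. As v'' = (q_n - n) v, the
singular potential cancels from its derivative and an integrable source remains. -/
lemma wronskian (h : RealRep n w w₁ f) (hn : 1 ≤ n) :
    ACD (fun x => groundState n x * psi n w w₁ x)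
      (fun x => groundState n x * (f x + n * w x)) := by
  have htan := continuousOn_tan_I
  have hgc : ContinuousOn (groundState n) I := fun x hx =>
    (hasDerivAt_groundState hn hx).continuousAt.continuousWithinAt
  have h1 := ACD.of_hasDerivAt (fun x hx => hasDerivAt_groundState hn hx) (by fun_prop)
  have h2 := ACD.of_hasDerivAt (u := fun x => (n + 1 / 2 : ℝ) * tan x * groundState n x)
    (fun x hx => ((hasDerivAt_tan_of_mem_I hx).const_mul _).mul (hasDerivAt_groundState hn hx))
    (by fun_prop)
  refine (((h1.mul h.ac₁).add (h2.mul h.ac)).congr_left ?_).congr_right ?_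
  · intro x _; unfold psi; ring
  · intro x _; unfold q; ring

lemma integrable_src (h : RealRep n w w₁ f) :
    Integrable (fun x => f x + n * w x) (volume.restrict I) :=
  (h.memLp_op.integrable (by norm_num)).add ((h.memLp.integrable (by norm_num)).const_mul _)

/-- The function log cos is unbounded at π/2 and its derivative is dominated by 1/cos. -/
lemma not_integrableOn_inv_cos {x₀ : ℝ} (hx : x₀ < π / 2) :
    ¬ IntegrableOn (fun x => 1 / cos x) (Ioo x₀ (π / 2)) := by
  have hev : ∀ᶠ x in 𝓝[<] (π / 2), x ∈ Ioo 0 (π / 2) :=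
    eventually_mem_Ioo_right (by positivity)
  refine not_integrableOn_of_tendsto_norm_atTop_of_deriv_isBigO_filter (𝓝[<] (π / 2))
    (Ioo_mem_nhdsLT hx) (f := fun x => log (cos x)) ?_ ?_ ?_
  · filter_upwards [hev] with x hx
    have := cos_pos_of_mem_I (mem_I_of_mem_Ioo hx)
    exact differentiableAt_cos.log this.ne'
  · have h1 : Tendsto cos (𝓝[<] (π / 2)) (𝓝[>] 0) := by
      refine tendsto_nhdsWithin_of_tendsto_nhds_of_eventually_within _ ?_ ?_
      · have := (continuous_cos.tendsto (π / 2)).mono_left (nhdsWithin_le_nhds (s := Iio (π / 2)))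
        simpa using this
      · filter_upwards [hev] with x hx using cos_pos_of_mem_I (mem_I_of_mem_Ioo hx)
    exact tendsto_abs_atBot_atTop.comp (tendsto_log_nhdsGT_zero.comp h1)
  · refine Asymptotics.IsBigO.of_bound 1 ?_
    filter_upwards [hev] with x hx
    have := cos_pos_of_mem_I (mem_I_of_mem_Ioo hx)
    rw [deriv.log differentiableAt_cos this.ne', Real.deriv_cos, norm_div, norm_div, one_mul]
    gcongr
    simpa using abs_sin_le_one x

/-- A Wronskian bounded below by C > 0 means (w/v)' ≥ C cos^{-(2n+1)}, so w grows at least like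
cos^{1/2-n}. Up to a constant, w² then dominates a multiple of 1/cos, contradicting w ∈ L². -/
lemma not_forall_le_wronskian (h : RealRep n w w₁ f) (hn : 1 ≤ n) {C x₀ : ℝ} (hC : 0 < C)
    (hx₀ : x₀ ∈ Ioo 0 (π / 2)) :
    ¬ ∀ x ∈ Ico x₀ (π / 2), C ≤ groundState n x * psi n w w₁ x := by
  intro hP
  have hnpos : (0 : ℝ) < n := by exact_mod_cast hn
  have hsub : ∀ x ∈ Ico x₀ (π / 2), x ∈ Ioo 0 (π / 2) := fun x hx => ⟨hx₀.1.trans_le hx.1, hx.2⟩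
  -- The subtracted function has derivative C sin / cos^{2n+1}, at most the lower bound for (w/v)',
  -- so `H` is increasing.
  set H : ℝ → ℝ := fun x => w x / groundState n x - C * ((cos x ^ (2 * n))⁻¹ / (2 * n))
  have hd : ∀ x ∈ Ico x₀ (π / 2), HasDerivAt H
      ((groundState n x * psi n w w₁ x - C * sin x) / cos x ^ (2 * n + 1)) x := by
    intro x hx
    have hxI := mem_I_of_mem_Ioo (hsub x hx)
    have hc := cos_pos_of_mem_I hxI
    have hg := groundState_pos n hxI
    have h1 := (h.hasDerivAt hxI).div (hasDerivAt_groundState hn hxI) hg.ne'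
    have h2 := ((((Real.hasDerivAt_cos x).pow (2 * n)).inv (by simp [hc.ne'])).div_const
      (2 * n : ℝ)).const_mul C
    refine (h1.sub h2).congr_deriv ?_
    rw [← groundState_sq n hxI]
    have e1 : groundState n x ^ 2 = cos x ^ (2 * n - 1) * cos x ^ 2 := by
      rw [groundState_sq n hxI, ← pow_add]; congr 1; omega
    have e2 : cos x ^ (2 * n) = cos x ^ (2 * n - 1) * cos x := by
      rw [← pow_succ]; congr 1; omega
    simp only [Pi.pow_apply, e2]
    have e3 : (w₁ x * groundState n x - w x * -((n + 1 / 2) * tan x * groundState n x)) =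
      groundState n x * psi n w w₁ x := by unfold psi; ring
    rw [e3, sub_div]
    congr 1
    rw [e1]
    push_cast
    field_simp
  have hmono : MonotoneOn H (Ico x₀ (π / 2)) := by
    refine monotoneOn_of_hasDerivWithinAt_nonneg (convex_Ico _ _)
      (fun x hx => (hd x hx).continuousAt.continuousWithinAt)
      (fun x hx => (hd x (interior_subset hx)).hasDerivWithinAt) ?_
    intro x hx
    have hx' := interior_subset hx
    have hc := cos_pos_of_mem_I (mem_I_of_mem_Ioo (hsub x hx'))
    apply div_nonneg _ (by positivity)
    nlinarith [hP x hx', sin_le_one x]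
  have hlow : ∀ x ∈ Ico x₀ (π / 2), 1 / √(cos x) ≤ 2 * n / C * (|w x| + |H x₀|) := by
    intro x hx
    have hxI := mem_I_of_mem_Ioo (hsub x hx)
    have hc := cos_pos_of_mem_I hxI
    have hs : 0 < √(cos x) := sqrt_pos.2 hc
    have hg := groundState_pos n hxI
    have hg1 : groundState n x ≤ 1 := by
      unfold groundState
      exact mul_le_one₀ (pow_le_one₀ hc.le (cos_le_one x)) hs.le (sqrt_le_one.2 (cos_le_one x))
    have h1 := hmono ⟨le_rfl, hx₀.2⟩ hx hx.1
    have h2 : groundState n x * H x = w x - C / (2 * n) * (√(cos x) / cos x ^ n) := by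
      simp only [H]
      rw [mul_sub, mul_div_cancel₀ _ hg.ne']
      congr 1
      unfold groundState
      field_simp
      ring
    -- This amounts to cos^n ≤ cos, which needs `n ≥ 1`.
    have h3 : 1 / √(cos x) ≤ √(cos x) / cos x ^ n := by
      rw [div_le_div_iff₀ hs (by positivity), mul_self_sqrt hc.le, one_mul]
      exact pow_le_of_le_one hc.le (cos_le_one x) (by omega)
    have h4 : -|H x₀| ≤ groundState n x * H x := by
      have : -|H x₀| ≤ groundState n x * H x₀ := by
        have : |groundState n x * H x₀| ≤ |H x₀| := by
          rw [abs_mul, abs_of_pos hg]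
          exact mul_le_of_le_one_left (abs_nonneg _) hg1
        linarith [neg_abs_le (groundState n x * H x₀)]
      exact this.trans (mul_le_mul_of_nonneg_left h1 hg.le)
    have h5 : C / (2 * n) * (1 / √(cos x)) ≤ |w x| + |H x₀| := by
      have : C / (2 * n) * (1 / √(cos x)) ≤ C / (2 * n) * (√(cos x) / cos x ^ n) := by gcongr
      linarith [le_abs_self (w x)]
    calc 1 / √(cos x) = 2 * n / C * (C / (2 * n) * (1 / √(cos x))) := by field_simp
      _ ≤ _ := by gcongr
  refine not_integrableOn_inv_cos hx₀.2 ?_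
  have hss : Ioo x₀ (π / 2) ⊆ I := fun x hx => mem_I_of_mem_Ioo (hsub x ⟨hx.1.le, hx.2⟩)
  have hi : IntegrableOn (fun x => (2 * n / C) ^ 2 * (2 * w x ^ 2 + 2 * |H x₀| ^ 2)) I :=
    ((h.memLp.integrable_sq.const_mul 2).add (integrable_const _)).const_mul _
  refine (hi.mono_set hss).mono' ?_ ?_
  · exact (measurable_const.div measurable_cos).aestronglyMeasurable
  · refine (ae_restrict_iff' measurableSet_Ioo).2 (.of_forall fun x hx => ?_)
    have hc := cos_pos_of_mem_I (hss hx)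
    have h1 := hlow x ⟨hx.1.le, hx.2⟩
    have h2 : (1 / √(cos x)) ^ 2 = 1 / cos x := by rw [div_pow, sq_sqrt hc.le, one_pow]
    rw [norm_of_nonneg (by positivity), ← h2]
    calc (1 / √(cos x)) ^ 2 ≤ (2 * n / C * (|w x| + |H x₀|)) ^ 2 := by gcongr
      _ ≤ _ := by
        rw [mul_pow]
        gcongr
        nlinarith [sq_nonneg (|w x| - |H x₀|), sq_abs (w x)]

/-- The Wronskian v ψ has a limit C at π/2, because its derivative is integrable, and C = 0 by
`not_forall_le_wronskian`. As v decreases, v(c)|ψ(c)| is at most v(c) times the tail integral of |f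
+ n w|; dividing by v(c) gives the claim. -/
lemma tendsto_psi_right (h : RealRep n w w₁ f) (hn : 1 ≤ n) :
    Tendsto (psi n w w₁) (𝓝[<] (π / 2)) (𝓝 0) := by
  set F : ℝ → ℝ := fun x => f x + n * w x
  have hpi : (0 : ℝ) < π / 2 := by positivity
  have hev : ∀ᶠ x in 𝓝[<] (π / 2), x ∈ Ioo 0 (π / 2) := eventually_mem_Ioo_right hpi
  have hFi : IntervalIntegrable F volume 0 (π / 2) := by
    rw [intervalIntegrable_iff_integrableOn_Ioo_of_le hpi.le]
    exact IntegrableOn.mono_set h.integrable_src fun x hx => mem_I_of_mem_Ioo hx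
  have hgcont : Continuous (groundState n) := by unfold groundState; fun_prop
  have hgFi : IntervalIntegrable (fun x => groundState n x * F x) volume 0 (π / 2) :=
    hFi.continuousOn_mul hgcont.continuousOn
  set A : ℝ → ℝ := fun c => ∫ x in c..(π / 2), |F x|
  have hA : Tendsto A (𝓝[<] (π / 2)) (𝓝 0) := by
    have h1 : ContinuousOn (fun c => ∫ x in (π / 2)..c, |F x|) (uIcc 0 (π / 2)) :=
      intervalIntegral.continuousOn_primitive_interval' hFi.abs right_mem_uIcc
    rw [uIcc_of_le hpi.le] at h1
    have h2 := ((h1 (π / 2) ⟨hpi.le, le_rfl⟩).mono_of_mem_nhdsWithin (s := Iio (π / 2)) ?_).neg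
    · simpa [A, ContinuousWithinAt, intervalIntegral.integral_symm (π / 2), Pi.neg_def] using h2
    · filter_upwards [hev] with x hx using ⟨hx.1.le, hx.2.le⟩
  set C : ℝ := groundState n 0 * psi n w w₁ 0 + ∫ x in (0)..(π / 2), groundState n x * F x
  have hPC : ∀ c ∈ Ioo 0 (π / 2), |groundState n c * psi n w w₁ c - C| ≤ groundState n c * A c := by
    intro c hc
    have hcu : c ∈ uIcc 0 (π / 2) := by rw [uIcc_of_le hpi.le]; exact ⟨hc.1.le, hc.2.le⟩
    have h1 := (h.wronskian hn).int_eq 0 zero_mem_I c (mem_I_of_mem_Ioo hc)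
    have h2 := intervalIntegral.integral_add_adjacent_intervals
      (hgFi.mono_set (uIcc_subset_uIcc left_mem_uIcc hcu))
      (hgFi.mono_set (uIcc_subset_uIcc hcu right_mem_uIcc))
    have h3 : groundState n c * psi n w w₁ c - C = -∫ x in c..(π / 2), groundState n x * F x := by
      simp only [C, F] at h1 h2 ⊢
      linarith
    rw [h3, abs_neg, ← intervalIntegral.integral_const_mul]
    refine (intervalIntegral.abs_integral_le_integral_abs hc.2.le).trans ?_
    refine intervalIntegral.integral_mono_on hc.2.le ?_ ?_ ?_
    · exact (hgFi.mono_set (uIcc_subset_uIcc hcu right_mem_uIcc)).abs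
    · exact ((hFi.mono_set (uIcc_subset_uIcc hcu right_mem_uIcc)).abs).const_mul _
    · intro x hx
      rw [abs_mul]
      gcongr
      rw [abs_of_nonneg]
      · exact groundState_le hc.1.le hx.1 hx.2
      · unfold groundState
        have : 0 ≤ cos x := cos_nonneg_of_mem_Icc ⟨by linarith [hx.1, hc.1], hx.2⟩
        positivity
  have hg1 : ∀ c ∈ Ioo 0 (π / 2), groundState n c ≤ 1 := fun c hc => by
    simpa [groundState] using groundState_le (n := n) le_rfl hc.1.le hc.2.le
  have hApos : ∀ c ∈ Ioo 0 (π / 2), 0 ≤ A c := fun c hc =>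
    intervalIntegral.integral_nonneg hc.2.le fun x _ => abs_nonneg _
  -- If C ≠ 0, the Wronskian of w or of -w stays above |C|/2 near the endpoint.
  have hC : C = 0 := by
    by_contra hne
    have hCpos : 0 < |C| / 2 := by positivity
    have hev2 : ∀ᶠ x in 𝓝[<] (π / 2), A x < |C| / 2 := hA.eventually_lt_const hCpos
    obtain ⟨x₀, hx₀, hx₀'⟩ := (mem_nhdsLT_iff_exists_Ioo_subset' hpi).1 (hev.and hev2)
    set x₁ := (x₀ + π / 2) / 2
    have hx₁ : x₁ ∈ Ioo x₀ (π / 2) := by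
      simp only [mem_Iio] at hx₀
      constructor <;> simp only [x₁] <;> linarith
    have hest : ∀ x ∈ Ico x₁ (π / 2), |groundState n x * psi n w w₁ x - C| ≤ |C| / 2 := by
      intro x hx
      obtain ⟨h1, h2⟩ := hx₀' (show x ∈ Ioo x₀ (π / 2) from ⟨hx₁.1.trans_le hx.1, hx.2⟩)
      have := mul_le_of_le_one_left (hApos x h1) (hg1 x h1)
      linarith [hPC x h1]
    rcases lt_or_gt_of_ne hne with hneg | hpos
    · refine h.neg.not_forall_le_wronskian hn hCpos (hx₀' hx₁).1 fun x hx => ?_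
      have h1 := hest x hx
      rw [abs_of_neg hneg] at h1 ⊢
      have : psi n (fun x => -w x) (fun x => -w₁ x) x = -psi n w w₁ x := by unfold psi; ring
      rw [this]
      linarith [(abs_le.1 h1).2]
    · refine h.not_forall_le_wronskian hn hCpos (hx₀' hx₁).1 fun x hx => ?_
      have h1 := hest x hx
      rw [abs_of_pos hpos] at h1 ⊢
      linarith [(abs_le.1 h1).1]
  refine squeeze_zero_norm' ?_ hA
  filter_upwards [hev] with x hx
  have h1 := hPC x hx
  have hg := groundState_pos n (mem_I_of_mem_Ioo hx)
  rw [hC, sub_zero, abs_mul, abs_of_pos hg] at h1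
  exact le_of_mul_le_mul_left h1 hg

lemma psi_comp_neg (x : ℝ) :
    psi n (fun x => w (-x)) (fun x => -w₁ (-x)) x = -psi n w w₁ (-x) := by
  simp only [psi, tan_neg]; ring

lemma tendsto_psi_left (h : RealRep n w w₁ f) (hn : 1 ≤ n) :
    Tendsto (fun c => psi n w w₁ (-c)) (𝓝[<] (π / 2)) (𝓝 0) := by
  have := (h.comp_neg.tendsto_psi_right hn).neg
  simpa [psi_comp_neg] using this

end RealRep

/-! ### Integral identities and inequalities for real domain elements. -/

lemma intervalIntegral_le_integral_I {g : ℝ → ℝ} (hg : Integrable g (volume.restrict I))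
    (h0 : ∀ x, 0 ≤ g x) {a c : ℝ} (ha : a ∈ I) (hc : c ∈ I) (hac : a ≤ c) :
    ∫ x in a..c, g x ≤ ∫ x in I, g x := by
  rw [intervalIntegral.integral_of_le hac]
  refine setIntegral_mono_set hg (.of_forall h0) (LE.le.eventuallyLE ?_)
  exact fun x hx => ⟨ha.1.trans hx.1, hx.2.trans_lt hc.2⟩

lemma intervalIntegrable_of_integrable_I {g : ℝ → ℝ} (hg : Integrable g (volume.restrict I))
    {a c : ℝ} (ha : a ∈ I) (hc : c ∈ I) : IntervalIntegrable g volume a c := by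
  rw [intervalIntegrable_iff]
  exact IntegrableOn.mono_set hg (uIoc_subset_uIcc.trans (uIcc_subset_I ha hc))

lemma integrable_bdd_mul {φ u v : ℝ → ℝ} {K : ℝ} (hφ : ContinuousOn φ I)
    (hK : ∀ x ∈ I, |φ x| ≤ K) (hu : MemLp u 2 (volume.restrict I))
    (hv : MemLp v 2 (volume.restrict I)) :
    Integrable (fun x => φ x * (u x * v x)) (volume.restrict I) :=
  (hu.integrable_mul hv).bdd_mul (c := K) (hφ.aestronglyMeasurable measurableSet_I)
    ((ae_restrict_iff' measurableSet_I).2 (.of_forall hK))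

lemma tendsto_zero_of_sq {g : ℝ → ℝ} {l : Filter ℝ} (h : Tendsto (fun x => g x ^ 2) l (𝓝 0)) :
    Tendsto g l (𝓝 0) := by
  have h1 := (continuous_sqrt.tendsto 0).comp h
  simp only [sqrt_zero] at h1
  refine squeeze_zero_norm (fun x => ?_) h1
  simp [sqrt_sq_eq_abs]

/-- This controls the boundary term in `RealRep.commutator`, with α = n + 1/2, t = tan x and w' = ψ
- αtw. Since α² - α(α-1) = α, the singular squares leave ηαt²w² ≥ 0, and the cross term η₁wt is
absorbed because η ≥ κ. The loss involves only ψ² and w², which vanish at the endpoints, so its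
constant may depend on `n`. -/
lemma boundary_form_ge {η η₁ η₂ κ K α t w ψ : ℝ} (hκ : 0 < κ) (hη : κ ≤ η) (hηK : η ≤ K)
    (h1 : |η₁| ≤ K) (h2 : |η₂| ≤ K) (hα : 1 ≤ α) :
    -((2 * K * α + α * K ^ 2 / κ) * (ψ ^ 2 + w ^ 2)) ≤
      η * (ψ - α * t * w) ^ 2 + η₁ * (w * (ψ - α * t * w)) - 1 / 2 * η₂ * w ^ 2
        - η * ((α * (α - 1) * t ^ 2 - 1 / 2) * w ^ 2) := by
  have hK : 0 < K := by linarith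
  obtain ⟨h1a, h1b⟩ := abs_le.1 h1
  obtain ⟨h2a, h2b⟩ := abs_le.1 h2
  -- In this variable all terms containing t collect into α(ηX² - η₁wX), which is bounded below by
  -- completing the square.
  set X := t * w - ψ with hX
  have e : η * (ψ - α * t * w) ^ 2 + η₁ * (w * (ψ - α * t * w)) - 1 / 2 * η₂ * w ^ 2
        - η * ((α * (α - 1) * t ^ 2 - 1 / 2) * w ^ 2) =
      α * (η * X ^ 2 - η₁ * (w * X)) - (α - 1) * (η * ψ ^ 2 + η₁ * (w * ψ))
        + 1 / 2 * (η - η₂) * w ^ 2 := by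
    rw [hX]; ring
  rw [e]
  have b1 : -(K ^ 2 / κ * w ^ 2) ≤ η * X ^ 2 - η₁ * (w * X) := by
    have hsq : η₁ ^ 2 ≤ K ^ 2 := sq_le_sq' h1a h1b
    have : 0 ≤ κ * (X - η₁ * w / (2 * κ)) ^ 2 := by positivity
    have e2 : κ * (X - η₁ * w / (2 * κ)) ^ 2 =
        κ * X ^ 2 - η₁ * (w * X) + η₁ ^ 2 * w ^ 2 / (4 * κ) := by
      field_simp; ring
    have b2 : η₁ ^ 2 * w ^ 2 / (4 * κ) ≤ K ^ 2 / κ * w ^ 2 := by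
      rw [div_mul_eq_mul_div, div_le_div_iff₀ (by positivity) hκ]
      nlinarith [mul_le_mul_of_nonneg_right hsq (mul_nonneg (sq_nonneg w) hκ.le),
        mul_nonneg (mul_nonneg (sq_nonneg K) (sq_nonneg w)) hκ.le]
    nlinarith [mul_le_mul_of_nonneg_right hη (sq_nonneg X)]
  have b3 : η * ψ ^ 2 + η₁ * (w * ψ) ≤ 2 * K * (ψ ^ 2 + w ^ 2) := by
    have : η₁ * (w * ψ) ≤ K * (ψ ^ 2 + w ^ 2) := by
      have h3 : |η₁ * (w * ψ)| ≤ K * |w * ψ| := by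
        rw [abs_mul]; gcongr
      have h4 : |w * ψ| ≤ ψ ^ 2 + w ^ 2 := by
        rw [abs_le]; constructor <;> nlinarith [sq_nonneg (w + ψ), sq_nonneg (w - ψ)]
      have := mul_le_mul_of_nonneg_left h4 hK.le
      linarith [le_abs_self (η₁ * (w * ψ))]
    nlinarith [mul_le_mul_of_nonneg_right hηK (sq_nonneg ψ), mul_nonneg hK.le (sq_nonneg w)]
  have b4 : -(K * w ^ 2) ≤ 1 / 2 * (η - η₂) * w ^ 2 := by
    nlinarith [sq_nonneg w]
  have c1 := mul_le_mul_of_nonneg_left b1 (by linarith : 0 ≤ α)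
  have c3 := mul_le_mul_of_nonneg_left b3 (by linarith : 0 ≤ α - 1)
  have c5 : α * K ^ 2 / κ * w ^ 2 = α * (K ^ 2 / κ * w ^ 2) := by ring
  have c6 : 0 ≤ α * K ^ 2 / κ * ψ ^ 2 := by positivity
  nlinarith [mul_nonneg hK.le (sq_nonneg ψ), mul_nonneg hK.le (sq_nonneg w)]

namespace RealRep

variable {n : ℕ} {w w₁ f : ℝ → ℝ}

lemma integrable_mul_op (h : RealRep n w w₁ f) :
    Integrable (fun x => w x * f x) (volume.restrict I) :=
  h.memLp.integrable_mul h.memLp_op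

/-- Integrating (w w')' = w'² + w(f + q w) from 0 to c bounds w w' from below. With w' = ψ - (n +
1/2) tan · w and ψ bounded, this becomes an upper bound, which in turn forces w → 0. -/
lemma tan_mul_sq_bounded (h : RealRep n w w₁ f) (hn : 1 ≤ n) :
    ∃ K, ∀ᶠ c in 𝓝[<] (π / 2), tan c * w c ^ 2 ≤ K := by
  have hn1 : (1 : ℝ) ≤ n := by exact_mod_cast hn
  have hi : Integrable (fun x => |w x * f x| + w x ^ 2) (volume.restrict I) :=
    h.integrable_mul_op.abs.add h.memLp.integrable_sq
  set N := ∫ x in I, (|w x * f x| + w x ^ 2)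
  refine ⟨N + |w 0 * w₁ 0| + 1, ?_⟩
  have hψ := (h.tendsto_psi_right hn).abs
  rw [abs_zero] at hψ
  -- Beyond π/4 the tangent is at least 1, so a stray w² is absorbed by tan · w².
  filter_upwards [eventually_mem_Ioo_right (a := π / 4) (by linarith [pi_pos]),
    hψ.eventually_lt_const zero_lt_one] with c hc hψc
  have hc0 : c ∈ Ioo 0 (π / 2) := ⟨by linarith [hc.1, pi_pos], hc.2⟩
  have hcI := mem_I_of_mem_Ioo hc0
  have htan : 1 ≤ tan c := by
    rw [← tan_pi_div_four]
    exact (strictMonoOn_tan.le_iff_le ⟨by linarith [pi_pos], by linarith [pi_pos]⟩ hcI).2 hc.1.le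
  have hm := h.ac.mul h.ac₁
  have h1 := hm.int_eq 0 zero_mem_I c hcI
  have h2 : -N ≤ ∫ x in (0)..c, (w₁ x * w₁ x + w x * (f x + q n x * w x)) := by
    have := intervalIntegral_le_integral_I hi (fun x => by positivity) zero_mem_I hcI hc0.1.le
    have h3 : ∫ x in (0)..c, -(|w x * f x| + w x ^ 2) ≤
        ∫ x in (0)..c, (w₁ x * w₁ x + w x * (f x + q n x * w x)) := by
      refine intervalIntegral.integral_mono_on hc0.1.le
        (intervalIntegrable_of_integrable_I hi zero_mem_I hcI).neg
        (hm.intervalIntegrable zero_mem_I hcI) fun x _ => ?_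
      nlinarith [neg_half_le_q hn x, neg_abs_le (w x * f x), sq_nonneg (w x), sq_nonneg (w₁ x),
        mul_le_mul_of_nonneg_right (neg_half_le_q hn x) (sq_nonneg (w x))]
    rw [intervalIntegral.integral_neg] at h3
    linarith
  rw [h1] at h2
  have h4 : w₁ c = psi n w w₁ c - (n + 1 / 2) * tan c * w c := by unfold psi; ring
  rw [h4] at h2
  have h5 : w c * psi n w w₁ c ≤ 1 / 2 * w c ^ 2 + 1 / 2 := by
    obtain ⟨ha, hb⟩ := abs_lt.1 hψc
    nlinarith [sq_nonneg (w c - psi n w w₁ c)]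
  have h6 := neg_abs_le (w 0 * w₁ 0)
  have h7 : w c ^ 2 ≤ tan c * w c ^ 2 := le_mul_of_one_le_left (sq_nonneg _) htan
  have h8 : tan c * w c ^ 2 ≤ n * (tan c * w c ^ 2) := le_mul_of_one_le_left (by positivity) hn1
  nlinarith

lemma tendsto_right (h : RealRep n w w₁ f) (hn : 1 ≤ n) :
    Tendsto w (𝓝[<] (π / 2)) (𝓝 0) := by
  obtain ⟨K, hK⟩ := h.tan_mul_sq_bounded hn
  refine tendsto_zero_of_sq (squeeze_zero' (.of_forall fun x => sq_nonneg _) ?_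
    ((tendsto_inv_atTop_zero.comp tendsto_tan_pi_div_two).const_mul K |>.trans_eq ?_))
  · filter_upwards [hK, tendsto_tan_pi_div_two.eventually_gt_atTop 0] with c hc ht
    simp only [Function.comp]
    rw [← div_eq_mul_inv, le_div_iff₀ ht]
    linarith
  · simp

lemma tendsto_left (h : RealRep n w w₁ f) (hn : 1 ≤ n) :
    Tendsto (fun c => w (-c)) (𝓝[<] (π / 2)) (𝓝 0) :=
  h.comp_neg.tendsto_right hn

/-- At both ends the tangent part of the boundary term w w' has a favourable sign and is dropped;
what remains contains ψ and disappears as c → π/2. -/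
lemma energy_aux (h : RealRep n w w₁ f) (hn : 1 ≤ n) {c : ℝ} (hc : c ∈ Ioo 0 (π / 2)) :
    ∫ x in (-c)..c, w₁ x ^ 2 ≤ (∫ x in (-c)..c, (1 / 2 * w x ^ 2 - w x * f x)) +
      (w c * psi n w w₁ c - w (-c) * psi n w w₁ (-c)) := by
  have hcI := mem_I_of_mem_Ioo hc
  have hcI' := neg_mem_I hcI
  have hm := h.ac.mul h.ac₁
  have h1 := hm.int_eq _ hcI' _ hcI
  have hint : IntervalIntegrable (fun x => 1 / 2 * w x ^ 2 - w x * f x) volume (-c) c :=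
    intervalIntegrable_of_integrable_I ((h.memLp.integrable_sq.const_mul _).sub
      h.integrable_mul_op) hcI' hcI
  have h2 : ∫ x in (-c)..c, w₁ x ^ 2 ≤ ∫ x in (-c)..c, ((1 / 2 * w x ^ 2 - w x * f x) +
      (w₁ x * w₁ x + w x * (f x + q n x * w x))) := by
    refine intervalIntegral.integral_mono_on (by linarith [hc.1])
      ((h.continuousOn_deriv.pow 2).mono (uIcc_subset_I hcI' hcI)).intervalIntegrable
      (hint.add (hm.intervalIntegrable hcI' hcI)) fun x _ => ?_
    nlinarith [mul_le_mul_of_nonneg_right (neg_half_le_q hn x) (sq_nonneg (w x))]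
  rw [intervalIntegral.integral_add hint (hm.intervalIntegrable hcI' hcI), h1] at h2
  refine h2.trans ?_
  have ht : 0 ≤ tan c := tan_nonneg_of_nonneg_of_le_pi_div_two hc.1.le hc.2.le
  have h3 : 0 ≤ (n + 1 / 2) * tan c * w c ^ 2 := by positivity
  have h4 : 0 ≤ (n + 1 / 2) * tan c * w (-c) ^ 2 := by positivity
  simp only [psi, tan_neg]
  nlinarith

lemma tendsto_boundary (h : RealRep n w w₁ f) (hn : 1 ≤ n) {u u₁ g : ℝ → ℝ}
    (hu : RealRep n u u₁ g) : Tendsto (fun c => u c * psi n w w₁ c - u (-c) * psi n w w₁ (-c))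
      (𝓝[<] (π / 2)) (𝓝 0) := by
  simpa using ((hu.tendsto_right hn).mul (h.tendsto_psi_right hn)).sub
    ((hu.tendsto_left hn).mul (h.tendsto_psi_left hn))

lemma tendsto_energy_rhs (h : RealRep n w w₁ f) (hn : 1 ≤ n) :
    Tendsto (fun c => (∫ x in (-c)..c, (1 / 2 * w x ^ 2 - w x * f x)) +
      (w c * psi n w w₁ c - w (-c) * psi n w w₁ (-c))) (𝓝[<] (π / 2))
      (𝓝 (∫ x in I, (1 / 2 * w x ^ 2 - w x * f x))) := by
  simpa using (tendsto_intervalIntegral_I ((h.memLp.integrable_sq.const_mul _).sub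
    h.integrable_mul_op)).add (h.tendsto_boundary hn h)

lemma integrable_deriv_sq (h : RealRep n w w₁ f) (hn : 1 ≤ n) :
    Integrable (fun x => w₁ x ^ 2) (volume.restrict I) := by
  refine integrable_of_intervalIntegral_bound (K := (∫ x in I, (1 / 2 * w x ^ 2 - w x * f x)) + 1)
    ((h.continuousOn_deriv.pow 2).locallyIntegrableOn measurableSet_I)
    (fun x _ => sq_nonneg _) ?_
  filter_upwards [eventually_mem_Ioo_right (a := 0) (by positivity),
    (h.tendsto_energy_rhs hn).eventually_lt_const (lt_add_one _)] with c hc h2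
  exact (h.energy_aux hn hc).trans h2.le

lemma memLp_deriv (h : RealRep n w w₁ f) (hn : 1 ≤ n) : MemLp w₁ 2 (volume.restrict I) :=
  (memLp_two_iff_integrable_sq (h.continuousOn_deriv.aestronglyMeasurable measurableSet_I)).2
    (h.integrable_deriv_sq hn)

lemma energy (h : RealRep n w w₁ f) (hn : 1 ≤ n) :
    ∫ x in I, w₁ x ^ 2 ≤ ∫ x in I, (1 / 2 * w x ^ 2 - w x * f x) := by
  refine le_of_tendsto_of_tendsto (tendsto_intervalIntegral_I (h.integrable_deriv_sq hn))
    (h.tendsto_energy_rhs hn) ?_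
  filter_upwards [eventually_mem_Ioo_right (a := 0) (by positivity)] with c hc
  exact h.energy_aux hn hc

/-- The tangent terms cancel in w'u - wu', which becomes ψ_w u - w ψ_u and tends to 0 at the ends.
-/
lemma symm {u u₁ g : ℝ → ℝ} (h : RealRep n w w₁ f) (hu : RealRep n u u₁ g) (hn : 1 ≤ n) :
    ∫ x in I, f x * u x = ∫ x in I, w x * g x := by
  have hi1 : Integrable (fun x => f x * u x) (volume.restrict I) :=
    h.memLp_op.integrable_mul hu.memLp
  have hi2 : Integrable (fun x => w x * g x) (volume.restrict I) :=
    h.memLp.integrable_mul hu.memLp_op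
  have hm := (h.ac₁.mul hu.ac).sub (h.ac.mul hu.ac₁)
  have h1 := tendsto_intervalIntegral_I (hi1.sub hi2)
  have h2 := (h.tendsto_boundary hn hu).sub (hu.tendsto_boundary hn h)
  rw [sub_zero] at h2
  have h3 : ∫ x in I, (f x * u x - w x * g x) = 0 := by
    refine tendsto_nhds_unique h1 (h2.congr' ?_)
    filter_upwards [eventually_mem_Ioo_right (a := 0) (by positivity)] with c hc
    have hcI := mem_I_of_mem_Ioo hc
    have h4 := hm.int_eq _ (neg_mem_I hcI) _ hcI
    have h5 : ∫ x in (-c)..c, (f x * u x - w x * g x) = ∫ x in (-c)..c,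
        ((f x + q n x * w x) * u x + w₁ x * u₁ x - (w₁ x * u₁ x + w x * (g x + q n x * u x))) :=
      intervalIntegral.integral_congr fun x _ => by ring
    simp only [Pi.sub_apply]
    rw [h5, h4]
    unfold psi; ring
  rw [integral_sub hi1 hi2] at h3
  linarith

/-- A Rellich identity with multiplier 2ηw' + η'w. The derivative of ηw'² + η'ww' - ½η''w² - ηqw²
consists of the displayed integrands and of -ηq'w² ≤ 0. Dropping the latter gives an inequality free
of `n`; `boundary_form_ge` handles the boundary. -/
lemma commutator (h : RealRep n w w₁ f) (hn : 1 ≤ n) {η η₁ η₂ η₃ : ℝ → ℝ} {K κ x₀ : ℝ}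
    (hη : ∀ x ∈ I, HasDerivAt η (η₁ x) x) (hη₁ : ∀ x ∈ I, HasDerivAt η₁ (η₂ x) x)
    (hη₂ : ∀ x ∈ I, HasDerivAt η₂ (η₃ x) x) (hη₃ : ContinuousOn η₃ I)
    (b0 : ∀ x ∈ I, |η x| ≤ K) (b1 : ∀ x ∈ I, |η₁ x| ≤ K) (b2 : ∀ x ∈ I, |η₂ x| ≤ K)
    (b3 : ∀ x ∈ I, |η₃ x| ≤ K) (hsign : ∀ x ∈ I, 0 ≤ x * η x) (hκ : 0 < κ) (hx₀ : x₀ < π / 2)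
    (hlow : ∀ x ∈ I, x₀ ≤ |x| → κ ≤ |η x|) :
    ∫ x in I, (1 / 2 * (η₃ x * (w x * w x)) - 2 * (η₁ x * (w₁ x * w₁ x))) ≤
      ∫ x in I, (2 * (η x * (f x * w₁ x)) + η₁ x * (f x * w x)) := by
  have hn1 : (1 : ℝ) ≤ n := by exact_mod_cast hn
  have c0 : ContinuousOn η I := fun x hx => (hη x hx).continuousAt.continuousWithinAt
  have c1 : ContinuousOn η₁ I := fun x hx => (hη₁ x hx).continuousAt.continuousWithinAt
  have c2 : ContinuousOn η₂ I := fun x hx => (hη₂ x hx).continuousAt.continuousWithinAt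
  have m1 := h.memLp_deriv hn
  have hi1 : Integrable (fun x => 1 / 2 * (η₃ x * (w x * w x)) - 2 * (η₁ x * (w₁ x * w₁ x)))
      (volume.restrict I) :=
    ((integrable_bdd_mul hη₃ b3 h.memLp h.memLp).const_mul _).sub
      ((integrable_bdd_mul c1 b1 m1 m1).const_mul _)
  have hi2 : Integrable (fun x => 2 * (η x * (f x * w₁ x)) + η₁ x * (f x * w x))
      (volume.restrict I) :=
    ((integrable_bdd_mul c0 b0 h.memLp_op m1).const_mul _).add
      (integrable_bdd_mul c1 b1 h.memLp_op h.memLp)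
  have a0 := ACD.of_hasDerivAt hη c1
  have a1 := ACD.of_hasDerivAt hη₁ c2
  have a2 := ACD.of_hasDerivAt hη₂ hη₃
  have aq := ACD.of_hasDerivAt (fun x hx => hasDerivAt_q n hx) (continuousOn_q' n)
  have aB := (((a0.mul (h.ac₁.mul h.ac₁)).add (a1.mul (h.ac.mul h.ac₁))).sub
    ((a2.mul (h.ac.mul h.ac)).const_mul (1 / 2))).sub (a0.mul (aq.mul (h.ac.mul h.ac)))
  set α : ℝ := n + 1 / 2 with hα
  set D : ℝ := 2 * K * α + α * K ^ 2 / κ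
  set E : ℝ → ℝ := fun x => psi n w w₁ x ^ 2 + w x ^ 2
  have hE : Tendsto (fun c => (∫ x in (-c)..c, (1 / 2 * (η₃ x * (w x * w x))
      - 2 * (η₁ x * (w₁ x * w₁ x)))) - D * E c - D * E (-c)) (𝓝[<] (π / 2))
      (𝓝 (∫ x in I, (1 / 2 * (η₃ x * (w x * w x)) - 2 * (η₁ x * (w₁ x * w₁ x))))) := by
    have e1 := (((h.tendsto_psi_right hn).pow 2).add ((h.tendsto_right hn).pow 2)).const_mul D
    have e2 := (((h.tendsto_psi_left hn).pow 2).add ((h.tendsto_left hn).pow 2)).const_mul D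
    simpa using ((tendsto_intervalIntegral_I hi1).sub e1).sub e2
  refine le_of_tendsto_of_tendsto hE (tendsto_intervalIntegral_I hi2) ?_
  filter_upwards [eventually_mem_Ioo_right (a := max 0 x₀) (max_lt (by positivity) hx₀)] with c hc
  have hc0 : c ∈ Ioo 0 (π / 2) := ⟨(le_max_left _ _).trans_lt hc.1, hc.2⟩
  have hcx : x₀ ≤ c := (le_max_right _ _).trans hc.1.le
  have hcI := mem_I_of_mem_Ioo hc0
  have hcI' := neg_mem_I hcI
  have hBint := aB.intervalIntegrable hcI' hcI
  have hB := aB.int_eq _ hcI' _ hcI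
  have j1 := intervalIntegrable_of_integrable_I hi1 hcI' hcI
  have j2 := intervalIntegrable_of_integrable_I hi2 hcI' hcI
  have hmono := intervalIntegral.integral_mono_on (a := -c) (b := c) (by linarith [hc0.1])
    (hBint.add j1) j2 (fun x hx => by
      have hxI : x ∈ I := uIcc_subset_I hcI' hcI (by rwa [uIcc_of_le (by linarith [hc0.1])])
      have := mul_nonneg (q'_mul_nonneg hn hxI (hsign x hxI)) (sq_nonneg (w x))
      nlinarith)
  rw [intervalIntegral.integral_add hBint j1, hB] at hmono
  have hw₁ : ∀ x, w₁ x = psi n w w₁ x - α * tan x * w x := fun x => by unfold psi; ring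
  have hq : ∀ x, q n x = α * (α - 1) * tan x ^ 2 - 1 / 2 := fun x => by unfold q; rw [hα]; ring
  have hηc : κ ≤ η c := by
    have h1 := hlow c hcI (by rwa [abs_of_pos hc0.1])
    have h2 : 0 ≤ η c := nonneg_of_mul_nonneg_right (hsign c hcI) hc0.1
    rwa [abs_of_nonneg h2] at h1
  have hηc' : κ ≤ -η (-c) := by
    have h1 := hlow (-c) hcI' (by rwa [abs_neg, abs_of_pos hc0.1])
    have h2 : 0 ≤ -η (-c) := by
      refine nonneg_of_mul_nonneg_right (a := c) ?_ hc0.1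
      have := hsign (-c) hcI'
      linarith
    rwa [abs_of_nonpos (by linarith)] at h1
  have g1 := boundary_form_ge (t := tan c) (w := w c) (ψ := psi n w w₁ c) hκ hηc
    ((le_abs_self _).trans (b0 c hcI)) (b1 c hcI) (b2 c hcI) (by rw [hα]; linarith : 1 ≤ α)
  -- At the left end η is negative and the boundary term is subtracted, so the same bound applies to
  -- -η, -η₁, -η₂.
  have g2 := boundary_form_ge (t := tan (-c)) (w := w (-c)) (ψ := psi n w w₁ (-c)) hκ hηc'
    ((neg_le_abs _).trans (b0 _ hcI')) ((abs_neg _).trans_le (b1 _ hcI'))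
    ((abs_neg _).trans_le (b2 _ hcI')) (by rw [hα]; linarith : 1 ≤ α)
  rw [← hw₁, ← hq] at g1 g2
  simp only [E, D]
  linarith

lemma potential_term (h : RealRep n w w₁ f) (hn : 1 ≤ n) {η η₁ γ γ₁ : ℝ → ℝ} {K : ℝ}
    (hη : ∀ x ∈ I, HasDerivAt η (η₁ x) x) (hη₁ : ContinuousOn η₁ I)
    (hγ : ∀ x ∈ I, HasDerivAt γ (γ₁ x) x) (hγ₁ : ContinuousOn γ₁ I)
    (b0 : ∀ x ∈ I, |η x| ≤ K) (b1 : ∀ x ∈ I, |η₁ x| ≤ K) (d0 : ∀ x ∈ I, |γ x| ≤ K)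
    (d1 : ∀ x ∈ I, |γ₁ x| ≤ K) :
    ∫ x in I, (2 * (γ x * η x * (w x * w₁ x)) + γ x * η₁ x * (w x * w x)) =
      -∫ x in I, γ₁ x * η x * (w x * w x) := by
  have c0 : ContinuousOn η I := fun x hx => (hη x hx).continuousAt.continuousWithinAt
  have cγ : ContinuousOn γ I := fun x hx => (hγ x hx).continuousAt.continuousWithinAt
  have m1 := h.memLp_deriv hn
  have hK : 0 ≤ K := (abs_nonneg _).trans (b0 0 zero_mem_I)
  have bd : ∀ {φ₁ φ₂ : ℝ → ℝ}, (∀ x ∈ I, |φ₁ x| ≤ K) → (∀ x ∈ I, |φ₂ x| ≤ K) →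
      ∀ x ∈ I, |φ₁ x * φ₂ x| ≤ K * K := fun h1 h2 x hx => by
    rw [abs_mul]; exact mul_le_mul (h1 x hx) (h2 x hx) (abs_nonneg _) hK
  have hi1 : Integrable (fun x => 2 * (γ x * η x * (w x * w₁ x)) + γ x * η₁ x * (w x * w x))
      (volume.restrict I) :=
    ((integrable_bdd_mul (cγ.mul c0) (bd d0 b0) h.memLp m1).const_mul _).add
      (integrable_bdd_mul (cγ.mul hη₁) (bd d0 b1) h.memLp h.memLp)
  have hi2 : Integrable (fun x => γ₁ x * η x * (w x * w x)) (volume.restrict I) :=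
    integrable_bdd_mul (hγ₁.mul c0) (bd d1 b0) h.memLp h.memLp
  have aB := ((ACD.of_hasDerivAt hγ hγ₁).mul (ACD.of_hasDerivAt hη hη₁)).mul (h.ac.mul h.ac)
  have h1 := tendsto_intervalIntegral_I (hi1.add hi2)
  have hbd : ∀ x ∈ I, |γ x * η x * (w x * w x)| ≤ K * K * (w x * w x) := fun x hx => by
    rw [abs_mul, abs_mul_self (w x)]
    exact mul_le_mul_of_nonneg_right (bd d0 b0 x hx) (mul_self_nonneg _)
  have hpos : ∀ᶠ c in 𝓝[<] (π / 2), c ∈ Ioo 0 (π / 2) := eventually_mem_Ioo_right (by positivity)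
  have t1 : Tendsto (fun c => γ c * η c * (w c * w c)) (𝓝[<] (π / 2)) (𝓝 0) := by
    refine squeeze_zero_norm' ?_ (by
      simpa using ((h.tendsto_right hn).mul (h.tendsto_right hn)).const_mul (K * K))
    filter_upwards [hpos] with c hc using hbd c (mem_I_of_mem_Ioo hc)
  have t2 : Tendsto (fun c => γ (-c) * η (-c) * (w (-c) * w (-c))) (𝓝[<] (π / 2)) (𝓝 0) := by
    refine squeeze_zero_norm' ?_ (by
      simpa using ((h.tendsto_left hn).mul (h.tendsto_left hn)).const_mul (K * K))
    filter_upwards [hpos] with c hc using hbd _ (neg_mem_I (mem_I_of_mem_Ioo hc))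
  have h3 : ∫ x in I, (2 * (γ x * η x * (w x * w₁ x)) + γ x * η₁ x * (w x * w x)
      + γ₁ x * η x * (w x * w x)) = 0 := by
    have t := t1.sub t2
    rw [sub_zero] at t
    refine tendsto_nhds_unique h1 (t.congr' ?_)
    filter_upwards [hpos] with c hc
    have hcI := mem_I_of_mem_Ioo hc
    rw [← aB.int_eq _ (neg_mem_I hcI) _ hcI]
    refine intervalIntegral.integral_congr fun x _ => ?_
    simp only [Pi.add_apply]; ring
  rw [integral_add hi1 hi2] at h3
  linarith

/-- Integrate (χww' - ½χ'w²)' with χ = (b² - x²)²; both χ and χ' vanish at ±b. The term b⁴/2 comes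
from -qχ ≤ χ/2 and 4b² from ½χ'' = 6x² - 2b² ≤ 4b². -/
lemma caccioppoli (h : RealRep n w w₁ f) (hn : 1 ≤ n) {b : ℝ} (hb : b ∈ Ioo 0 (π / 2)) :
    ∫ x in (-b)..b, (b ^ 2 - x ^ 2) ^ 2 * (w₁ x * w₁ x) ≤
      (∫ x in (-b)..b, -((b ^ 2 - x ^ 2) ^ 2 * (f x * w x))) +
        (b ^ 4 / 2 + 4 * b ^ 2) * ∫ x in (-b)..b, w x * w x := by
  have hbI := mem_I_of_mem_Ioo hb
  have hbI' := neg_mem_I hbI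
  have hss := uIcc_subset_I hbI' hbI
  have dχ : ∀ x : ℝ, HasDerivAt (fun x => (b ^ 2 - x ^ 2) ^ 2) (-(4 * x * (b ^ 2 - x ^ 2))) x :=
    fun x => by
      refine (((hasDerivAt_id x).pow 2).const_sub (b ^ 2) |>.pow 2).congr_deriv ?_
      simp; ring
  have dχ₁ : ∀ x : ℝ, HasDerivAt (fun x => -(4 * x * (b ^ 2 - x ^ 2)))
      (12 * x ^ 2 - 4 * b ^ 2) x := fun x => by
    refine ((((hasDerivAt_id x).const_mul 4).mul
      (((hasDerivAt_id x).pow 2).const_sub (b ^ 2))).neg).congr_deriv ?_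
    simp; ring
  have aχ := ACD.of_hasDerivAt (fun x _ => dχ x) (by fun_prop)
  have aχ₁ := ACD.of_hasDerivAt (fun x _ => dχ₁ x) (by fun_prop)
  have aB := (aχ.mul (h.ac.mul h.ac₁)).sub ((aχ₁.mul (h.ac.mul h.ac)).const_mul (1 / 2))
  have hB := aB.int_eq _ hbI' _ hbI
  have hBi := aB.intervalIntegrable hbI' hbI
  have cw := h.continuousOn.mono hss
  have cw₁ := h.continuousOn_deriv.mono hss
  have j1 : IntervalIntegrable (fun x => (b ^ 2 - x ^ 2) ^ 2 * (w₁ x * w₁ x)) volume (-b) b :=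
    ContinuousOn.intervalIntegrable (by fun_prop)
  have j2 : IntervalIntegrable (fun x => -((b ^ 2 - x ^ 2) ^ 2 * (f x * w x))) volume (-b) b :=
    ((intervalIntegrable_of_integrable_I (h.memLp_op.integrable_mul h.memLp)
      hbI' hbI).continuousOn_mul (by fun_prop)).neg
  have j3 : IntervalIntegrable (fun x => (b ^ 4 / 2 + 4 * b ^ 2) * (w x * w x)) volume (-b) b :=
    ContinuousOn.intervalIntegrable (by fun_prop)
  rw [← intervalIntegral.integral_const_mul, ← intervalIntegral.integral_add j2 j3]
  have hmono := intervalIntegral.integral_mono_on (a := -b) (b := b) (by linarith [hb.1])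
    j1 (hBi.add (j2.add j3)) (fun x hx => by
      have hxb : x ^ 2 ≤ b ^ 2 := sq_le_sq' hx.1 hx.2
      have hχ : (b ^ 2 - x ^ 2) ^ 2 ≤ b ^ 4 := by nlinarith [sq_nonneg x, sq_nonneg b]
      have hw := mul_self_nonneg (w x)
      have e1 := mul_le_mul_of_nonneg_right (neg_half_le_q hn x)
        (mul_nonneg (sq_nonneg (b ^ 2 - x ^ 2)) hw)
      have e2 := mul_le_mul_of_nonneg_right hχ hw
      have e3 := mul_le_mul_of_nonneg_right hxb hw
      nlinarith)
  rw [intervalIntegral.integral_add hBi (j2.add j3), hB] at hmono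
  refine hmono.trans (le_of_eq ?_)
  ring_nf

end RealRep

/-! ### Complex-valued domain elements and their representatives. -/

/-- Lebesgue measure on `I`. -/
abbrev μI : Measure ℝ := volume.restrict I

section ComplexRep

variable {u u' : ℝ → ℂ}

lemma HasLocACDeriv.re (h : HasLocACDeriv u u') :
    ACD (fun x => (u x).re) (fun x => (u' x).re) where
  locInt := fun x hx => by
    obtain ⟨s, hs, hi⟩ := h.1 x hx
    exact ⟨s, hs, hi.re⟩
  int_eq := fun x hx y hy => by
    have h1 := Complex.reCLM.intervalIntegral_comp_comm (intervalIntegrable_of_mem h.1 hx hy)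
    simp only [Complex.reCLM_apply] at h1
    rw [h1, h.2 x hx y hy, Complex.sub_re]

lemma HasLocACDeriv.im (h : HasLocACDeriv u u') :
    ACD (fun x => (u x).im) (fun x => (u' x).im) where
  locInt := fun x hx => by
    obtain ⟨s, hs, hi⟩ := h.1 x hx
    exact ⟨s, hs, hi.im⟩
  int_eq := fun x hx y hy => by
    have h1 := Complex.imCLM.intervalIntegral_comp_comm (intervalIntegrable_of_mem h.1 hx hy)
    simp only [Complex.imCLM_apply] at h1
    rw [h1, h.2 x hx y hy, Complex.sub_im]

lemma hasLocACDeriv_of_re_im (hr : ACD (fun x => (u x).re) (fun x => (u' x).re))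
    (hi : ACD (fun x => (u x).im) (fun x => (u' x).im)) : HasLocACDeriv u u' := by
  have hl : LocallyIntegrableOn u' I := by
    rw [locallyIntegrableOn_iff isOpen_I.isLocallyClosed]
    intro k hk hkc
    have h1 : IntegrableOn (fun x => ((u' x).re : ℂ)) k :=
      (hr.locInt.integrableOn_compact_subset hk hkc).ofReal
    have h2 : IntegrableOn (fun x => ((u' x).im : ℂ)) k :=
      (hi.locInt.integrableOn_compact_subset hk hkc).ofReal
    exact (h1.add (h2.mul_const Complex.I)).congr
      (.of_forall fun x => Complex.re_add_im (u' x))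
  refine ⟨hl, fun x hx y hy => ?_⟩
  have hint := intervalIntegrable_of_mem hl hx hy
  apply Complex.ext
  · have h1 := Complex.reCLM.intervalIntegral_comp_comm hint
    simp only [Complex.reCLM_apply] at h1
    rw [← h1, hr.2 x hx y hy, Complex.sub_re]
  · have h1 := Complex.imCLM.intervalIntegral_comp_comm hint
    simp only [Complex.imCLM_apply] at h1
    rw [← h1, hi.2 x hx y hy, Complex.sub_im]

/-- `w` is an element of the domain of `M_n`, with derivative `w₁` and `M_n w = f`. -/
structure ComplexRep (n : ℕ) (w w₁ f : ℝ → ℂ) : Prop where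
  ac : HasLocACDeriv w w₁
  ac₁ : HasLocACDeriv w₁ (fun x => f x + (q n x : ℂ) * w x)
  memLp : MemLp w 2 μI
  memLp_op : MemLp f 2 μI

namespace ComplexRep

variable {n : ℕ} {w w₁ f v v₁ g : ℝ → ℂ}

lemma re (h : ComplexRep n w w₁ f) :
    RealRep n (fun x => (w x).re) (fun x => (w₁ x).re) (fun x => (f x).re) where
  ac := h.ac.re
  ac₁ := by simpa using h.ac₁.re
  memLp := h.memLp.re
  memLp_op := h.memLp_op.re

lemma im (h : ComplexRep n w w₁ f) :
    RealRep n (fun x => (w x).im) (fun x => (w₁ x).im) (fun x => (f x).im) where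
  ac := h.ac.im
  ac₁ := by simpa using h.ac₁.im
  memLp := h.memLp.im
  memLp_op := h.memLp_op.im

lemma add (hw : ComplexRep n w w₁ f) (hv : ComplexRep n v v₁ g) :
    ComplexRep n (fun x => w x + v x) (fun x => w₁ x + v₁ x) (fun x => f x + g x) where
  ac := hw.ac.add hv.ac
  ac₁ := by
    have h := hw.ac₁.add hv.ac₁
    have e : (fun x => f x + g x + (q n x : ℂ) * (w x + v x)) =
      fun x => f x + (q n x : ℂ) * w x + (g x + (q n x : ℂ) * v x) := by funext x; ring
    rwa [e]
  memLp := hw.memLp.add hv.memLp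
  memLp_op := hw.memLp_op.add hv.memLp_op

lemma const_mul (c : ℂ) (hw : ComplexRep n w w₁ f) :
    ComplexRep n (fun x => c * w x) (fun x => c * w₁ x) (fun x => c * f x) where
  ac := hw.ac.const_mul c
  ac₁ := by
    have h := hw.ac₁.const_mul c
    have e : (fun x => c * f x + (q n x : ℂ) * (c * w x)) =
      fun x => c * (f x + (q n x : ℂ) * w x) := by funext x; ring
    rwa [e]
  memLp := hw.memLp.const_mul c
  memLp_op := hw.memLp_op.const_mul c

lemma deriv_unique (hw : ComplexRep n w w₁ f) (hv : ComplexRep n v v₁ g)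
    (h : w =ᵐ[μI] v) : w₁ =ᵐ[μI] v₁ := by
  have key : ∀ {a a₁ c b b₁ d : ℝ → ℝ}, RealRep n a a₁ c → RealRep n b b₁ d → a =ᵐ[μI] b →
      ∀ x ∈ I, a₁ x = b₁ x := by
    intro a a₁ c b b₁ d ha hb hab x hx
    have h1 := Measure.eqOn_open_of_ae_eq hab isOpen_I ha.continuousOn hb.continuousOn
    exact (ha.hasDerivAt hx).unique ((hb.hasDerivAt hx).congr_of_eventuallyEq
      (h1.eventuallyEq_of_mem (isOpen_I.mem_nhds hx)))
  refine (ae_restrict_iff' measurableSet_I).2 (.of_forall fun x hx => Complex.ext ?_ ?_)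
  · exact key hw.re hv.re (by filter_upwards [h] with x hx; rw [hx]) x hx
  · exact key hw.im hv.im (by filter_upwards [h] with x hx; rw [hx]) x hx

lemma memLp_deriv (hn : 1 ≤ n) (h : ComplexRep n w w₁ f) : MemLp w₁ 2 μI := by
  have h1 := (h.re.memLp_deriv hn).ofReal (K := ℂ)
  have h2 := ((h.im.memLp_deriv hn).ofReal (K := ℂ)).mul_const Complex.I
  refine (h1.add h2).ae_eq (.of_forall fun x => ?_)
  exact Complex.re_add_im (w₁ x)

/-- Stability of the domain under conjugation by the weight: the new term 2ρ'w' is square integrable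
by `memLp_deriv`. -/
lemma mul_real {ρ ρ₁ ρ₂ : ℝ →ᵇ ℝ} (hn : 1 ≤ n) (hw : ComplexRep n w w₁ f)
    (h1 : ∀ x, HasDerivAt ρ (ρ₁ x) x) (h2 : ∀ x, HasDerivAt ρ₁ (ρ₂ x) x) :
    ComplexRep n (fun x => (ρ x : ℂ) * w x) (fun x => (ρ x : ℂ) * w₁ x + (ρ₁ x : ℂ) * w x)
      (fun x => (ρ x : ℂ) * f x + 2 * ((ρ₁ x : ℂ) * w₁ x) + (ρ₂ x : ℂ) * w x) := by
  have a1 := ACD.of_hasDerivAt (fun x _ => h1 x) ρ₁.continuous.continuousOn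
  have a2 := ACD.of_hasDerivAt (fun x _ => h2 x) ρ₂.continuous.continuousOn
  have hb : ∀ (φ : ℝ →ᵇ ℝ) {v : ℝ → ℂ}, MemLp v 2 μI → MemLp (fun x => (φ x : ℂ) * v x) 2 μI := by
    intro φ v hv
    refine MemLp.of_le_mul (c := ‖φ‖) hv ?_ (.of_forall fun x => ?_)
    · exact (Complex.continuous_ofReal.comp φ.continuous).aestronglyMeasurable.mul
        hv.aestronglyMeasurable
    · rw [norm_mul, Complex.norm_real]
      gcongr
      exact φ.norm_coe_le_norm x
  have hr := hw.re
  have hi := hw.im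
  refine ⟨hasLocACDeriv_of_re_im ?_ ?_, hasLocACDeriv_of_re_im ?_ ?_, hb ρ hw.memLp, ?_⟩
  · refine ((a1.mul hr.ac).congr_left fun x _ => by simp).congr_right fun x _ => by simp; ring
  · refine ((a1.mul hi.ac).congr_left fun x _ => by simp).congr_right fun x _ => by simp; ring
  · refine (((a1.mul hr.ac₁).add (a2.mul hr.ac)).congr_left fun x _ => by simp).congr_right
      fun x _ => by simp; ring
  · refine (((a1.mul hi.ac₁).add (a2.mul hi.ac)).congr_left fun x _ => by simp).congr_right
      fun x _ => by simp; ring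
  · exact ((hb ρ hw.memLp_op).add ((hb ρ₁ (hw.memLp_deriv hn)).const_mul 2)).add (hb ρ₂ hw.memLp)

end ComplexRep

end ComplexRep

namespace DomM

variable {n : ℕ}

lemma exists_rep (p : DomM n) : ∃ w f : ℝ → ℂ, w =ᵐ[μI] p.toL2 ∧ f =ᵐ[μI] p.op ∧
    ComplexRep n w p.dx f := by
  obtain ⟨⟨w, hw, hac⟩, w₂, hac₁, hop⟩ := Classical.choose_spec p.2
  have hop' : (fun x => w₂ x - (q n x : ℂ) * w x) =ᵐ[μI] p.op := by
    filter_upwards [hw, hop] with x h1 h2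
    rw [h1]; exact h2.symm
  refine ⟨w, fun x => w₂ x - (q n x : ℂ) * w x, hw, hop', hac, ?_, ?_, ?_⟩
  · have e : (fun x => w₂ x - (q n x : ℂ) * w x + (q n x : ℂ) * w x) = w₂ := by funext x; ring
    rw [e]; exact hac₁
  · exact (memLp_congr_ae hw).2 (Lp.memLp _)
  · exact (memLp_congr_ae hop').2 (Lp.memLp _)

lemma exists_of_rep {w w₁ f : ℝ → ℂ} (h : ComplexRep n w w₁ f) :
    ∃ p : DomM n, w =ᵐ[μI] p.toL2 ∧ f =ᵐ[μI] p.op := by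
  have h1 := h.memLp.coeFn_toLp
  have h2 := h.memLp_op.coeFn_toLp
  refine ⟨⟨(h.memLp.toLp w, h.memLp_op.toLp f), w₁, ⟨w, h1.symm, h.ac⟩, _, h.ac₁, ?_⟩,
    h1.symm, h2.symm⟩
  filter_upwards [h1, h2] with x h3 h4
  rw [h3, h4]; ring

lemma dx_ae_eq {p : DomM n} {w w₁ f : ℝ → ℂ} (h : ComplexRep n w w₁ f) (hw : w =ᵐ[μI] p.toL2) :
    p.dx =ᵐ[μI] w₁ := by
  obtain ⟨v, g, hv, -, hp⟩ := p.exists_rep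
  exact hp.deriv_unique h (hv.trans hw.symm)

lemma memLp_dx (hn : 1 ≤ n) (p : DomM n) : MemLp p.dx 2 μI := by
  obtain ⟨v, g, -, -, hp⟩ := p.exists_rep
  exact hp.memLp_deriv hn

end DomM

/-! ### Weighted quadratic forms on the Hilbert space. -/

section Forms

/-- Multiplication by bounded continuous functions on `L²`. -/
def mulL : (ℝ →ᵇ ℝ) →L[ℝ] (L2 →L[ℝ] L2) :=
  ((ContinuousLinearMap.lsmul ℝ ℝ : ℝ →L[ℝ] ℂ →L[ℝ] ℂ).holderL μI ∞ 2 2).comp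
    (BoundedContinuousFunction.toLp ∞ μI ℝ)

lemma coeFn_mulL (φ : ℝ →ᵇ ℝ) (A : L2) : mulL φ A =ᵐ[μI] fun x => (φ x : ℂ) * A x := by
  have h1 := (ContinuousLinearMap.lsmul ℝ ℝ : ℝ →L[ℝ] ℂ →L[ℝ] ℂ).coeFn_holder (r := 2)
    (BoundedContinuousFunction.toLp ∞ μI ℝ φ) A
  have h2 := BoundedContinuousFunction.coeFn_toLp (p := ∞) (𝕜 := ℝ) μI φ
  filter_upwards [h1, h2] with x h3 h4
  refine h3.trans ?_
  rw [h4]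
  simp

lemma mulL_mul (φ ψ : ℝ →ᵇ ℝ) (A : L2) : mulL (φ * ψ) A = mulL φ (mulL ψ A) := by
  apply Lp.ext
  filter_upwards [coeFn_mulL (φ * ψ) A, coeFn_mulL φ (mulL ψ A), coeFn_mulL ψ A] with x h1 h2 h3
  rw [h1, h2, h3]
  simp [mul_assoc]

lemma mulL_one (A : L2) : mulL 1 A = A := by
  apply Lp.ext
  filter_upwards [coeFn_mulL 1 A] with x h1
  simp [h1]

/-- The form `∫ φ Re (A conj B)`. -/
def form (φ : ℝ →ᵇ ℝ) (A B : L2) : ℝ := inner ℝ (mulL φ A) B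

lemma form_eq {φ : ℝ →ᵇ ℝ} {A B : L2} {a b : ℝ → ℂ} (ha : a =ᵐ[μI] A) (hb : b =ᵐ[μI] B) :
    form φ A B = (∫ x in I, φ x * ((a x).re * (b x).re)) +
      ∫ x in I, φ x * ((a x).im * (b x).im) := by
  have ha' : MemLp a 2 μI := (memLp_congr_ae ha).2 (Lp.memLp _)
  have hb' : MemLp b 2 μI := (memLp_congr_ae hb).2 (Lp.memLp _)
  have i1 : Integrable (fun x => φ x * ((a x).re * (b x).re)) μI :=
    integrable_bdd_mul φ.continuous.continuousOn (fun x _ => φ.norm_coe_le_norm x) ha'.re hb'.re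
  have i2 : Integrable (fun x => φ x * ((a x).im * (b x).im)) μI :=
    integrable_bdd_mul φ.continuous.continuousOn (fun x _ => φ.norm_coe_le_norm x) ha'.im hb'.im
  rw [form, L2.inner_def, ← integral_add i1 i2]
  refine integral_congr_ae ?_
  filter_upwards [ha, hb, coeFn_mulL φ A] with x h1 h2 h3
  rw [h1, h2, h3, Complex.inner]
  simp
  ring

lemma form_one (A B : L2) : form 1 A B = inner ℝ A B := by rw [form, mulL_one]

lemma form_symm (φ : ℝ →ᵇ ℝ) (A B : L2) : form φ A B = form φ B A := by
  rw [form_eq (φ := φ) (A := A) (B := B) .rfl .rfl, form_eq (φ := φ) (A := B) (B := A) .rfl .rfl]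
  simp only [mul_comm]

lemma form_eq_right (φ : ℝ →ᵇ ℝ) (A B : L2) : form φ A B = inner ℝ A (mulL φ B) := by
  rw [form_symm, form, real_inner_comm]

lemma form_mul (φ ψ : ℝ →ᵇ ℝ) (A B : L2) : inner ℝ (mulL φ A) (mulL ψ B) = form (φ * ψ) A B := by
  rw [← form_eq_right, form, form, ← mulL_mul, mul_comm]

lemma form_mono {φ ψ : ℝ →ᵇ ℝ} (h : ∀ x ∈ I, φ x ≤ ψ x) (A : L2) : form φ A A ≤ form ψ A A := by
  have hA : MemLp A 2 μI := Lp.memLp A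
  have ci : ∀ (φ : ℝ →ᵇ ℝ), Integrable (fun x => φ x * ((A x).re * (A x).re)) μI ∧
      Integrable (fun x => φ x * ((A x).im * (A x).im)) μI := fun φ =>
    ⟨integrable_bdd_mul φ.continuous.continuousOn (fun x _ => φ.norm_coe_le_norm x) hA.re hA.re,
      integrable_bdd_mul φ.continuous.continuousOn (fun x _ => φ.norm_coe_le_norm x) hA.im hA.im⟩
  rw [form_eq (φ := φ) (A := A) (B := A) .rfl .rfl, form_eq (φ := ψ) (A := A) (B := A) .rfl .rfl]
  refine add_le_add (setIntegral_mono_on (ci φ).1 (ci ψ).1 measurableSet_I fun x hx => ?_)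
    (setIntegral_mono_on (ci φ).2 (ci ψ).2 measurableSet_I fun x hx => ?_)
  · exact mul_le_mul_of_nonneg_right (h x hx) (mul_self_nonneg _)
  · exact mul_le_mul_of_nonneg_right (h x hx) (mul_self_nonneg _)

lemma form_add_left (φ ψ : ℝ →ᵇ ℝ) (A B : L2) : form (φ + ψ) A B = form φ A B + form ψ A B := by
  simp [form, inner_add_left]

lemma form_smul_left (c : ℝ) (φ : ℝ →ᵇ ℝ) (A B : L2) : form (c • φ) A B = c * form φ A B := by
  simp [form, real_inner_smul_left]

/-- The mass of `A` on the observation interval `(-b, b)`. -/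
def obs (b : ℝ) (A : L2) : ℝ := ∫ x in Ioo (-b) b, ‖A x‖ ^ 2

end Forms

/-! ### The derivative as an operator, the cutoff, and the identities on the domain. -/

lemma norm_dx_le {n : ℕ} (hn : 1 ≤ n) (p : DomM n) :
    ‖(p.memLp_dx hn).toLp p.dx‖ ^ 2 ≤ 1 / 2 * ‖p.toL2‖ ^ 2 - inner ℝ p.toL2 p.op := by
  obtain ⟨w, f, hw, hf, hp⟩ := p.exists_rep
  have hd := (p.memLp_dx hn).coeFn_toLp
  rw [← real_inner_self_eq_norm_sq, ← real_inner_self_eq_norm_sq, ← form_one, ← form_one,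
    ← form_one, form_eq hd.symm hd.symm, form_eq hw hw, form_eq hw hf]
  have e1 := hp.re.energy hn
  have e2 := hp.im.energy hn
  rw [integral_sub (hp.re.memLp.integrable_sq.const_mul _) hp.re.integrable_mul_op,
    integral_const_mul] at e1
  rw [integral_sub (hp.im.memLp.integrable_sq.const_mul _) hp.im.integrable_mul_op,
    integral_const_mul] at e2
  simp only [BoundedContinuousFunction.coe_one, Pi.one_apply, one_mul, ← sq]
  linarith

/-- The derivative as a bounded operator from the domain of `M_n` to `L²`. -/
def dxL {n : ℕ} (hn : 1 ≤ n) : DomM n →L[ℝ] L2 :=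
  LinearMap.mkContinuous
    { toFun := fun p => (p.memLp_dx hn).toLp p.dx
      map_add' := fun p r => by
        rw [← MemLp.toLp_add]
        apply MemLp.toLp_congr
        obtain ⟨w, f, hw, hf, hp⟩ := p.exists_rep
        obtain ⟨v, g, hv, hg, hr⟩ := r.exists_rep
        refine DomM.dx_ae_eq (hp.add hr) ?_
        filter_upwards [hw, hv, Lp.coeFn_add p.toL2 r.toL2] with x h1 h2 h3
        exact (h1 ▸ h2 ▸ h3.symm : w x + v x = (p.toL2 + r.toL2) x)
      map_smul' := fun c p => by
        rw [RingHom.id_apply, ← MemLp.toLp_const_smul]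
        apply MemLp.toLp_congr
        obtain ⟨w, f, hw, hf, hp⟩ := p.exists_rep
        have : (c • p.dx) = fun x => (c : ℂ) * p.dx x := by funext x; simp
        rw [this]
        refine DomM.dx_ae_eq (hp.const_mul c) ?_
        filter_upwards [hw, Lp.coeFn_smul c p.toL2] with x h1 h3
        rw [h1]
        refine Eq.trans ?_ h3.symm
        simp }
    -- The energy inequality gives ‖w'‖² ≤ (3/2)‖p‖² in the graph norm, so 2 is an admissible
    -- operator bound.
    2 (fun p => by
      have h := norm_dx_le hn p
      have h1 : ‖p.toL2‖ ≤ ‖p‖ := norm_fst_le p.1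
      have h2 : ‖p.op‖ ≤ ‖p‖ := norm_snd_le p.1
      have h3 := abs_le.1 (abs_real_inner_le_norm p.toL2 p.op)
      have h4 : ‖p.toL2‖ * ‖p.op‖ ≤ ‖p‖ * ‖p‖ := by gcongr
      have h5 : ‖p.toL2‖ ^ 2 ≤ ‖p‖ ^ 2 := by gcongr
      refine (pow_le_pow_iff_left₀ (norm_nonneg _) (by positivity) two_ne_zero).1 (h.trans ?_)
      nlinarith [h3.1, sq_nonneg ‖p‖])

lemma coeFn_dxL {n : ℕ} (hn : 1 ≤ n) (p : DomM n) : dxL hn p =ᵐ[μI] p.dx :=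
  (p.memLp_dx hn).coeFn_toLp

/-- The cutoff `(b² - x²)₊²`. -/
def cutoff (b : ℝ) : ℝ →ᵇ ℝ :=
  BoundedContinuousFunction.ofNormedAddCommGroup (fun x => max (b ^ 2 - x ^ 2) 0 ^ 2)
    (by fun_prop) (b ^ 4) (fun x => by
      rw [norm_of_nonneg (by positivity)]
      have h : max (b ^ 2 - x ^ 2) 0 ≤ b ^ 2 := max_le (by linarith [sq_nonneg x]) (sq_nonneg b)
      calc max (b ^ 2 - x ^ 2) 0 ^ 2 ≤ (b ^ 2) ^ 2 := by gcongr
        _ = b ^ 4 := by ring)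

lemma cutoff_apply (b x : ℝ) : cutoff b x = max (b ^ 2 - x ^ 2) 0 ^ 2 := rfl

lemma cutoff_nonneg (b x : ℝ) : 0 ≤ cutoff b x := sq_nonneg _

lemma cutoff_le (b x : ℝ) : cutoff b x ≤ b ^ 4 := by
  have h : max (b ^ 2 - x ^ 2) 0 ≤ b ^ 2 := max_le (by linarith [sq_nonneg x]) (sq_nonneg b)
  calc max (b ^ 2 - x ^ 2) 0 ^ 2 ≤ (b ^ 2) ^ 2 := by gcongr
    _ = b ^ 4 := by ring

lemma Ioc_neg_subset_I {b : ℝ} (hb : b ∈ Ioo 0 (π / 2)) : Ioc (-b) b ⊆ I := fun x hx =>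
  ⟨by linarith [hx.1, hb.2], by linarith [hx.2, hb.2]⟩

lemma integral_cutoff_mul {b : ℝ} (hb : b ∈ Ioo 0 (π / 2)) (g : ℝ → ℝ) :
    ∫ x in I, cutoff b x * g x = ∫ x in (-b)..b, (b ^ 2 - x ^ 2) ^ 2 * g x := by
  rw [intervalIntegral.integral_of_le (by linarith [hb.1]),
    setIntegral_eq_of_subset_of_forall_sdiff_eq_zero measurableSet_I (Ioc_neg_subset_I hb)]
  · refine setIntegral_congr_fun measurableSet_Ioc fun x hx => ?_
    have : x ^ 2 ≤ b ^ 2 := sq_le_sq' hx.1.le hx.2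
    simp only [cutoff_apply]
    rw [max_eq_left (by linarith)]
  · intro x hx
    have : b ^ 2 - x ^ 2 ≤ 0 := by
      by_contra! h
      have := abs_lt_of_sq_lt_sq' (by linarith : x ^ 2 < b ^ 2) hb.1.le
      exact hx.2 ⟨this.1, this.2.le⟩
    rw [cutoff_apply, max_eq_right this]
    simp

lemma obs_eq {b : ℝ} (hb : b ∈ Ioo 0 (π / 2)) {A : L2} {a : ℝ → ℂ} (ha : a =ᵐ[μI] A) :
    obs b A = (∫ x in (-b)..b, (a x).re * (a x).re) + ∫ x in (-b)..b, (a x).im * (a x).im := by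
  have ha' : MemLp a 2 μI := (memLp_congr_ae ha).2 (Lp.memLp _)
  have i1 : Integrable (fun x => (a x).re * (a x).re) (volume.restrict (Ioc (-b) b)) :=
    IntegrableOn.mono_set (ha'.re.integrable_mul ha'.re) (Ioc_neg_subset_I hb)
  have i2 : Integrable (fun x => (a x).im * (a x).im) (volume.restrict (Ioc (-b) b)) :=
    IntegrableOn.mono_set (ha'.im.integrable_mul ha'.im) (Ioc_neg_subset_I hb)
  rw [obs, ← integral_Ioc_eq_integral_Ioo, intervalIntegral.integral_of_le (by linarith [hb.1]),
    intervalIntegral.integral_of_le (by linarith [hb.1]), ← integral_add i1 i2]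
  refine integral_congr_ae ?_
  filter_upwards [ae_restrict_of_ae_restrict_of_subset (Ioc_neg_subset_I hb) ha] with x hx
  rw [← hx, Complex.sq_norm, Complex.normSq_apply]

lemma form_cutoff_le {b : ℝ} (hb : b ∈ Ioo 0 (π / 2)) (A : L2) :
    form (cutoff b) A A ≤ b ^ 4 * obs b A := by
  rw [form_eq (φ := cutoff b) (A := A) (B := A) .rfl .rfl, obs_eq hb (A := A) .rfl,
    integral_cutoff_mul hb, integral_cutoff_mul hb, mul_add, ← intervalIntegral.integral_const_mul,
    ← intervalIntegral.integral_const_mul]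
  have hA : MemLp A 2 μI := Lp.memLp A
  have hbI := mem_I_of_mem_Ioo hb
  have key : ∀ {g : ℝ → ℝ}, MemLp g 2 μI →
      ∫ x in (-b)..b, (b ^ 2 - x ^ 2) ^ 2 * (g x * g x) ≤ ∫ x in (-b)..b, b ^ 4 * (g x * g x) := by
    intro g hg
    have hi := intervalIntegrable_of_integrable_I (hg.integrable_mul hg) (neg_mem_I hbI) hbI
    refine intervalIntegral.integral_mono_on (by linarith [hb.1])
      (hi.continuousOn_mul (by fun_prop)) (hi.const_mul _) fun x hx => ?_
    have hxb : x ^ 2 ≤ b ^ 2 := sq_le_sq' hx.1 hx.2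
    have hχ : (b ^ 2 - x ^ 2) ^ 2 ≤ b ^ 4 := by nlinarith [sq_nonneg x, sq_nonneg b]
    exact mul_le_mul_of_nonneg_right hχ (mul_self_nonneg _)
  exact add_le_add (key hA.re) (key hA.im)

namespace DomM

variable {n : ℕ}

/-- The inclusion of the domain in `L²`, as a bounded real-linear map. -/
def toL2L (n : ℕ) : DomM n →L[ℝ] L2 :=
  ((ContinuousLinearMap.fst ℂ L2 L2).comp (graphM n).subtypeL).restrictScalars ℝ

/-- `M_n` as a bounded real-linear map from its domain to `L²`. -/
def opL (n : ℕ) : DomM n →L[ℝ] L2 :=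
  ((ContinuousLinearMap.snd ℂ L2 L2).comp (graphM n).subtypeL).restrictScalars ℝ

lemma energy (hn : 1 ≤ n) (p : DomM n) :
    ‖dxL hn p‖ ^ 2 ≤ 1 / 2 * ‖p.toL2‖ ^ 2 - inner ℝ p.toL2 p.op := norm_dx_le hn p

lemma inner_op_symm (hn : 1 ≤ n) (p r : DomM n) :
    inner ℝ p.op r.toL2 = inner ℝ p.toL2 r.op := by
  obtain ⟨w, f, hw, hf, hp⟩ := p.exists_rep
  obtain ⟨v, g, hv, hg, hr⟩ := r.exists_rep
  rw [← form_one, ← form_one, form_eq hf hv, form_eq hw hg]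
  simp only [BoundedContinuousFunction.coe_one, Pi.one_apply, one_mul]
  rw [hp.re.symm hr.re hn, hp.im.symm hr.im hn]

lemma commutator (hn : 1 ≤ n) (p : DomM n) {η η₁ η₂ η₃ : ℝ →ᵇ ℝ} {κ x₀ : ℝ}
    (hη : ∀ x, HasDerivAt η (η₁ x) x) (hη₁ : ∀ x, HasDerivAt η₁ (η₂ x) x)
    (hη₂ : ∀ x, HasDerivAt η₂ (η₃ x) x) (hsign : ∀ x ∈ I, 0 ≤ x * η x) (hκ : 0 < κ)
    (hx₀ : x₀ < π / 2) (hlow : ∀ x ∈ I, x₀ ≤ |x| → κ ≤ |η x|) :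
    1 / 2 * form η₃ p.toL2 p.toL2 - 2 * form η₁ (dxL hn p) (dxL hn p) ≤
      2 * form η p.op (dxL hn p) + form η₁ p.op p.toL2 := by
  obtain ⟨w, f, hw, hf, hp⟩ := p.exists_rep
  have hd := (coeFn_dxL hn p).symm
  rw [form_eq hw hw, form_eq hd hd, form_eq hf hd, form_eq hf hw]
  set K := ‖η‖ + ‖η₁‖ + ‖η₂‖ + ‖η₃‖
  have n0 := norm_nonneg η
  have n1 := norm_nonneg η₁
  have n2 := norm_nonneg η₂
  have n3 := norm_nonneg η₃
  have key : ∀ {a a₁ c : ℝ → ℝ}, RealRep n a a₁ c →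
      1 / 2 * (∫ x in I, η₃ x * (a x * a x)) - 2 * (∫ x in I, η₁ x * (a₁ x * a₁ x)) ≤
      2 * (∫ x in I, η x * (c x * a₁ x)) + ∫ x in I, η₁ x * (c x * a x) := by
    intro a a₁ c h
    have hK : ∀ φ : ℝ →ᵇ ℝ, ‖φ‖ ≤ K → ∀ x ∈ I, |φ x| ≤ K := fun φ hφ x _ =>
      (φ.norm_coe_le_norm x).trans hφ
    have k0 := hK η (by simp only [K]; linarith)
    have k1 := hK η₁ (by simp only [K]; linarith)
    have k2 := hK η₂ (by simp only [K]; linarith)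
    have k3 := hK η₃ (by simp only [K]; linarith)
    have m1 := h.memLp_deriv hn
    have h1 := h.commutator hn (fun x _ => hη x) (fun x _ => hη₁ x) (fun x _ => hη₂ x)
      η₃.continuous.continuousOn k0 k1 k2 k3 hsign hκ hx₀ hlow
    rw [integral_sub ((integrable_bdd_mul η₃.continuous.continuousOn k3 h.memLp h.memLp).const_mul _)
      ((integrable_bdd_mul η₁.continuous.continuousOn k1 m1 m1).const_mul _),
      integral_add ((integrable_bdd_mul η.continuous.continuousOn k0 h.memLp_op m1).const_mul _)
      (integrable_bdd_mul η₁.continuous.continuousOn k1 h.memLp_op h.memLp),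
      integral_const_mul, integral_const_mul, integral_const_mul] at h1
    exact h1
  have e1 := key hp.re
  have e2 := key hp.im
  linarith

lemma potential_term (hn : 1 ≤ n) (p : DomM n) {η η₁ γ γ₁ : ℝ →ᵇ ℝ}
    (hη : ∀ x, HasDerivAt η (η₁ x) x) (hγ : ∀ x, HasDerivAt γ (γ₁ x) x) :
    2 * form (γ * η) p.toL2 (dxL hn p) + form (γ * η₁) p.toL2 p.toL2 =
      -form (γ₁ * η) p.toL2 p.toL2 := by
  obtain ⟨w, f, hw, hf, hp⟩ := p.exists_rep
  have hd := (coeFn_dxL hn p).symm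
  rw [form_eq hw hw, form_eq hw hw, form_eq hw hd]
  set K := ‖η‖ + ‖η₁‖ + ‖γ‖ + ‖γ₁‖
  have n0 := norm_nonneg η
  have n1 := norm_nonneg η₁
  have n2 := norm_nonneg γ
  have n3 := norm_nonneg γ₁
  have key : ∀ {a a₁ c : ℝ → ℝ}, RealRep n a a₁ c →
      2 * (∫ x in I, (γ * η) x * (a x * a₁ x)) + (∫ x in I, (γ * η₁) x * (a x * a x)) =
      -∫ x in I, (γ₁ * η) x * (a x * a x) := by
    intro a a₁ c h
    have hK : ∀ φ : ℝ →ᵇ ℝ, ‖φ‖ ≤ K → ∀ x ∈ I, |φ x| ≤ K := fun φ hφ x _ =>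
      (φ.norm_coe_le_norm x).trans hφ
    have m1 := h.memLp_deriv hn
    have h1 := h.potential_term hn (fun x _ => hη x) η₁.continuous.continuousOn
      (fun x _ => hγ x) γ₁.continuous.continuousOn (hK η (by simp only [K]; linarith))
      (hK η₁ (by simp only [K]; linarith)) (hK γ (by simp only [K]; linarith))
      (hK γ₁ (by simp only [K]; linarith))
    rw [integral_add ((integrable_bdd_mul (φ := fun x => γ x * η x)
        (γ * η).continuous.continuousOn (fun x _ => (γ * η).norm_coe_le_norm x) h.memLp m1).const_mul _)
      (integrable_bdd_mul (φ := fun x => γ x * η₁ x)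
        (γ * η₁).continuous.continuousOn (fun x _ => (γ * η₁).norm_coe_le_norm x) h.memLp h.memLp),
      integral_const_mul] at h1
    exact h1
  have e1 := key hp.re
  have e2 := key hp.im
  linarith

lemma caccioppoli (hn : 1 ≤ n) (p : DomM n) {b : ℝ} (hb : b ∈ Ioo 0 (π / 2)) :
    form (cutoff b) (dxL hn p) (dxL hn p) ≤
      -form (cutoff b) p.op p.toL2 + (b ^ 4 / 2 + 4 * b ^ 2) * obs b p.toL2 := by
  obtain ⟨w, f, hw, hf, hp⟩ := p.exists_rep
  have hd := (coeFn_dxL hn p).symm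
  rw [form_eq hd hd, form_eq hf hw, obs_eq hb hw]
  simp only [integral_cutoff_mul hb]
  have e1 := hp.re.caccioppoli hn hb
  have e2 := hp.im.caccioppoli hn hb
  rw [intervalIntegral.integral_neg] at e1 e2
  linarith

lemma exists_mul (hn : 1 ≤ n) (p : DomM n) {ρ ρ₁ ρ₂ : ℝ →ᵇ ℝ}
    (h1 : ∀ x, HasDerivAt ρ (ρ₁ x) x) (h2 : ∀ x, HasDerivAt ρ₁ (ρ₂ x) x) :
    ∃ r : DomM n, r.toL2 = mulL ρ p.toL2 ∧
      r.op = mulL ρ p.op + (2 : ℝ) • mulL ρ₁ (dxL hn p) + mulL ρ₂ p.toL2 ∧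
      dxL hn r = mulL ρ (dxL hn p) + mulL ρ₁ p.toL2 := by
  obtain ⟨w, f, hw, hf, hp⟩ := p.exists_rep
  have hd := coeFn_dxL hn p
  have hr := hp.mul_real hn h1 h2
  obtain ⟨r, hr1, hr2⟩ := exists_of_rep hr
  refine ⟨r, Lp.ext ?_, Lp.ext ?_, Lp.ext ?_⟩
  · filter_upwards [hr1, hw, coeFn_mulL ρ p.toL2] with x g1 g2 g3
    rw [← g1, g3, g2]
  · filter_upwards [hr2, hw, hf, hd, coeFn_mulL ρ p.op, coeFn_mulL ρ₁ (dxL hn p),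
      coeFn_mulL ρ₂ p.toL2, Lp.coeFn_add (mulL ρ p.op + (2 : ℝ) • mulL ρ₁ (dxL hn p))
      (mulL ρ₂ p.toL2), Lp.coeFn_add (mulL ρ p.op) ((2 : ℝ) • mulL ρ₁ (dxL hn p)),
      Lp.coeFn_smul (2 : ℝ) (mulL ρ₁ (dxL hn p))] with x g1 g2 g3 g4 g5 g6 g7 g8 g9 g10
    rw [← g1, g8, Pi.add_apply, g9, Pi.add_apply, g10, Pi.smul_apply, g5, g6, g7, g2, g3, g4]
    simp
  · filter_upwards [(coeFn_dxL hn r).trans (dx_ae_eq hr hr1), hw, hd, coeFn_mulL ρ (dxL hn p),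
      coeFn_mulL ρ₁ p.toL2, Lp.coeFn_add (mulL ρ (dxL hn p)) (mulL ρ₁ p.toL2)]
      with x g1 g2 g3 g4 g5 g6
    rw [g1, g6, Pi.add_apply, g4, g5, g2, g3]

end DomM

/-! ### Construction of the Carleman weight. -/

/-- A Carleman weight with observation interval `(-b, b)`: increasing away from the origin and
strictly concave away from the observation interval. -/
structure Weight (b : ℝ) where
  β : ℝ →ᵇ ℝ
  β₁ : ℝ →ᵇ ℝ
  β₂ : ℝ →ᵇ ℝ
  β₃ : ℝ →ᵇ ℝ
  β₄ : ℝ →ᵇ ℝ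
  κ : ℝ
  K : ℝ
  x₀ : ℝ
  hasDerivAt : ∀ x, HasDerivAt β (β₁ x) x
  hasDerivAt₁ : ∀ x, HasDerivAt β₁ (β₂ x) x
  hasDerivAt₂ : ∀ x, HasDerivAt β₂ (β₃ x) x
  hasDerivAt₃ : ∀ x, HasDerivAt β₃ (β₄ x) x
  one_le : ∀ x, 1 ≤ β x
  mul_nonneg : ∀ x, 0 ≤ x * β₁ x
  κ_pos : 0 < κ
  one_le_K : 1 ≤ K
  x₀_lt : x₀ < π / 2
  κ_le : ∀ x ∈ I, x₀ ≤ |x| → κ ≤ |β₁ x|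
  concave : ∀ x ∈ I, κ ≤ -2 * β₂ x + K * cutoff b x
  concave' : ∀ x ∈ I, κ ≤ -2 * (β₁ x ^ 2 * β₂ x) + K * cutoff b x
  bound : ∀ x, |β x| ≤ K
  bound₁ : ∀ x, |β₁ x| ≤ K
  bound₄ : ∀ x, |β₄ x| ≤ K

lemma pow_le_one_add_pow_four {x : ℝ} {j : ℕ} (hj : j ≤ 4) : |x ^ j| ≤ 1 + x ^ 4 := by
  have h4 : (0 : ℝ) ≤ x ^ 4 := by positivity
  rw [abs_pow]
  rcases le_total |x| 1 with h | h
  · linarith [pow_le_one₀ (abs_nonneg x) h (n := j)]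
  · have := pow_le_pow_right₀ h hj
    have e : |x| ^ 4 = x ^ 4 := by rw [← abs_pow, abs_of_nonneg h4]
    linarith

lemma pow_four_mul_exp_le {k : ℝ} (hk : 0 < k) (x : ℝ) :
    (1 + x ^ 4) * exp (-(k * x ^ 2)) ≤ 1 + 2 / k ^ 2 := by
  have h1 : exp (-(k * x ^ 2)) ≤ 1 := exp_le_one_iff.2 (by
    have := mul_nonneg hk.le (sq_nonneg x); linarith)
  have h2 := pow_div_factorial_le_exp (k * x ^ 2) (by positivity) 2
  have h3 : x ^ 4 * exp (-(k * x ^ 2)) ≤ 2 / k ^ 2 := by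
    rw [exp_neg, ← div_eq_mul_inv, div_le_div_iff₀ (exp_pos _) (by positivity)]
    simp only [Nat.factorial] at h2
    norm_num at h2
    nlinarith
  linarith

/-- A polynomial of degree at most four times the Gaussian `exp (-k x²)`. -/
def gaussPoly {k : ℝ} (hk : 0 < k) (c₀ c₁ c₂ c₃ c₄ : ℝ) : ℝ →ᵇ ℝ :=
  BoundedContinuousFunction.ofNormedAddCommGroup
    (fun x => (c₀ + c₁ * x + c₂ * x ^ 2 + c₃ * x ^ 3 + c₄ * x ^ 4) * exp (-(k * x ^ 2)))
    (by fun_prop) ((|c₀| + |c₁| + |c₂| + |c₃| + |c₄|) * (1 + 2 / k ^ 2)) (fun x => by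
      have h : |c₀ + c₁ * x + c₂ * x ^ 2 + c₃ * x ^ 3 + c₄ * x ^ 4| ≤
          (|c₀| + |c₁| + |c₂| + |c₃| + |c₄|) * (1 + x ^ 4) := by
        have g0 := mul_le_mul_of_nonneg_left
          (pow_le_one_add_pow_four (x := x) (j := 0) (by norm_num)) (abs_nonneg c₀)
        have g1 := mul_le_mul_of_nonneg_left
          (pow_le_one_add_pow_four (x := x) (j := 1) (by norm_num)) (abs_nonneg c₁)
        have g2 := mul_le_mul_of_nonneg_left
          (pow_le_one_add_pow_four (x := x) (j := 2) (by norm_num)) (abs_nonneg c₂)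
        have g3 := mul_le_mul_of_nonneg_left
          (pow_le_one_add_pow_four (x := x) (j := 3) (by norm_num)) (abs_nonneg c₃)
        have g4 := mul_le_mul_of_nonneg_left
          (pow_le_one_add_pow_four (x := x) (j := 4) (by norm_num)) (abs_nonneg c₄)
        rw [← abs_mul] at g0 g1 g2 g3 g4
        have a1 := abs_add_le (c₀ + c₁ * x + c₂ * x ^ 2 + c₃ * x ^ 3) (c₄ * x ^ 4)
        have a2 := abs_add_le (c₀ + c₁ * x + c₂ * x ^ 2) (c₃ * x ^ 3)
        have a3 := abs_add_le (c₀ + c₁ * x) (c₂ * x ^ 2)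
        have a4 := abs_add_le c₀ (c₁ * x)
        simp only [pow_zero, mul_one, pow_one] at g0 g1
        linarith
      rw [norm_mul, Real.norm_eq_abs, Real.norm_eq_abs, abs_exp]
      calc _ ≤ (|c₀| + |c₁| + |c₂| + |c₃| + |c₄|) * (1 + x ^ 4) * exp (-(k * x ^ 2)) := by gcongr
        _ = (|c₀| + |c₁| + |c₂| + |c₃| + |c₄|) * ((1 + x ^ 4) * exp (-(k * x ^ 2))) := by ring
        _ ≤ _ := by gcongr; exact pow_four_mul_exp_le hk x)

lemma gaussPoly_apply {k : ℝ} (hk : 0 < k) (c₀ c₁ c₂ c₃ c₄ x : ℝ) :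
    gaussPoly hk c₀ c₁ c₂ c₃ c₄ x =
      (c₀ + c₁ * x + c₂ * x ^ 2 + c₃ * x ^ 3 + c₄ * x ^ 4) * exp (-(k * x ^ 2)) := rfl

lemma hasDerivAt_gaussPoly {k : ℝ} (hk : 0 < k) (c₀ c₁ c₂ c₃ x : ℝ) :
    HasDerivAt (gaussPoly hk c₀ c₁ c₂ c₃ 0)
      ((c₁ + (2 * c₂ - 2 * k * c₀) * x + (3 * c₃ - 2 * k * c₁) * x ^ 2 + (-(2 * k * c₂)) * x ^ 3
        + (-(2 * k * c₃)) * x ^ 4) * exp (-(k * x ^ 2))) x := by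
  have hx := hasDerivAt_id x
  have hp : HasDerivAt (fun x => c₀ + c₁ * x + c₂ * x ^ 2 + c₃ * x ^ 3 + 0 * x ^ 4)
      (c₁ + c₂ * (2 * x) + c₃ * (3 * x ^ 2)) x := by
    refine (((((hasDerivAt_const x c₀).add (hx.const_mul c₁)).add ((hx.pow 2).const_mul c₂)).add
      ((hx.pow 3).const_mul c₃)).add ((hx.pow 4).const_mul 0)).congr_deriv ?_
    simp
  have he : HasDerivAt (fun x => exp (-(k * x ^ 2))) (exp (-(k * x ^ 2)) * -(k * (2 * x))) x := by
    refine (((hx.pow 2).const_mul k).neg.exp).congr_deriv ?_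
    simp
  refine (hp.mul he).congr_deriv ?_
  ring

/-- The choice β = 1 + (1 - e^{-kx²})/(2k) has β' = x e^{-kx²} and β'' = (1 - 2kx²) e^{-kx²}. With k
= 4/b² one has kx² ≥ 1 for |x| ≥ b/2, so β'' ≤ -e^{-kx²} there, while the cutoff is bounded below
for |x| < b/2. -/
theorem exists_weight {b : ℝ} (hb : b ∈ Ioo 0 (π / 2)) : Nonempty (Weight b) := by
  have hb0 := hb.1
  set k : ℝ := 4 / b ^ 2 with hkdef
  have hk : 0 < k := by positivity
  have hkb : k * b ^ 2 = 4 := by rw [hkdef]; field_simp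
  set β : ℝ →ᵇ ℝ := BoundedContinuousFunction.const ℝ (1 + 1 / (2 * k)) +
    gaussPoly hk (-(1 / (2 * k))) 0 0 0 0
  set β₁ := gaussPoly hk 0 1 0 0 0
  set β₂ := gaussPoly hk 1 0 (-(2 * k)) 0 0
  set β₃ := gaussPoly hk 0 (-(6 * k)) 0 (4 * k ^ 2) 0
  set β₄ := gaussPoly hk (-(6 * k)) 0 (24 * k ^ 2) 0 (-(8 * k ^ 3))
  set m : ℝ := exp (-(k * (π / 2) ^ 2))
  have hm : 0 < m := exp_pos _
  -- The entries bound -2β'', -2β'²β'' and |β'| from below on the part |x| ≥ b/2 of the interval.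
  set κ : ℝ := min m (min (b ^ 2 / 2 * m ^ 3) (b / 2 * m))
  have hκ : 0 < κ := by simp only [κ]; positivity
  -- The quotient is sized so that K times the cutoff, which is at least 9b⁴/16 for |x| < b/2,
  -- outweighs the wrong sign of β'' there.
  set K : ℝ := 1 + ‖β‖ + ‖β₁‖ + ‖β₄‖ +
    (κ + 2 * ‖β₂‖ + 2 * (‖β₁‖ ^ 2 * ‖β₂‖)) / (9 * b ^ 4 / 16)
  have n0 := norm_nonneg β
  have n1 := norm_nonneg β₁
  have n2 := norm_nonneg β₂
  have n4 := norm_nonneg β₄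
  have hquot : 0 ≤ (κ + 2 * ‖β₂‖ + 2 * (‖β₁‖ ^ 2 * ‖β₂‖)) / (9 * b ^ 4 / 16) := by positivity
  have hK0 : 0 ≤ K := by simp only [K]; linarith
  have e1 : ∀ x, β₁ x = x * exp (-(k * x ^ 2)) := fun x => by simp [β₁, gaussPoly_apply]
  have e2 : ∀ x, β₂ x = (1 - 2 * (k * x ^ 2)) * exp (-(k * x ^ 2)) := fun x => by
    simp only [β₂, gaussPoly_apply]; ring
  have hfar : ∀ x ∈ I, b / 2 ≤ |x| → m ≤ exp (-(k * x ^ 2)) ∧ 1 ≤ k * x ^ 2 := by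
    intro x hx h
    have h1 : x ^ 2 ≤ (π / 2) ^ 2 := sq_le_sq' hx.1.le hx.2.le
    have h2 : (b / 2) ^ 2 ≤ x ^ 2 := by rw [← sq_abs x]; gcongr
    refine ⟨exp_le_exp.2 (by nlinarith), by nlinarith⟩
  have hnear : ∀ x, |x| < b / 2 → κ + 2 * ‖β₂‖ + 2 * (‖β₁‖ ^ 2 * ‖β₂‖) ≤ K * cutoff b x := by
    intro x hx
    have h2 : x ^ 2 ≤ (b / 2) ^ 2 := by rw [← sq_abs x]; gcongr
    have h3 : 9 * b ^ 4 / 16 ≤ cutoff b x := by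
      have h4 : 3 / 4 * b ^ 2 ≤ max (b ^ 2 - x ^ 2) 0 := le_max_of_le_left (by linarith)
      calc 9 * b ^ 4 / 16 = (3 / 4 * b ^ 2) ^ 2 := by ring
        _ ≤ _ := by rw [cutoff_apply]; gcongr
    calc _ = (κ + 2 * ‖β₂‖ + 2 * (‖β₁‖ ^ 2 * ‖β₂‖)) / (9 * b ^ 4 / 16) * (9 * b ^ 4 / 16) := by
          field_simp
      _ ≤ K * (9 * b ^ 4 / 16) := by
          gcongr
          simp only [K]; linarith
      _ ≤ _ := by gcongr
  have habs : ∀ (φ : ℝ →ᵇ ℝ) x, |φ x| ≤ ‖φ‖ := fun φ x => φ.norm_coe_le_norm x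
  have hprod : ∀ x, |β₁ x ^ 2 * β₂ x| ≤ ‖β₁‖ ^ 2 * ‖β₂‖ := fun x => by
    rw [abs_mul, abs_pow]
    have := habs β₁ x
    have := habs β₂ x
    gcongr
  refine ⟨⟨β, β₁, β₂, β₃, β₄, κ, K, b / 2, ?_, ?_, ?_, ?_, ?_, ?_, hκ, ?_, by linarith [hb.2, hb0],
    ?_, ?_, ?_, ?_, ?_, ?_⟩⟩
  · intro x
    refine ((hasDerivAt_gaussPoly hk _ 0 0 0 x).const_add (1 + 1 / (2 * k))).congr_deriv ?_
    rw [e1]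
    field_simp
    ring
  · intro x
    refine (hasDerivAt_gaussPoly hk 0 1 0 0 x).congr_deriv ?_
    rw [e2]; ring
  · intro x
    refine (hasDerivAt_gaussPoly hk 1 0 (-(2 * k)) 0 x).congr_deriv ?_
    simp only [β₃, gaussPoly_apply]; ring
  · intro x
    refine (hasDerivAt_gaussPoly hk 0 (-(6 * k)) 0 (4 * k ^ 2) x).congr_deriv ?_
    simp only [β₄, gaussPoly_apply]; ring
  · intro x
    have h1 : exp (-(k * x ^ 2)) ≤ 1 := exp_le_one_iff.2 (by
      have := mul_nonneg hk.le (sq_nonneg x); linarith)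
    have h2 : 0 ≤ 1 / (2 * k) * (1 - exp (-(k * x ^ 2))) :=
      mul_nonneg (by positivity) (by linarith)
    have h3 : β x = 1 + 1 / (2 * k) * (1 - exp (-(k * x ^ 2))) := by
      simp only [β, BoundedContinuousFunction.add_apply, BoundedContinuousFunction.const_apply,
        gaussPoly_apply]
      ring
    linarith
  · intro x
    rw [e1, ← mul_assoc]
    exact mul_nonneg (mul_self_nonneg x) (exp_pos _).le
  · simp only [K]; linarith
  · intro x hx h
    obtain ⟨h1, -⟩ := hfar x hx h
    rw [e1, abs_mul, abs_exp]
    calc κ ≤ b / 2 * m := (min_le_right _ _).trans (min_le_right _ _)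
      _ ≤ _ := by gcongr
  · intro x hx
    rcases lt_or_ge |x| (b / 2) with h | h
    · have h1 := hnear x h
      have h2 := (abs_le.1 (habs β₂ x)).2
      have h3 : 0 ≤ ‖β₁‖ ^ 2 * ‖β₂‖ := by positivity
      linarith
    · obtain ⟨h1, h2⟩ := hfar x hx h
      have h3 : 0 ≤ K * cutoff b x := mul_nonneg hK0 (cutoff_nonneg b x)
      have h4 : κ ≤ m := min_le_left _ _
      rw [e2]
      nlinarith
  · intro x hx
    rcases lt_or_ge |x| (b / 2) with h | h
    · have h1 := hnear x h
      have h2 := (abs_le.1 (hprod x)).2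
      linarith
    · obtain ⟨h1, h2⟩ := hfar x hx h
      have h3 : 0 ≤ K * cutoff b x := mul_nonneg hK0 (cutoff_nonneg b x)
      have h4 : κ ≤ b ^ 2 / 2 * m ^ 3 := (min_le_right _ _).trans (min_le_left _ _)
      have h5 : (b / 2) ^ 2 ≤ x ^ 2 := by rw [← sq_abs x]; gcongr
      have h6 : b ^ 2 / 2 * m ^ 3 ≤ 2 * (x ^ 2 * exp (-(k * x ^ 2)) ^ 3) := by
        have : (b / 2) ^ 2 * m ^ 3 ≤ x ^ 2 * exp (-(k * x ^ 2)) ^ 3 := by gcongr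
        nlinarith
      have h7 : 0 ≤ x ^ 2 * exp (-(k * x ^ 2)) ^ 3 := by positivity
      have h8 : -2 * (β₁ x ^ 2 * β₂ x) =
          2 * (x ^ 2 * exp (-(k * x ^ 2)) ^ 3) * (2 * (k * x ^ 2) - 1) := by rw [e1, e2]; ring
      rw [h8]
      nlinarith
  · intro x
    refine (habs β x).trans ?_
    simp only [K]; linarith
  · intro x
    refine (habs β₁ x).trans ?_
    simp only [K]; linarith
  · intro x
    refine (habs β₄ x).trans ?_
    simp only [K]; linarith

/-! ### The conjugated operator at a fixed time. -/

lemma form_sub_left (φ ψ : ℝ →ᵇ ℝ) (A B : L2) : form (φ - ψ) A B = form φ A B - form ψ A B := by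
  simp [form, inner_sub_left]

lemma form_one_self (A : L2) : form 1 A A = ‖A‖ ^ 2 := by
  rw [form_one, real_inner_self_eq_norm_sq]

lemma obs_nonneg (b : ℝ) (A : L2) : 0 ≤ obs b A := integral_nonneg fun _ => by positivity

/-- The term -2σ³β₁²β₂ dominates. The others amount to at most (1/2 + 2 + 3/2)εσ³K² = 4εσ³K², which
`hεK` bounds by σ³κ/2; hence the factor 8. -/
lemma zero_order_coeff_ge {σ R R' ε K κ β β₁ β₂ β₄ χ : ℝ} (hε : 0 < ε) (hK : 1 ≤ K)
    (hεK : 8 * ε * K ^ 2 ≤ κ) (hσ : 1 ≤ σ) (hεσ : 1 ≤ ε * σ) (hR : |R| ≤ ε * σ ^ 2)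
    (hR' : |R'| ≤ 3 * ε * σ ^ 3) (hβ : |β| ≤ K) (hβ₁ : |β₁| ≤ K) (hβ₄ : |β₄| ≤ K)
    (hc : κ ≤ -2 * (β₁ ^ 2 * β₂) + K * χ) :
    σ ^ 3 * (κ / 2) - σ ^ 3 * K * χ ≤
      σ / 2 * β₄ + σ * ((R * β₁ - 2 * σ ^ 2 * (β₁ * β₂)) * β₁)
        - 1 / 2 * (R' * β - 2 * σ * R * (β₁ * β₁)) := by
  have hσ2 : σ ≤ ε * σ ^ 2 := by nlinarith
  have hσ3 : ε * σ ^ 2 ≤ ε * σ ^ 3 := by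
    have : σ ^ 2 ≤ σ ^ 3 := pow_le_pow_right₀ hσ (by norm_num)
    gcongr
  have hKK : K ≤ K ^ 2 := by nlinarith
  have t1 : |σ * β₄| ≤ ε * σ ^ 3 * K ^ 2 := by
    rw [abs_mul, abs_of_pos (by linarith)]
    calc σ * |β₄| ≤ (ε * σ ^ 3) * K := by gcongr; linarith
      _ ≤ _ := by gcongr
  have t2 : |σ * R * β₁ ^ 2| ≤ ε * σ ^ 3 * K ^ 2 := by
    rw [abs_mul, abs_mul, abs_pow, abs_of_pos (show 0 < σ by linarith)]
    calc σ * |R| * |β₁| ^ 2 ≤ σ * (ε * σ ^ 2) * K ^ 2 := by gcongr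
      _ = _ := by ring
  have t3 : |R' * β| ≤ 3 * ε * σ ^ 3 * K ^ 2 := by
    rw [abs_mul]
    calc |R'| * |β| ≤ (3 * ε * σ ^ 3) * K := by gcongr
      _ ≤ _ := by gcongr
  have s1 := (abs_le.1 t1).1
  have s2 := (abs_le.1 t2).1
  have s3 := (abs_le.1 t3).2
  have hσ30 : 0 ≤ σ ^ 3 := by positivity
  have c1 := mul_le_mul_of_nonneg_left hc hσ30
  have c2 := mul_le_mul_of_nonneg_left hεK hσ30
  have e : σ / 2 * β₄ + σ * ((R * β₁ - 2 * σ ^ 2 * (β₁ * β₂)) * β₁)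
        - 1 / 2 * (R' * β - 2 * σ * R * (β₁ * β₁)) =
      1 / 2 * (σ * β₄) + 2 * (σ * R * β₁ ^ 2) + σ ^ 3 * (-2 * (β₁ ^ 2 * β₂))
        - 1 / 2 * (R' * β) := by ring
  rw [e]
  linarith

/-- Here P2, S2 and PS stand for ‖P‖², ‖S‖² and ⟨P, S⟩; X = χz with χ the cutoff; Φ = ∫χ|z|², Ψ =
∫χ|z'|²; d2 = ‖z'‖², z2 = ‖z‖², and o is the observed mass. The wrong-sign gradient 2σKΨ is traded
through `h2` and `h6` for ‖P‖², available once, and for observed mass. -/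
lemma conjugated_algebra {b σ K κ P2 S2 o PS Pzt PX X2 Φ Ψ d2 z2 E4 E2 EV Ep : ℝ} (hK : 1 ≤ K)
    (hσ : 1 ≤ σ) (hS : 0 ≤ S2) (ho : 0 ≤ o) (hΦ : 0 ≤ Φ)
    (h1 : Pzt + σ * (1 / 2 * E4 - 2 * E2) + σ * EV ≤ PS)
    (h2 : Ψ ≤ PX + 2 * σ ^ 2 * K ^ 2 * Φ + (b ^ 4 / 2 + 4 * b ^ 2) * o)
    (h3 : σ ^ 3 * (κ / 2) * z2 - σ ^ 3 * K * Φ ≤ σ * (1 / 2 * E4) + σ * EV - 1 / 2 * Ep)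
    (h4 : κ * d2 - K * Ψ ≤ -(2 * E2)) (h6 : 2 * (σ * K) * PX ≤ P2 + (σ * K) ^ 2 * X2)
    (h7 : Φ ≤ b ^ 4 * o) (h8 : X2 ≤ b ^ 4 * Φ) :
    2 * (Pzt + 1 / 2 * Ep) + 2 * σ * κ * d2 + σ ^ 3 * κ * z2 ≤ P2 + 2 * PS + S2 +
      ((K ^ 2 * b ^ 4 + 4 * K ^ 3 + 2 * K) * b ^ 4 + 2 * K * (b ^ 4 / 2 + 4 * b ^ 2)) *
        (σ ^ 3 * o) := by
  have hσ0 : 0 < σ := by linarith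
  have h9 : 2 * σ * K * Ψ ≤ P2 + (σ * K) ^ 2 * (b ^ 4 * Φ)
      + 4 * σ ^ 3 * K ^ 3 * Φ + 2 * σ * K * (b ^ 4 / 2 + 4 * b ^ 2) * o := by
    have a1 := mul_le_mul_of_nonneg_left h2 (show 0 ≤ 2 * σ * K by positivity)
    have a2 := mul_le_mul_of_nonneg_left h8 (sq_nonneg (σ * K))
    linarith
  have hσ2 : σ ^ 2 ≤ σ ^ 3 := pow_le_pow_right₀ hσ (by norm_num)
  have hσ1 : σ ≤ σ ^ 3 := by simpa using pow_le_pow_right₀ hσ (show 1 ≤ 3 by norm_num)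
  have a1 : (σ * K) ^ 2 * (b ^ 4 * Φ) ≤ σ ^ 3 * (K ^ 2 * b ^ 4 * Φ) := by
    have : (σ * K) ^ 2 * (b ^ 4 * Φ) = σ ^ 2 * (K ^ 2 * b ^ 4 * Φ) := by ring
    rw [this]; gcongr
  have a2 : σ * (2 * K * (b ^ 4 / 2 + 4 * b ^ 2) * o) ≤
      σ ^ 3 * (2 * K * (b ^ 4 / 2 + 4 * b ^ 2) * o) := by gcongr
  have a3 : σ ^ 3 * ((K ^ 2 * b ^ 4 + 4 * K ^ 3 + 2 * K) * Φ) ≤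
      σ ^ 3 * ((K ^ 2 * b ^ 4 + 4 * K ^ 3 + 2 * K) * (b ^ 4 * o)) := by gcongr
  have h11 := mul_le_mul_of_nonneg_left h4 hσ0.le
  linarith

namespace Weight

variable {b : ℝ} (W : Weight b) {n : ℕ}

/-- The potential `R β - σ² β'²` of the conjugated operator. -/
def pot (σ R : ℝ) : ℝ →ᵇ ℝ := R • W.β - σ ^ 2 • (W.β₁ * W.β₁)

/-- The time derivative of the potential when `σ' = R`. -/
def pot' (σ R R' : ℝ) : ℝ →ᵇ ℝ := R' • W.β - (2 * σ * R) • (W.β₁ * W.β₁)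

/-- The symmetric part of the conjugated operator. -/
def symmPart (σ R : ℝ) (p : DomM n) : L2 := mulL (W.pot σ R) p.toL2 - p.op

/-- The antisymmetric part of the conjugated operator, with time derivative `zt`. -/
def antiPart (hn : 1 ≤ n) (σ : ℝ) (p : DomM n) (zt : L2) : L2 :=
  zt - σ • ((2 : ℝ) • mulL W.β₁ (dxL hn p) + mulL W.β₂ p.toL2)

/-- With η = β', the multiplier 2ηz' + η'z is exactly the spatial part of `antiPart`.
`DomM.commutator` treats the contribution of M_n, and `DomM.potential_term` that of the bounded
potential. -/
lemma inner_symmPart_ge (hn : 1 ≤ n) (σ R : ℝ) (hσ : 0 ≤ σ) (p : DomM n) (zt : L2) :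
    inner ℝ (W.symmPart σ R p) zt + σ * (1 / 2 * form W.β₄ p.toL2 p.toL2
      - 2 * form W.β₂ (dxL hn p) (dxL hn p))
      + σ * form ((R • W.β₁ - (2 * σ ^ 2) • (W.β₁ * W.β₂)) * W.β₁) p.toL2 p.toL2 ≤
    inner ℝ (W.symmPart σ R p) (W.antiPart hn σ p zt) := by
  have h1 := p.commutator hn W.hasDerivAt₁ W.hasDerivAt₂ W.hasDerivAt₃
    (fun x _ => W.mul_nonneg x) W.κ_pos W.x₀_lt W.κ_le
  have h2 := p.potential_term hn (γ := W.pot σ R)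
    (γ₁ := R • W.β₁ - (2 * σ ^ 2) • (W.β₁ * W.β₂)) W.hasDerivAt₁ (fun x => by
      refine (((W.hasDerivAt x).const_mul R).sub
        (((W.hasDerivAt₁ x).mul (W.hasDerivAt₁ x)).const_mul (σ ^ 2))).congr_deriv ?_
      simp; ring)
  have h3 : inner ℝ (W.symmPart σ R p) (W.antiPart hn σ p zt) =
      inner ℝ (W.symmPart σ R p) zt - σ * ((2 * form (W.pot σ R * W.β₁) p.toL2 (dxL hn p)
        + form (W.pot σ R * W.β₂) p.toL2 p.toL2)
        - (2 * form W.β₁ p.op (dxL hn p) + form W.β₂ p.op p.toL2)) := by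
    rw [antiPart, inner_sub_right, inner_smul_right, inner_add_right, inner_smul_right, symmPart,
      inner_sub_left _ _ (mulL W.β₁ _), inner_sub_left _ _ (mulL W.β₂ _), form_mul, form_mul,
      ← form_eq_right, ← form_eq_right]
    ring
  rw [h3, h2]
  nlinarith [mul_le_mul_of_nonneg_left h1 hσ]

/-- The Caccioppoli inequality is rewritten with P in place of M_n, so that ‖P‖² can pay for it. -/
lemma cutoff_term_le (hn : 1 ≤ n) (hb : b ∈ Ioo 0 (π / 2)) {σ R : ℝ} (hR : |R| ≤ σ ^ 2)
    (p : DomM n) :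
    form (cutoff b) (dxL hn p) (dxL hn p) ≤
      inner ℝ (W.symmPart σ R p) (mulL (cutoff b) p.toL2)
        + 2 * σ ^ 2 * W.K ^ 2 * form (cutoff b) p.toL2 p.toL2
        + (b ^ 4 / 2 + 4 * b ^ 2) * obs b p.toL2 := by
  have h1 := p.caccioppoli hn hb
  have h2 : inner ℝ (W.symmPart σ R p) (mulL (cutoff b) p.toL2) =
      form (W.pot σ R * cutoff b) p.toL2 p.toL2 - form (cutoff b) p.op p.toL2 := by
    rw [symmPart, inner_sub_left, form_mul, ← form_eq_right]
  have h3 : form (-(W.pot σ R * cutoff b)) p.toL2 p.toL2 ≤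
      form ((2 * σ ^ 2 * W.K ^ 2) • cutoff b) p.toL2 p.toL2 := by
    refine form_mono (fun x _ => ?_) _
    have hβ := W.bound x
    have hβ₁ := W.bound₁ x
    have hK := W.one_le_K
    have e1 : -(R * W.β x) ≤ σ ^ 2 * W.K ^ 2 := by
      have : |R * W.β x| ≤ σ ^ 2 * W.K := by rw [abs_mul]; gcongr
      have h5 : W.K ≤ W.K ^ 2 := by nlinarith
      have h6 := mul_le_mul_of_nonneg_left h5 (sq_nonneg σ)
      linarith [neg_abs_le (R * W.β x)]
    have e2 : W.β₁ x * W.β₁ x ≤ W.K ^ 2 := by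
      rw [← sq, ← sq_abs]; gcongr
    have e3 := mul_le_mul_of_nonneg_left e2 (sq_nonneg σ)
    have e4 := cutoff_nonneg b x
    simp only [pot, BoundedContinuousFunction.neg_apply, BoundedContinuousFunction.mul_apply,
      BoundedContinuousFunction.sub_apply, BoundedContinuousFunction.smul_apply, smul_eq_mul]
    nlinarith [mul_le_mul_of_nonneg_right (add_le_add e1 e3) e4]
  have h4 : form (-(W.pot σ R * cutoff b)) p.toL2 p.toL2 =
      -form (W.pot σ R * cutoff b) p.toL2 p.toL2 := by simp [form]
  rw [form_smul_left, h4] at h3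
  linarith

lemma zero_order_ge {σ R R' ε : ℝ} (hε : 0 < ε) (hεK : 8 * ε * W.K ^ 2 ≤ W.κ) (hσ : 1 ≤ σ)
    (hεσ : 1 ≤ ε * σ) (hR : |R| ≤ ε * σ ^ 2) (hR' : |R'| ≤ 3 * ε * σ ^ 3) (A : L2) :
    σ ^ 3 * (W.κ / 2) * ‖A‖ ^ 2 - σ ^ 3 * W.K * form (cutoff b) A A ≤
      σ * (1 / 2 * form W.β₄ A A)
      + σ * form ((R • W.β₁ - (2 * σ ^ 2) • (W.β₁ * W.β₂)) * W.β₁) A A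
      - 1 / 2 * form (W.pot' σ R R') A A := by
  have key : form ((σ ^ 3 * (W.κ / 2)) • 1 - (σ ^ 3 * W.K) • cutoff b) A A ≤
      form ((σ / 2) • W.β₄ + σ • ((R • W.β₁ - (2 * σ ^ 2) • (W.β₁ * W.β₂)) * W.β₁)
        - (1 / 2 : ℝ) • W.pot' σ R R') A A := by
    refine form_mono (fun x hx => ?_) A
    have := zero_order_coeff_ge hε W.one_le_K hεK hσ hεσ hR hR' (W.bound x) (W.bound₁ x)
      (W.bound₄ x) (W.concave' x hx)
    simpa only [pot', BoundedContinuousFunction.mul_apply, BoundedContinuousFunction.add_apply,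
      BoundedContinuousFunction.sub_apply, BoundedContinuousFunction.smul_apply, smul_eq_mul,
      BoundedContinuousFunction.coe_one, Pi.one_apply, mul_one] using this
  simp only [form_sub_left, form_add_left, form_smul_left, form_one_self] at key
  linarith

/-- The constant in front of the observation term. -/
def obsConst : ℝ :=
  (W.K ^ 2 * b ^ 4 + 4 * W.K ^ 3 + 2 * W.K) * b ^ 4 + 2 * W.K * (b ^ 4 / 2 + 4 * b ^ 2)

theorem conjugated_estimate (hn : 1 ≤ n) (hb : b ∈ Ioo 0 (π / 2)) {σ R R' ε : ℝ} (hε : 0 < ε)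
    (hε1 : ε ≤ 1) (hεK : 8 * ε * W.K ^ 2 ≤ W.κ) (hσ : 1 ≤ σ) (hεσ : 1 ≤ ε * σ)
    (hR : |R| ≤ ε * σ ^ 2) (hR' : |R'| ≤ 3 * ε * σ ^ 3) (p : DomM n) (zt : L2) :
    2 * (inner ℝ (W.symmPart σ R p) zt + 1 / 2 * form (W.pot' σ R R') p.toL2 p.toL2)
      + 2 * σ * W.κ * ‖dxL hn p‖ ^ 2 + σ ^ 3 * W.κ * ‖p.toL2‖ ^ 2 ≤
    ‖W.symmPart σ R p + W.antiPart hn σ p zt‖ ^ 2 + W.obsConst * (σ ^ 3 * obs b p.toL2) := by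
  have hK := W.one_le_K
  have hσ0 : 0 < σ := by linarith
  have hR1 : |R| ≤ σ ^ 2 := hR.trans (mul_le_of_le_one_left (sq_nonneg σ) hε1)
  have h1 := W.inner_symmPart_ge hn σ R hσ0.le p zt
  have h2 := W.cutoff_term_le hn hb hR1 p
  have h3 := W.zero_order_ge hε hεK hσ hεσ hR hR' p.toL2
  have h4 : W.κ * ‖dxL hn p‖ ^ 2 - W.K * form (cutoff b) (dxL hn p) (dxL hn p) ≤
      -(2 * form W.β₂ (dxL hn p) (dxL hn p)) := by
    have key : form (W.κ • 1 - W.K • cutoff b) (dxL hn p) (dxL hn p) ≤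
        form ((-2 : ℝ) • W.β₂) (dxL hn p) (dxL hn p) := by
      refine form_mono (fun x hx => ?_) _
      have := W.concave x hx
      simp only [BoundedContinuousFunction.sub_apply, BoundedContinuousFunction.smul_apply,
        smul_eq_mul, BoundedContinuousFunction.coe_one, Pi.one_apply]
      linarith
    simp only [form_sub_left, form_smul_left, form_one_self] at key
    linarith
  set P := W.symmPart σ R p
  set S := W.antiPart hn σ p zt
  have h5 : ‖P + S‖ ^ 2 = ‖P‖ ^ 2 + 2 * inner ℝ P S + ‖S‖ ^ 2 := norm_add_sq_real P S
  set X := mulL (cutoff b) p.toL2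
  have h6 : 2 * (σ * W.K) * inner ℝ P X ≤ ‖P‖ ^ 2 + (σ * W.K) ^ 2 * ‖X‖ ^ 2 := by
    have e := norm_sub_sq_real P ((σ * W.K) • X)
    rw [inner_smul_right, norm_smul, mul_pow, Real.norm_eq_abs, sq_abs] at e
    have : 0 ≤ ‖P - (σ * W.K) • X‖ ^ 2 := sq_nonneg _
    linarith
  set o := obs b p.toL2
  have ho : 0 ≤ o := obs_nonneg _ _
  have h7 : form (cutoff b) p.toL2 p.toL2 ≤ b ^ 4 * o := form_cutoff_le hb _
  have h8 : ‖X‖ ^ 2 ≤ b ^ 4 * form (cutoff b) p.toL2 p.toL2 := by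
    rw [← real_inner_self_eq_norm_sq, form_mul, ← form_smul_left]
    refine form_mono (fun x _ => ?_) _
    simp only [BoundedContinuousFunction.mul_apply, BoundedContinuousFunction.smul_apply,
      smul_eq_mul]
    exact mul_le_mul_of_nonneg_right (cutoff_le b x) (cutoff_nonneg b x)
  have hΦ : 0 ≤ form (cutoff b) p.toL2 p.toL2 := by
    have : form 0 p.toL2 p.toL2 ≤ form (cutoff b) p.toL2 p.toL2 :=
      form_mono (fun x _ => cutoff_nonneg b x) _
    simpa [form] using this
  have h12 : 0 ≤ ‖S‖ ^ 2 := sq_nonneg _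
  rw [h5]
  exact conjugated_algebra hK hσ h12 ho hΦ h1 h2 h3 h4 h6 h7 h8

end Weight

/-! ### Conjugation by the weight and differentiation in time. -/

lemma norm_mulL_le {φ : ℝ →ᵇ ℝ} {M : ℝ} (hM : 0 ≤ M) (h : ∀ x, |φ x| ≤ M) (A : L2) :
    ‖mulL φ A‖ ≤ M * ‖A‖ := by
  refine (pow_le_pow_iff_left₀ (norm_nonneg _) (by positivity) two_ne_zero).1 ?_
  have h1 : form (φ * φ) A A ≤ form (M ^ 2 • 1) A A := form_mono (fun x _ => by
    have : |φ x| ^ 2 ≤ M ^ 2 := by have := h x; gcongr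
    rw [sq_abs] at this
    simpa [← sq] using this) A
  rwa [form_smul_left, form_one_self, ← form_mul, real_inner_self_eq_norm_sq, ← mul_pow] at h1

namespace Weight

variable {b : ℝ} (W : Weight b) {n : ℕ}

/-- The function `exp (-u β)`. -/
def expW (u : ℝ) : ℝ →ᵇ ℝ := NormedSpace.exp (u • -W.β)

lemma expW_apply (u x : ℝ) : W.expW u x = exp (-(u * W.β x)) := by
  have h1 : Continuous (fun f : ℝ →ᵇ ℝ => f x) := by fun_prop
  let ev : (ℝ →ᵇ ℝ) →+* ℝ :=
    { toFun := fun f => f x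
      map_one' := rfl
      map_mul' := fun _ _ => rfl
      map_zero' := rfl
      map_add' := fun _ _ => rfl }
  have h2 : ev (NormedSpace.exp (u • -W.β)) = NormedSpace.exp (ev (u • -W.β)) :=
    NormedSpace.map_exp ev h1 _
  rw [← Real.exp_eq_exp_ℝ] at h2
  refine h2.trans ?_
  change Real.exp ((u • -W.β) x) = _
  simp

/-- The exponential lives in the Banach algebra of bounded continuous functions, so this derivative
holds in sup norm and, through `mulL`, in operator norm. -/
lemma hasDerivAt_expW (u : ℝ) : HasDerivAt W.expW (-(W.β * W.expW u)) u := by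
  have := hasDerivAt_exp_smul_const (𝕂 := ℝ) (-W.β) u
  refine this.congr_deriv ?_
  ext x
  change NormedSpace.exp (u • -W.β) x * -W.β x = -(W.β x * NormedSpace.exp (u • -W.β) x)
  ring

lemma expW_hasDerivAt (u x : ℝ) : HasDerivAt (W.expW u) ((-u • (W.β₁ * W.expW u)) x) x := by
  have e : (W.expW u : ℝ → ℝ) = fun x => exp (-(u * W.β x)) := funext (W.expW_apply u)
  rw [e]
  refine ((W.hasDerivAt x).const_mul u).neg.exp.congr_deriv ?_
  simp [expW_apply]; ring

lemma expW_hasDerivAt₁ (u x : ℝ) : HasDerivAt (-u • (W.β₁ * W.expW u) : ℝ →ᵇ ℝ)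
    ((u ^ 2 • (W.β₁ * (W.β₁ * W.expW u)) - u • (W.β₂ * W.expW u)) x) x := by
  refine (((W.hasDerivAt₁ x).mul (W.expW_hasDerivAt u x)).const_mul (-u)).congr_deriv ?_
  simp; ring

lemma norm_expW_le {u : ℝ} (hu : 0 ≤ u) (A : L2) : ‖mulL (W.expW u) A‖ ≤ exp (-u) * ‖A‖ := by
  refine norm_mulL_le (exp_pos _).le (fun x => ?_) A
  rw [expW_apply, abs_exp, exp_le_exp]
  have := mul_le_mul_of_nonneg_left (W.one_le x) hu
  linarith

/-- `M_n (e^{-uβ} g)`. -/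
def conjOp (hn : 1 ≤ n) (u : ℝ) (p : DomM n) : L2 :=
  mulL (W.expW u) p.op - (2 * u) • mulL W.β₁ (mulL (W.expW u) (dxL hn p))
    + u ^ 2 • mulL W.β₁ (mulL W.β₁ (mulL (W.expW u) p.toL2))
    - u • mulL W.β₂ (mulL (W.expW u) p.toL2)

lemma exists_conj (hn : 1 ≤ n) (u : ℝ) (p : DomM n) : ∃ r : DomM n,
    r.toL2 = mulL (W.expW u) p.toL2 ∧ r.op = W.conjOp hn u p ∧
    dxL hn r = mulL (W.expW u) (dxL hn p) - u • mulL W.β₁ (mulL (W.expW u) p.toL2) := by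
  obtain ⟨r, h1, h2, h3⟩ := p.exists_mul hn (W.expW_hasDerivAt u) (W.expW_hasDerivAt₁ u)
  refine ⟨r, h1, h2.trans ?_, h3.trans ?_⟩
  · simp only [conjOp, map_smul, map_sub, _root_.smul_apply,
      _root_.sub_apply, mulL_mul]
    module
  · simp only [map_smul, _root_.smul_apply, mulL_mul]
    module

section Curve

variable {σ : ℝ → ℝ} {R R' t : ℝ} {G : ℝ → DomM n} {G' : DomM n}

lemma hasDerivAt_conj (hσ : HasDerivAt σ R t) (hG : HasDerivAt G G' t) :
    HasDerivAt (fun t => mulL (W.expW (σ t)) (G t).toL2)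
      (mulL (W.expW (σ t)) G'.toL2 - R • mulL W.β (mulL (W.expW (σ t)) (G t).toL2)) t := by
  have h1 : HasDerivAt (fun t => mulL (W.expW (σ t))) (mulL (R • -(W.β * W.expW (σ t)))) t :=
    mulL.hasFDerivAt.comp_hasDerivAt t ((W.hasDerivAt_expW (σ t)).scomp t hσ)
  have h2 : HasDerivAt (fun t => (G t).toL2) G'.toL2 t :=
    (DomM.toL2L n).hasFDerivAt.comp_hasDerivAt t hG
  refine (h1.clm_apply h2).congr_deriv ?_
  simp only [map_smul, map_neg, _root_.smul_apply, _root_.neg_apply,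
    mulL_mul]
  module

lemma differentiableAt_mulL_expW (hσ : DifferentiableAt ℝ σ t) {A : ℝ → L2}
    (hA : DifferentiableAt ℝ A t) : DifferentiableAt ℝ (fun t => mulL (W.expW (σ t)) (A t)) t := by
  have h1 : DifferentiableAt ℝ (fun t => mulL (W.expW (σ t))) t :=
    mulL.differentiableAt.comp t ((W.hasDerivAt_expW (σ t)).differentiableAt.comp t hσ)
  exact h1.clm_apply hA

lemma differentiableAt_conjOp (hn : 1 ≤ n) (hσ : DifferentiableAt ℝ σ t)
    (hG : DifferentiableAt ℝ G t) :
    DifferentiableAt ℝ (fun t => W.conjOp hn (σ t) (G t)) t := by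
  have d0 := W.differentiableAt_mulL_expW hσ ((DomM.toL2L n).differentiableAt.comp t hG)
  have d1 := W.differentiableAt_mulL_expW hσ ((dxL hn).differentiableAt.comp t hG)
  have d2 := W.differentiableAt_mulL_expW hσ ((DomM.opL n).differentiableAt.comp t hG)
  have m : ∀ (φ : ℝ →ᵇ ℝ) {A : ℝ → L2}, DifferentiableAt ℝ A t →
      DifferentiableAt ℝ (fun t => mulL φ (A t)) t := fun φ A hA =>
    (mulL φ).differentiableAt.comp t hA
  exact ((d2.sub ((hσ.const_mul 2).smul (m W.β₁ d1))).add
    ((hσ.pow 2).smul (m W.β₁ (m W.β₁ d0)))).sub (hσ.smul (m W.β₂ d0))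

/-- The quadratic form `½ ⟨S z, z⟩` of the symmetric part `S` at `z = e^{-σβ} g`. -/
def energyForm (hn : 1 ≤ n) (σ R : ℝ) (p : DomM n) : ℝ :=
  1 / 2 * (form (W.pot σ R) (mulL (W.expW σ) p.toL2) (mulL (W.expW σ) p.toL2)
    - inner ℝ (W.conjOp hn σ p) (mulL (W.expW σ) p.toL2))

lemma inner_conjOp_symm (hn : 1 ≤ n) (u v : ℝ) (p r : DomM n) :
    inner ℝ (W.conjOp hn u p) (mulL (W.expW v) r.toL2) =
      inner ℝ (W.conjOp hn v r) (mulL (W.expW u) p.toL2) := by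
  obtain ⟨p', hp0, hp1, -⟩ := W.exists_conj hn u p
  obtain ⟨r', hr0, hr1, -⟩ := W.exists_conj hn v r
  rw [← hp0, ← hp1, ← hr0, ← hr1, p'.inner_op_symm hn r', real_inner_comm]

lemma hasDerivAt_energyForm (hn : 1 ≤ n) {ρ : ℝ → ℝ} (hσ : HasDerivAt σ (ρ t) t)
    (hρ : HasDerivAt ρ R' t) (hG : HasDerivAt G G' t) {zt : L2}
    (hz : HasDerivAt (fun t => mulL (W.expW (σ t)) (G t).toL2) zt t) :
    HasDerivAt (fun t => W.energyForm hn (σ t) (ρ t) (G t))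
      (form (W.pot (σ t) (ρ t)) (mulL (W.expW (σ t)) (G t).toL2) zt
        - inner ℝ (W.conjOp hn (σ t) (G t)) zt
        + 1 / 2 * form (W.pot' (σ t) (ρ t) R') (mulL (W.expW (σ t)) (G t).toL2)
          (mulL (W.expW (σ t)) (G t).toL2)) t := by
  set z : ℝ → L2 := fun t => mulL (W.expW (σ t)) (G t).toL2
  set m : ℝ → L2 := fun t => W.conjOp hn (σ t) (G t)
  have hm := (W.differentiableAt_conjOp hn hσ.differentiableAt hG.differentiableAt).hasDerivAt
  set m' := deriv m t
  -- Symmetry of M_n between the values of z at two times is differentiated in one of them; `zt`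
  -- itself need not be shown to lie in the domain.
  have hsymm : inner ℝ m' (z t) = inner ℝ (m t) zt := by
    have h1 : HasDerivAt (fun r => inner ℝ (m r) (z t)) (inner ℝ m' (z t)) t := by
      simpa using hm.inner ℝ (hasDerivAt_const t (z t))
    have h2 : HasDerivAt (fun r => inner ℝ (m t) (z r)) (inner ℝ (m t) zt) t := by
      simpa using (hasDerivAt_const t (m t)).inner ℝ hz
    have h3 : (fun r => inner ℝ (m r) (z t)) = fun r => inner ℝ (m t) (z r) :=
      funext fun r => W.inner_conjOp_symm hn _ _ _ _
    rw [h3] at h1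
    exact h1.unique h2
  have hpot : HasDerivAt (fun t => W.pot (σ t) (ρ t)) (W.pot' (σ t) (ρ t) R') t := by
    refine ((hρ.smul_const W.β).sub ((hσ.pow 2).smul_const (W.β₁ * W.β₁))).congr_deriv ?_
    simp only [pot', Nat.cast_ofNat, Nat.add_one_sub_one, pow_one]
  have hpz : HasDerivAt (fun t => mulL (W.pot (σ t) (ρ t)) (z t))
      (mulL (W.pot' (σ t) (ρ t) R') (z t) + mulL (W.pot (σ t) (ρ t)) zt) t :=
    (mulL.hasFDerivAt.comp_hasDerivAt t hpot).clm_apply hz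
  refine (((hpz.inner ℝ hz).sub (hm.inner ℝ hz)).const_mul (1 / 2)).congr_deriv ?_
  rw [inner_add_left, hsymm]
  change 1 / 2 * (form _ _ _ + (form _ _ _ + form _ _ _) - _) = _
  rw [form_symm (W.pot (σ t) (ρ t)) zt]
  ring

lemma symm_add_anti (hn : 1 ≤ n) (σ R : ℝ) (p p' r : DomM n)
    (h0 : r.toL2 = mulL (W.expW σ) p.toL2) (hM : r.op = W.conjOp hn σ p)
    (h1 : dxL hn r = mulL (W.expW σ) (dxL hn p) - σ • mulL W.β₁ (mulL (W.expW σ) p.toL2)) :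
    W.symmPart σ R r + W.antiPart hn σ r
      (mulL (W.expW σ) p'.toL2 - R • mulL W.β (mulL (W.expW σ) p.toL2)) =
    mulL (W.expW σ) (p'.toL2 - p.op) := by
  simp only [symmPart, antiPart, h0, hM, h1, conjOp, pot, map_sub, map_smul,
    _root_.smul_apply, _root_.sub_apply, mulL_mul]
  module

end Curve

/-- The constant in front of the left-hand side of the Carleman estimate. -/
def lowConst : ℝ := W.κ / (1 + 2 * W.K ^ 2)

lemma lowConst_pos : 0 < W.lowConst := by
  have := W.κ_pos
  unfold lowConst; positivity

/-- The left-hand side density of the Carleman estimate. -/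
def lhsDensity (hn : 1 ≤ n) (σ : ℝ) (p : DomM n) : ℝ :=
  σ * ‖mulL (W.expW σ) (dxL hn p)‖ ^ 2 + σ ^ 3 * ‖mulL (W.expW σ) p.toL2‖ ^ 2

/-- The doubled bracket is the time derivative of 2 `energyForm`, by `hasDerivAt_energyForm`.
Returning from z' to e^{-σβ}∂_x g = z' + σβ'z costs the factor 1 + 2K² in `lowConst`. -/
theorem differential_inequality (hn : 1 ≤ n) (hb : b ∈ Ioo 0 (π / 2)) {σ R R' ε : ℝ} (hε : 0 < ε)
    (hε1 : ε ≤ 1) (hεK : 8 * ε * W.K ^ 2 ≤ W.κ) (hσ : 1 ≤ σ) (hεσ : 1 ≤ ε * σ)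
    (hR : |R| ≤ ε * σ ^ 2) (hR' : |R'| ≤ 3 * ε * σ ^ 3) (p p' : DomM n) {zt : L2}
    (hzt : zt = mulL (W.expW σ) p'.toL2 - R • mulL W.β (mulL (W.expW σ) p.toL2)) :
    2 * (form (W.pot σ R) (mulL (W.expW σ) p.toL2) zt - inner ℝ (W.conjOp hn σ p) zt
        + 1 / 2 * form (W.pot' σ R R') (mulL (W.expW σ) p.toL2) (mulL (W.expW σ) p.toL2))
      + W.lowConst * W.lhsDensity hn σ p ≤
    ‖mulL (W.expW σ) (p'.toL2 - p.op)‖ ^ 2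
      + W.obsConst * (σ ^ 3 * obs b (mulL (W.expW σ) p.toL2)) := by
  obtain ⟨r, h0, hM, h1⟩ := W.exists_conj hn σ p
  have key := W.conjugated_estimate hn hb hε hε1 hεK hσ hεσ hR hR' r zt
  rw [hzt, W.symm_add_anti hn σ R p p' r h0 hM h1, ← hzt, symmPart, inner_sub_left, h0, hM] at key
  have hK := W.one_le_K
  have hσ0 : 0 < σ := by linarith
  set v := mulL (W.expW σ) p.toL2
  set v₁ := mulL (W.expW σ) (dxL hn p)
  have e1 : ‖v₁‖ ^ 2 ≤ 2 * ‖dxL hn r‖ ^ 2 + 2 * (σ ^ 2 * W.K ^ 2 * ‖v‖ ^ 2) := by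
    have e2 : v₁ = dxL hn r + σ • mulL W.β₁ v := by rw [h1]; abel
    have e3 : ‖mulL W.β₁ v‖ ≤ W.K * ‖v‖ := norm_mulL_le (by linarith) W.bound₁ v
    have e4 : ‖v₁‖ ≤ ‖dxL hn r‖ + σ * (W.K * ‖v‖) := by
      rw [e2]
      refine (norm_add_le _ _).trans ?_
      rw [norm_smul, norm_of_nonneg hσ0.le]
      gcongr
    calc ‖v₁‖ ^ 2 ≤ (‖dxL hn r‖ + σ * (W.K * ‖v‖)) ^ 2 := by gcongr
      _ ≤ _ := by nlinarith [sq_nonneg (‖dxL hn r‖ - σ * (W.K * ‖v‖))]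
  have e5 : W.lhsDensity hn σ p ≤
      (1 + 2 * W.K ^ 2) * (2 * σ * ‖dxL hn r‖ ^ 2 + σ ^ 3 * ‖v‖ ^ 2) := by
    have a1 := mul_le_mul_of_nonneg_left e1 hσ0.le
    have a2 : 0 ≤ W.K ^ 2 * (σ * ‖dxL hn r‖ ^ 2) := by positivity
    change σ * ‖v₁‖ ^ 2 + σ ^ 3 * ‖v‖ ^ 2 ≤ _
    linarith
  have e6 : W.lowConst * W.lhsDensity hn σ p ≤
      2 * σ * W.κ * ‖dxL hn r‖ ^ 2 + σ ^ 3 * W.κ * ‖v‖ ^ 2 := by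
    have a1 := mul_le_mul_of_nonneg_left e5 W.lowConst_pos.le
    have a2 : W.lowConst * (1 + 2 * W.K ^ 2) = W.κ := by
      unfold lowConst; field_simp
    rw [← mul_assoc, a2] at a1
    linarith
  have e7 : inner ℝ (mulL (W.pot σ R) v) zt = form (W.pot σ R) v zt := rfl
  rw [e7] at key
  linarith

end Weight

/-! ### Singular time weights and integration in time. -/

/-- `1 / ((t - a) (d - t))`. -/
def timeWeight (a d t : ℝ) : ℝ := 1 / ((t - a) * (d - t))

/-- The derivative of `timeWeight`. -/
def timeWeight' (a d t : ℝ) : ℝ := (2 * t - a - d) * timeWeight a d t ^ 2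

/-- The second derivative of `timeWeight`. -/
def timeWeight'' (a d t : ℝ) : ℝ :=
  2 * timeWeight a d t ^ 2 + 2 * (2 * t - a - d) ^ 2 * timeWeight a d t ^ 3

section TimeWeight

variable {a d t : ℝ}

lemma hasDerivAt_timeWeight (ht : t ∈ Ioo a d) :
    HasDerivAt (timeWeight a d) (timeWeight' a d t) t := by
  have h1 : t - a ≠ 0 := by linarith [ht.1]
  have h2 : d - t ≠ 0 := by linarith [ht.2]
  have h := (((hasDerivAt_id t).sub_const a).mul ((hasDerivAt_id t).const_sub d)).inv
    (mul_ne_zero h1 h2)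
  have e : timeWeight a d = (fun y => (id y - a) * (d - id y))⁻¹ := by
    funext y; simp [timeWeight]
  rw [e]
  refine h.congr_deriv ?_
  simp only [timeWeight', timeWeight, id, Pi.mul_apply]
  field_simp
  ring

lemma hasDerivAt_timeWeight' (ht : t ∈ Ioo a d) :
    HasDerivAt (timeWeight' a d) (timeWeight'' a d t) t := by
  have h := ((((hasDerivAt_id t).const_mul 2).sub_const a).sub_const d).mul
    ((hasDerivAt_timeWeight ht).pow 2)
  refine h.congr_deriv ?_
  simp only [timeWeight', timeWeight'', id, Pi.pow_apply]
  ring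

lemma timeWeight_pos (ht : t ∈ Ioo a d) : 0 < timeWeight a d t := by
  have h1 : 0 < t - a := by linarith [ht.1]
  have h2 : 0 < d - t := by linarith [ht.2]
  unfold timeWeight; positivity

lemma four_le_timeWeight (ht : t ∈ Ioo a d) : 4 ≤ timeWeight a d t * (d - a) ^ 2 := by
  have h1 : 0 < t - a := by linarith [ht.1]
  have h2 : 0 < d - t := by linarith [ht.2]
  rw [timeWeight, one_div_mul_eq_div, le_div_iff₀ (by positivity)]
  nlinarith [sq_nonneg ((t - a) - (d - t))]

/-- For σ = sθ these are the hypotheses of `Weight.differential_inequality` with ε = C⁻¹. With L = d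
- a they follow from |θ'| ≤ Lθ², θL² ≥ 4 and s ≥ C(L + L²). -/
lemma timeWeight_bounds {s C : ℝ} (hC : 1 ≤ C) (ht : t ∈ Ioo a d)
    (hs : C * ((d - a) + (d - a) ^ 2) ≤ s) :
    1 ≤ s * timeWeight a d t ∧ 1 ≤ C⁻¹ * (s * timeWeight a d t) ∧
      |s * timeWeight' a d t| ≤ C⁻¹ * (s * timeWeight a d t) ^ 2 ∧
      |s * timeWeight'' a d t| ≤ 3 * C⁻¹ * (s * timeWeight a d t) ^ 3 := by
  have hL : 0 < d - a := by linarith [ht.1, ht.2]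
  have h4 := four_le_timeWeight ht
  have hθ := timeWeight_pos ht
  have hg : |2 * t - a - d| ≤ d - a := abs_le.2 ⟨by linarith [ht.1], by linarith [ht.2]⟩
  have hC0 : 0 < C := by linarith
  unfold timeWeight' timeWeight''
  set θ := timeWeight a d t
  set L := d - a
  set g := 2 * t - a - d
  have hsL : C * L ≤ s := by nlinarith
  have hsL2 : C * L ^ 2 ≤ s := by nlinarith
  have hs0 : 0 < s := lt_of_lt_of_le (by positivity) hsL
  have b2 : C ≤ s * θ := by nlinarith
  refine ⟨hC.trans b2, ?_, ?_, ?_⟩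
  · rw [inv_mul_eq_div, le_div_iff₀ hC0]; linarith
  · rw [inv_mul_eq_div, le_div_iff₀ hC0, abs_mul, abs_mul, abs_of_pos hs0,
      abs_of_pos (show 0 < θ ^ 2 by positivity)]
    calc s * (|g| * θ ^ 2) * C ≤ s * (L * θ ^ 2) * C := by gcongr
      _ = s * θ ^ 2 * (C * L) := by ring
      _ ≤ s * θ ^ 2 * s := by gcongr
      _ = (s * θ) ^ 2 := by ring
  · have e1 : |s * (2 * θ ^ 2 + 2 * g ^ 2 * θ ^ 3)| = s * (2 * θ ^ 2 + 2 * g ^ 2 * θ ^ 3) :=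
      abs_of_nonneg (by positivity)
    have e2 : g ^ 2 ≤ L ^ 2 := by rw [← sq_abs g]; gcongr
    have e3 : 2 * θ ^ 2 ≤ L ^ 2 * θ ^ 3 := by
      have : 2 * θ ^ 2 ≤ (θ * L ^ 2) * θ ^ 2 := by gcongr; linarith
      linarith
    have e4 : C * L ^ 2 ≤ s ^ 2 := by
      calc C * L ^ 2 ≤ (C * L) ^ 2 := by
            rw [mul_pow]; gcongr; nlinarith
        _ ≤ s ^ 2 := by gcongr
    rw [e1, mul_assoc 3, inv_mul_eq_div, ← mul_div_assoc, le_div_iff₀ hC0]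
    calc s * (2 * θ ^ 2 + 2 * g ^ 2 * θ ^ 3) * C
        ≤ s * (L ^ 2 * θ ^ 3 + 2 * L ^ 2 * θ ^ 3) * C := by gcongr
      _ = 3 * s * θ ^ 3 * (C * L ^ 2) := by ring
      _ ≤ 3 * s * θ ^ 3 * s ^ 2 := by gcongr
      _ = 3 * (s * θ) ^ 3 := by ring

lemma tendsto_timeWeight_left (h : a < d) : Tendsto (timeWeight a d) (𝓝[>] a) atTop := by
  have h1 : Tendsto (fun t => (t - a) * (d - t)) (𝓝[>] a) (𝓝[>] 0) := by
    refine tendsto_nhdsWithin_of_tendsto_nhds_of_eventually_within _ ?_ ?_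
    · have : Continuous (fun t => (t - a) * (d - t)) := by fun_prop
      simpa using (this.tendsto a).mono_left nhdsWithin_le_nhds
    · filter_upwards [Ioo_mem_nhdsGT h] with t ht
      exact mul_pos (sub_pos.2 ht.1) (sub_pos.2 ht.2)
  have e : timeWeight a d = fun t => ((t - a) * (d - t))⁻¹ := by
    funext t; rw [timeWeight, one_div]
  rw [e]
  exact tendsto_inv_nhdsGT_zero.comp h1

lemma tendsto_timeWeight_right (h : a < d) : Tendsto (timeWeight a d) (𝓝[<] d) atTop := by
  have h1 : Tendsto (fun t => (t - a) * (d - t)) (𝓝[<] d) (𝓝[>] 0) := by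
    refine tendsto_nhdsWithin_of_tendsto_nhds_of_eventually_within _ ?_ ?_
    · have : Continuous (fun t => (t - a) * (d - t)) := by fun_prop
      simpa using (this.tendsto d).mono_left nhdsWithin_le_nhds
    · filter_upwards [Ioo_mem_nhdsLT h] with t ht
      exact mul_pos (sub_pos.2 ht.1) (sub_pos.2 ht.2)
  have e : timeWeight a d = fun t => ((t - a) * (d - t))⁻¹ := by
    funext t; rw [timeWeight, one_div]
  rw [e]
  exact tendsto_inv_nhdsGT_zero.comp h1

end TimeWeight

/-- Integrate over [a + δ, d - δ] and let δ → 0. Neither integrability of F' nor finiteness of the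
integral of B is required. -/
lemma lintegral_le_of_deriv_add_le {a d : ℝ} (had : a < d) {F F' A B : ℝ → ℝ}
    (hF : ∀ t ∈ Ioo a d, HasDerivAt F (F' t) t) (hA : ContinuousOn A (Ioo a d))
    (hB : ContinuousOn B (Ioo a d)) (hA0 : ∀ t ∈ Ioo a d, 0 ≤ A t) (hB0 : ∀ t ∈ Ioo a d, 0 ≤ B t)
    (h : ∀ t ∈ Ioo a d, F' t + A t ≤ B t) (hl : Tendsto F (𝓝[>] a) (𝓝 0))
    (hr : Tendsto F (𝓝[<] d) (𝓝 0)) :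
    ∫⁻ t in Ioo a d, ENNReal.ofReal (A t) ≤ ∫⁻ t in Ioo a d, ENNReal.ofReal (B t) := by
  have tid : Tendsto (fun δ : ℝ => δ) (𝓝[>] 0) (𝓝 0) := nhdsWithin_le_nhds
  have t1 : Tendsto (fun δ : ℝ => a + δ) (𝓝[>] 0) (𝓝 a) := by simpa using tid.const_add a
  have t2 : Tendsto (fun δ : ℝ => d - δ) (𝓝[>] 0) (𝓝 d) := by simpa using tid.const_sub d
  have t1' : Tendsto (fun δ : ℝ => a + δ) (𝓝[>] 0) (𝓝[>] a) :=
    tendsto_nhdsWithin_of_tendsto_nhds_of_eventually_within _ t1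
      (by filter_upwards [self_mem_nhdsWithin] with δ hδ; simpa using hδ)
  have t2' : Tendsto (fun δ : ℝ => d - δ) (𝓝[>] 0) (𝓝[<] d) :=
    tendsto_nhdsWithin_of_tendsto_nhds_of_eventually_within _ t2
      (by filter_upwards [self_mem_nhdsWithin] with δ hδ; simpa using hδ)
  have hcov : AECover (volume.restrict (Ioo a d)) (𝓝[>] (0 : ℝ))
      (fun δ => Ioc (a + δ) (d - δ)) := aecover_Ioo_of_Ioc t1 t2
  have hlim := hcov.lintegral_tendsto_of_countably_generated
    (hA.aemeasurable measurableSet_Ioo).ennreal_ofReal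
  have herr : Tendsto (fun δ => (∫⁻ t in Ioo a d, ENNReal.ofReal (B t)) +
      ENNReal.ofReal (F (a + δ) - F (d - δ))) (𝓝[>] 0)
      (𝓝 ((∫⁻ t in Ioo a d, ENNReal.ofReal (B t)) + ENNReal.ofReal (0 - 0))) :=
    tendsto_const_nhds.add (ENNReal.tendsto_ofReal ((hl.comp t1').sub (hr.comp t2')))
  rw [sub_zero, ENNReal.ofReal_zero, add_zero] at herr
  refine le_of_tendsto_of_tendsto hlim herr ?_
  filter_upwards [Ioo_mem_nhdsGT (show (0 : ℝ) < (d - a) / 2 by linarith)] with δ hδ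
  set c := a + δ
  set e := d - δ
  have hce : c ≤ e := by simp only [c, e]; linarith [hδ.2]
  have hsub : Icc c e ⊆ Ioo a d := fun t ht =>
    ⟨by linarith [ht.1, hδ.1], by linarith [ht.2, hδ.1]⟩
  have hsub' : Ioc c e ⊆ Ioo a d := Ioc_subset_Icc_self.trans hsub
  have iA : IntegrableOn A (Icc c e) := (hA.mono hsub).integrableOn_Icc
  have iB : IntegrableOn B (Icc c e) := (hB.mono hsub).integrableOn_Icc
  have key := intervalIntegral.sub_le_integral_of_hasDeriv_right_of_le hce
    (fun t ht => (hF t (hsub ht)).continuousAt.continuousWithinAt)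
    (fun t ht => (hF t (hsub (Ioo_subset_Icc_self ht))).hasDerivWithinAt) (iB.sub iA)
    (fun t ht => by
      have := h t (hsub (Ioo_subset_Icc_self ht))
      simp only [Pi.sub_apply]; linarith)
  simp only [Pi.sub_apply] at key
  rw [intervalIntegral.integral_sub
    ((intervalIntegrable_iff_integrableOn_Icc_of_le hce).2 iB)
    ((intervalIntegrable_iff_integrableOn_Icc_of_le hce).2 iA),
    intervalIntegral.integral_of_le hce, intervalIntegral.integral_of_le hce] at key
  rw [Measure.restrict_restrict measurableSet_Ioc, inter_eq_left.2 hsub',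
    ← ofReal_integral_eq_lintegral_ofReal (iA.mono_set Ioc_subset_Icc_self)
      ((ae_restrict_iff' measurableSet_Ioc).2 (.of_forall fun t ht => hA0 t (hsub' ht)))]
  calc ENNReal.ofReal (∫ t in Ioc c e, A t)
      ≤ ENNReal.ofReal ((∫ t in Ioc c e, B t) + (F c - F e)) :=
        ENNReal.ofReal_le_ofReal (by linarith)
    _ ≤ ENNReal.ofReal (∫ t in Ioc c e, B t) + ENNReal.ofReal (F c - F e) :=
        ENNReal.ofReal_add_le
    _ ≤ _ := by
        gcongr
        rw [ofReal_integral_eq_lintegral_ofReal (iB.mono_set Ioc_subset_Icc_self)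
          ((ae_restrict_iff' measurableSet_Ioc).2 (.of_forall fun t ht => hB0 t (hsub' ht)))]
        exact lintegral_mono_set hsub'

lemma obs_eq_norm_sq {b : ℝ} (hb : b ∈ Ioo 0 (π / 2)) (A : L2) :
    obs b A = ‖LpToLpRestrictCLM ℝ ℂ ℝ μI 2 (Ioo (-b) b) A‖ ^ 2 := by
  have hss : Ioo (-b) b ⊆ I := Ioo_subset_Ioc_self.trans (Ioc_neg_subset_I hb)
  rw [obs, ← Measure.restrict_restrict_of_subset hss, ← real_inner_self_eq_norm_sq, L2.inner_def]
  refine integral_congr_ae ?_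
  filter_upwards [LpToLpRestrictCLM_coeFn ℝ (Ioo (-b) b) A] with x hx
  rw [real_inner_self_eq_norm_sq]
  exact congrArg (fun z : ℂ => ‖z‖ ^ 2) hx.symm

lemma continuous_obs {b : ℝ} (hb : b ∈ Ioo 0 (π / 2)) : Continuous (obs b) := by
  have : obs b = fun A => ‖LpToLpRestrictCLM ℝ ℂ ℝ μI 2 (Ioo (-b) b) A‖ ^ 2 :=
    funext (obs_eq_norm_sq hb)
  rw [this]
  fun_prop

/-! ### The integrated estimate for curves bounded in the graph norm. -/

namespace Weight

variable {b : ℝ} (W : Weight b) {n : ℕ}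

lemma obsConst_nonneg : 0 ≤ W.obsConst := by
  have := W.one_le_K
  unfold obsConst; positivity

lemma lhsDensity_nonneg (hn : 1 ≤ n) {σ : ℝ} (hσ : 0 ≤ σ) (p : DomM n) :
    0 ≤ W.lhsDensity hn σ p := by
  unfold lhsDensity; positivity

lemma continuous_expW : Continuous W.expW :=
  continuous_iff_continuousAt.2 fun u => (W.hasDerivAt_expW u).continuousAt

lemma continuousOn_mulL_expW {σ : ℝ → ℝ} {A : ℝ → L2} {S : Set ℝ} (hσ : ContinuousOn σ S)
    (hA : ContinuousOn A S) : ContinuousOn (fun t => mulL (W.expW (σ t)) (A t)) S :=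
  ((mulL.continuous.comp W.continuous_expW).comp_continuousOn hσ).clm_apply hA

lemma continuousOn_lhsDensity (hn : 1 ≤ n) {σ : ℝ → ℝ} {G : ℝ → DomM n} {S : Set ℝ}
    (hσ : ContinuousOn σ S) (hG : ContinuousOn G S) :
    ContinuousOn (fun t => W.lhsDensity hn (σ t) (G t)) S := by
  have h1 := (W.continuousOn_mulL_expW hσ ((dxL hn).continuous.comp_continuousOn hG)).norm
  have h2 := (W.continuousOn_mulL_expW hσ ((DomM.toL2L n).continuous.comp_continuousOn hG)).norm
  exact (hσ.mul (h1.pow 2)).add ((hσ.pow 3).mul (h2.pow 2))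

/-- As β ≥ 1, conjugation contributes e^{-σ}, against at most σ² from the coefficients. The boundary
terms therefore vanish as σ → ∞, and the size of M plays no role in the final constants. -/
lemma exists_energyForm_bound (hn : 1 ≤ n) (N : ℝ) : ∃ M, ∀ (σ R : ℝ) (p : DomM n), 1 ≤ σ →
    |R| ≤ σ ^ 2 → ‖p‖ ≤ N → |W.energyForm hn σ R p| ≤ M * (σ ^ 2 * exp (-σ)) := by
  set D := ‖dxL hn‖
  have hD : 0 ≤ D := norm_nonneg (dxL hn)
  refine ⟨(2 * W.K ^ 2 + (1 + 2 * W.K * D + W.K ^ 2 + ‖W.β₂‖)) * N ^ 2, fun σ R p hσ hR hp => ?_⟩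
  have hK := W.one_le_K
  have hN : 0 ≤ N := (norm_nonneg _).trans hp
  have hσ0 : 0 ≤ σ := by linarith
  set E := exp (-σ)
  have hE : 0 < E := exp_pos _
  have hE1 : E ≤ 1 := exp_le_one_iff.2 (by linarith)
  set v := mulL (W.expW σ) p.toL2
  have hv : ‖v‖ ≤ E * N := (W.norm_expW_le hσ0 _).trans (by
    have : ‖p.toL2‖ ≤ N := (norm_fst_le p.1).trans hp
    gcongr)
  have hm : ‖mulL (W.expW σ) p.op‖ ≤ E * N := (W.norm_expW_le hσ0 _).trans (by
    have : ‖p.op‖ ≤ N := (norm_snd_le p.1).trans hp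
    gcongr)
  have hd : ‖mulL (W.expW σ) (dxL hn p)‖ ≤ E * (D * N) := (W.norm_expW_le hσ0 _).trans (by
    have : ‖dxL hn p‖ ≤ D * N := (dxL hn).le_opNorm_of_le hp
    gcongr)
  have m1 : ∀ A, ‖mulL W.β₁ A‖ ≤ W.K * ‖A‖ := norm_mulL_le (by linarith) W.bound₁
  have m2 : ∀ A, ‖mulL W.β₂ A‖ ≤ ‖W.β₂‖ * ‖A‖ :=
    norm_mulL_le (norm_nonneg _) W.β₂.norm_coe_le_norm
  have mp : ‖mulL (W.pot σ R) v‖ ≤ 2 * σ ^ 2 * W.K ^ 2 * ‖v‖ := by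
    refine norm_mulL_le (by positivity) (fun x => ?_) v
    have hβ := W.bound x
    have hβ₁ := W.bound₁ x
    have e1 : |R * W.β x| ≤ σ ^ 2 * W.K ^ 2 := by
      rw [abs_mul]
      have : W.K ≤ W.K ^ 2 := by nlinarith
      calc |R| * |W.β x| ≤ σ ^ 2 * W.K := by gcongr
        _ ≤ _ := by gcongr
    have e2 : |σ ^ 2 * (W.β₁ x * W.β₁ x)| ≤ σ ^ 2 * W.K ^ 2 := by
      rw [abs_mul, abs_mul, ← sq, abs_of_nonneg (sq_nonneg σ)]; gcongr
    have e3 : (W.pot σ R) x = R * W.β x - σ ^ 2 * (W.β₁ x * W.β₁ x) := rfl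
    rw [e3]
    refine (abs_sub _ _).trans ?_
    linarith
  have hconj : ‖W.conjOp hn σ p‖ ≤ (1 + 2 * W.K * D + W.K ^ 2 + ‖W.β₂‖) * (σ ^ 2 * (E * N)) := by
    have hσ1 : σ ≤ σ ^ 2 := by nlinarith
    have hσ2 : 1 ≤ σ ^ 2 := by nlinarith
    have n1 : ‖(2 * σ) • mulL W.β₁ (mulL (W.expW σ) (dxL hn p))‖ ≤
        2 * W.K * D * (σ ^ 2 * (E * N)) := by
      rw [norm_smul, norm_of_nonneg (by positivity)]
      calc 2 * σ * ‖mulL W.β₁ (mulL (W.expW σ) (dxL hn p))‖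
          ≤ 2 * σ ^ 2 * (W.K * (E * (D * N))) := by
            gcongr; exact (m1 _).trans (by gcongr)
        _ = _ := by ring
    have n2 : ‖σ ^ 2 • mulL W.β₁ (mulL W.β₁ v)‖ ≤ W.K ^ 2 * (σ ^ 2 * (E * N)) := by
      rw [norm_smul, norm_of_nonneg (by positivity)]
      calc σ ^ 2 * ‖mulL W.β₁ (mulL W.β₁ v)‖ ≤ σ ^ 2 * (W.K * (W.K * (E * N))) := by
            gcongr
            refine (m1 _).trans ?_
            gcongr
            exact (m1 _).trans (by gcongr)
        _ = _ := by ring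
    have n3 : ‖σ • mulL W.β₂ v‖ ≤ ‖W.β₂‖ * (σ ^ 2 * (E * N)) := by
      rw [norm_smul, norm_of_nonneg (by positivity)]
      calc σ * ‖mulL W.β₂ v‖ ≤ σ ^ 2 * (‖W.β₂‖ * (E * N)) := by
            gcongr; exact (m2 _).trans (by gcongr)
        _ = _ := by ring
    have n4 : ‖mulL (W.expW σ) p.op‖ ≤ σ ^ 2 * (E * N) :=
      hm.trans (le_mul_of_one_le_left (by positivity) hσ2)
    have := norm_sub_le (mulL (W.expW σ) p.op - (2 * σ) • mulL W.β₁ (mulL (W.expW σ) (dxL hn p))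
      + σ ^ 2 • mulL W.β₁ (mulL W.β₁ v)) (σ • mulL W.β₂ v)
    have := norm_add_le (mulL (W.expW σ) p.op
      - (2 * σ) • mulL W.β₁ (mulL (W.expW σ) (dxL hn p))) (σ ^ 2 • mulL W.β₁ (mulL W.β₁ v))
    have := norm_sub_le (mulL (W.expW σ) p.op)
      ((2 * σ) • mulL W.β₁ (mulL (W.expW σ) (dxL hn p)))
    unfold conjOp
    linarith
  have i1 : |form (W.pot σ R) v v| ≤ 2 * W.K ^ 2 * N ^ 2 * (σ ^ 2 * E) := by
    refine (abs_real_inner_le_norm _ _).trans ?_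
    calc ‖mulL (W.pot σ R) v‖ * ‖v‖ ≤ (2 * σ ^ 2 * W.K ^ 2 * (E * N)) * (1 * N) := by
          gcongr
          · exact mp.trans (by gcongr)
          · exact hv.trans (by gcongr)
      _ = _ := by ring
  have hβ₂ := norm_nonneg W.β₂
  have i2 : |inner ℝ (W.conjOp hn σ p) v| ≤
      (1 + 2 * W.K * D + W.K ^ 2 + ‖W.β₂‖) * N ^ 2 * (σ ^ 2 * E) := by
    refine (abs_real_inner_le_norm _ _).trans ?_
    calc ‖W.conjOp hn σ p‖ * ‖v‖ ≤
        (1 + 2 * W.K * D + W.K ^ 2 + ‖W.β₂‖) * (σ ^ 2 * (E * N)) * (1 * N) := by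
          gcongr
          exact hv.trans (by gcongr)
      _ = _ := by ring
  have i3 := abs_sub (form (W.pot σ R) v v) (inner ℝ (W.conjOp hn σ p) v)
  unfold energyForm
  rw [abs_mul, abs_of_pos (by norm_num : (0 : ℝ) < 1 / 2)]
  have i4 := abs_nonneg (form (W.pot σ R) v v - inner ℝ (W.conjOp hn σ p) v)
  linarith

end Weight

lemma ofReal_norm_sq_eq (A : L2) :
    ENNReal.ofReal (‖A‖ ^ 2) = ∫⁻ x in I, ENNReal.ofReal (‖A x‖ ^ 2) := by
  have h : Integrable (fun x => ‖A x‖ ^ 2) μI := (Lp.memLp A).norm.integrable_sq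
  rw [← ofReal_integral_eq_lintegral_ofReal h (.of_forall fun x => sq_nonneg _),
    ← real_inner_self_eq_norm_sq, L2.inner_def]
  simp only [real_inner_self_eq_norm_sq]

lemma ofReal_obs_eq {b : ℝ} (hb : b ∈ Ioo 0 (π / 2)) (A : L2) :
    ENNReal.ofReal (obs b A) = ∫⁻ x in Ioo (-b) b, ENNReal.ofReal (‖A x‖ ^ 2) := by
  have h : Integrable (fun x => ‖A x‖ ^ 2) μI := (Lp.memLp A).norm.integrable_sq
  have hss : Ioo (-b) b ⊆ I := Ioo_subset_Ioc_self.trans (Ioc_neg_subset_I hb)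
  rw [obs, ofReal_integral_eq_lintegral_ofReal (IntegrableOn.mono_set h hss)
    (.of_forall fun x => sq_nonneg _)]

/-- The function u³e^{-2uβ} decreases for u ≥ 3/(2β). This compares the weights of truncated time
intervals with the full one. -/
lemma pow_three_mul_exp_antitone {u v β : ℝ} (hu : 3 / 2 ≤ u) (huv : u ≤ v) (hβ : 1 ≤ β) :
    v ^ 3 * exp (-2 * v * β) ≤ u ^ 3 * exp (-2 * u * β) := by
  have hu0 : 0 < u := by linarith
  have h1 : v / u ≤ exp (v / u - 1) := by linarith [add_one_le_exp (v / u - 1)]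
  have h2 : 3 * (v / u - 1) ≤ 2 * (v - u) * β := by
    have e : v / u - 1 = (v - u) / u := by field_simp
    rw [e, ← mul_div_assoc, div_le_iff₀ hu0]
    have : 3 ≤ 2 * β * u := by nlinarith
    nlinarith
  have h3 : (v / u) ^ 3 ≤ exp (2 * (v - u) * β) := by
    have h0 : 0 ≤ v / u := div_nonneg (by linarith) hu0.le
    calc (v / u) ^ 3 ≤ exp (v / u - 1) ^ 3 := by gcongr
      _ = exp (3 * (v / u - 1)) := by rw [← exp_nat_mul]; norm_num
      _ ≤ _ := exp_le_exp.2 h2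
  calc v ^ 3 * exp (-2 * v * β) = u ^ 3 * (v / u) ^ 3 * exp (-2 * v * β) := by field_simp
    _ ≤ u ^ 3 * exp (2 * (v - u) * β) * exp (-2 * v * β) := by gcongr
    _ = u ^ 3 * exp (-2 * u * β) := by rw [mul_assoc, ← exp_add]; ring_nf

namespace Weight

variable {b : ℝ} (W : Weight b) {n : ℕ}

lemma norm_mulL_expW_sq (σ : ℝ) (A : L2) :
    (fun x => ‖mulL (W.expW σ) A x‖ ^ 2) =ᵐ[μI] fun x => ‖A x‖ ^ 2 * exp (-2 * σ * W.β x) := by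
  filter_upwards [coeFn_mulL (W.expW σ) A] with x hx
  rw [hx, norm_mul, Complex.norm_real, mul_pow, Real.norm_eq_abs, sq_abs, expW_apply, mul_comm,
    ← exp_nat_mul]
  congr 2
  push_cast; ring

lemma ofReal_norm_expW_sq (σ : ℝ) (A : L2) : ENNReal.ofReal (‖mulL (W.expW σ) A‖ ^ 2) =
    ∫⁻ x in I, ENNReal.ofReal (‖A x‖ ^ 2 * exp (-2 * σ * W.β x)) := by
  rw [ofReal_norm_sq_eq]
  refine lintegral_congr_ae ?_
  filter_upwards [W.norm_mulL_expW_sq σ A] with x hx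
  rw [hx]

lemma ofReal_obs_expW (hb : b ∈ Ioo 0 (π / 2)) {σ : ℝ} (hσ : 0 ≤ σ) (A : L2) :
    ENNReal.ofReal (σ ^ 3 * obs b (mulL (W.expW σ) A)) =
      ∫⁻ x in Ioo (-b) b, ENNReal.ofReal (‖A x‖ ^ 2 * (σ ^ 3 * exp (-2 * σ * W.β x))) := by
  have hss : Ioo (-b) b ⊆ I := Ioo_subset_Ioc_self.trans (Ioc_neg_subset_I hb)
  rw [ENNReal.ofReal_mul (by positivity), ofReal_obs_eq hb, ← lintegral_const_mul'' _
    (((Lp.aestronglyMeasurable (mulL (W.expW σ) A)).norm.aemeasurable.pow_const 2).ennreal_ofReal.mono_measure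
      (Measure.restrict_mono hss le_rfl))]
  refine lintegral_congr_ae ?_
  filter_upwards [ae_restrict_of_ae_restrict_of_subset hss (W.norm_mulL_expW_sq σ A)] with x hx
  rw [hx, ← ENNReal.ofReal_mul (by positivity)]
  congr 1; ring

lemma ofReal_lhsDensity (hn : 1 ≤ n) {σ : ℝ} (hσ : 0 ≤ σ) (p : DomM n) :
    ENNReal.ofReal (W.lhsDensity hn σ p) = ∫⁻ x in I, ENNReal.ofReal
      ((σ * ‖p.dx x‖ ^ 2 + σ ^ 3 * ‖p.toL2 x‖ ^ 2) * exp (-2 * σ * W.β x)) := by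
  have m : ∀ (A : L2), AEMeasurable (fun x => ENNReal.ofReal (‖mulL (W.expW σ) A x‖ ^ 2)) μI :=
    fun A => ((Lp.aestronglyMeasurable _).norm.aemeasurable.pow_const 2).ennreal_ofReal
  rw [lhsDensity, ENNReal.ofReal_add (by positivity) (by positivity),
    ENNReal.ofReal_mul hσ, ENNReal.ofReal_mul (by positivity), ofReal_norm_sq_eq,
    ofReal_norm_sq_eq, ← lintegral_const_mul'' _ (m _), ← lintegral_const_mul'' _ (m _),
    ← lintegral_add_left' ((m _).const_mul _)]
  refine lintegral_congr_ae ?_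
  filter_upwards [W.norm_mulL_expW_sq σ (dxL hn p), W.norm_mulL_expW_sq σ p.toL2,
    coeFn_dxL hn p] with x h1 h2 h3
  rw [h1, h2, h3, ← ENNReal.ofReal_mul hσ, ← ENNReal.ofReal_mul (by positivity),
    ← ENNReal.ofReal_add (by positivity) (by positivity)]
  congr 1; ring

theorem lintegral_lhsDensity_le (hn : 1 ≤ n) (hb : b ∈ Ioo 0 (π / 2)) {C : ℝ} (hC : 1 ≤ C)
    (hCK : 8 * C⁻¹ * W.K ^ 2 ≤ W.κ) {a d s : ℝ} (had : a < d)
    (hs : C * ((d - a) + (d - a) ^ 2) ≤ s) {G G' : ℝ → DomM n}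
    (hG : ∀ t ∈ Ioo a d, HasDerivAt G (G' t) t) (hG' : ContinuousOn G' (Ioo a d)) {N : ℝ}
    (hN : ∀ t ∈ Ioo a d, ‖G t‖ ≤ N) :
    ∫⁻ t in Ioo a d, ENNReal.ofReal
        (W.lowConst * W.lhsDensity hn (s * timeWeight a d t) (G t)) ≤
      ∫⁻ t in Ioo a d, ENNReal.ofReal
        (‖mulL (W.expW (s * timeWeight a d t)) ((G' t).toL2 - (G t).op)‖ ^ 2 +
          W.obsConst * ((s * timeWeight a d t) ^ 3 *
            obs b (mulL (W.expW (s * timeWeight a d t)) (G t).toL2))) := by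
  have hC0 : 0 < C := by linarith
  have hCi : C⁻¹ ≤ 1 := inv_le_one_of_one_le₀ hC
  have hb' := fun t (ht : t ∈ Ioo a d) => timeWeight_bounds hC ht hs
  have hL : 0 < d - a := by linarith
  have hs0 : 0 < s := lt_of_lt_of_le (by positivity) hs
  have hσ : ∀ t ∈ Ioo a d, HasDerivAt (fun t => s * timeWeight a d t) (s * timeWeight' a d t) t :=
    fun t ht => (hasDerivAt_timeWeight ht).const_mul s
  have hρ : ∀ t ∈ Ioo a d, HasDerivAt (fun t => s * timeWeight' a d t) (s * timeWeight'' a d t) t :=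
    fun t ht => (hasDerivAt_timeWeight' ht).const_mul s
  have cσ : ContinuousOn (fun t => s * timeWeight a d t) (Ioo a d) := fun t ht =>
    (hσ t ht).continuousAt.continuousWithinAt
  have cG : ContinuousOn G (Ioo a d) := fun t ht => (hG t ht).continuousAt.continuousWithinAt
  have hz := fun t (ht : t ∈ Ioo a d) => W.hasDerivAt_conj (hσ t ht) (hG t ht)
  obtain ⟨M, hM⟩ := W.exists_energyForm_bound hn N
  set F : ℝ → ℝ := fun t =>
    2 * W.energyForm hn (s * timeWeight a d t) (s * timeWeight' a d t) (G t)
  have hFb : ∀ t ∈ Ioo a d, ‖F t‖ ≤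
      2 * M * ((s * timeWeight a d t) ^ 2 * exp (-(s * timeWeight a d t))) := by
    intro t ht
    obtain ⟨h1, -, h3, -⟩ := hb' t ht
    have := hM _ _ (G t) h1 (h3.trans (mul_le_of_le_one_left (sq_nonneg _) hCi)) (hN t ht)
    rw [norm_mul, Real.norm_eq_abs, Real.norm_eq_abs, abs_two]
    linarith
  have hdecay : ∀ {l : Filter ℝ}, Tendsto (timeWeight a d) l atTop →
      Tendsto (fun t => 2 * M * ((s * timeWeight a d t) ^ 2 * exp (-(s * timeWeight a d t)))) l
        (𝓝 0) := by
    intro l hl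
    simpa using ((tendsto_pow_mul_exp_neg_atTop_nhds_zero 2).comp
      (hl.const_mul_atTop hs0)).const_mul (2 * M)
  refine lintegral_le_of_deriv_add_le had (F := F)
    (fun t ht => (W.hasDerivAt_energyForm hn (hσ t ht) (hρ t ht) (hG t ht) (hz t ht)).const_mul 2)
    ?_ ?_ ?_ ?_ ?_ ?_ ?_
  · exact continuousOn_const.mul (W.continuousOn_lhsDensity hn cσ cG)
  · refine ((W.continuousOn_mulL_expW cσ (((DomM.toL2L n).continuous.comp_continuousOn hG').sub
      ((DomM.opL n).continuous.comp_continuousOn cG))).norm.pow 2).add (continuousOn_const.mul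
      ((cσ.pow 3).mul ((continuous_obs hb).comp_continuousOn (W.continuousOn_mulL_expW cσ
        ((DomM.toL2L n).continuous.comp_continuousOn cG)))))
  · intro t ht
    exact _root_.mul_nonneg W.lowConst_pos.le
      (W.lhsDensity_nonneg hn (by linarith [(hb' t ht).1]) _)
  · intro t ht
    have h1 := (hb' t ht).1
    have h2 := obs_nonneg b (mulL (W.expW (s * timeWeight a d t)) (G t).toL2)
    have h3 := W.obsConst_nonneg
    positivity
  · intro t ht
    obtain ⟨h1, h2, h3, h4⟩ := hb' t ht
    exact W.differential_inequality hn hb (inv_pos.2 hC0) hCi hCK h1 h2 h3 h4 (G t) (G' t) rfl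
  · refine squeeze_zero_norm' ?_ (hdecay (tendsto_timeWeight_left had))
    filter_upwards [Ioo_mem_nhdsGT had] with t ht using hFb t ht
  · refine squeeze_zero_norm' ?_ (hdecay (tendsto_timeWeight_right had))
    filter_upwards [Ioo_mem_nhdsLT had] with t ht using hFb t ht

end Weight

/-! ### Passage to the full time interval. -/

lemma timeWeight_le {T ε t : ℝ} (hε : 0 < ε) (ht : t ∈ Ioo ε (T - ε)) :
    timeWeight 0 T t ≤ timeWeight ε (T - ε) t := by
  have h1 : 0 < t - ε := by linarith [ht.1]
  have h2 : 0 < T - ε - t := by linarith [ht.2]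
  unfold timeWeight
  refine one_div_le_one_div_of_le (mul_pos h1 h2) ?_
  nlinarith

namespace Weight

variable {b : ℝ} (W : Weight b) {n : ℕ}

/-- On (ε, T - ε) the curve is bounded in the graph norm by compactness. The truncated time weight
exceeds the full one, so both right-hand densities are bounded by their final form; the left-hand
side converges pointwise and Fatou's lemma applies. -/
theorem lintegral_lhsDensity_le_of_contDiffOn (hn : 1 ≤ n) (hb : b ∈ Ioo 0 (π / 2)) {C : ℝ}
    (hC : 2 ≤ C) (hCK : 8 * C⁻¹ * W.K ^ 2 ≤ W.κ) {T s : ℝ} (hT : 0 < T) (hs : C * (T + T ^ 2) ≤ s)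
    {G : ℝ → DomM n} (hG : ContDiffOn ℝ 2 G (Ioo 0 T)) :
    ∫⁻ t in Ioo 0 T, ENNReal.ofReal
        (W.lowConst * W.lhsDensity hn (s * timeWeight 0 T t) (G t)) ≤
      ∫⁻ t in Ioo 0 T, ((∫⁻ x in I, ENNReal.ofReal (‖((deriv G t).toL2 - (G t).op : L2) x‖ ^ 2 *
          exp (-2 * (s * timeWeight 0 T t) * W.β x))) +
        ENNReal.ofReal W.obsConst * ∫⁻ x in Ioo (-b) b, ENNReal.ofReal (‖(G t).toL2 x‖ ^ 2 *
          ((s * timeWeight 0 T t) ^ 3 * exp (-2 * (s * timeWeight 0 T t) * W.β x)))) := by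
  set ε : ℕ → ℝ := fun k => T / (k + 3)
  have hε0 : ∀ k, 0 < ε k := fun k => by positivity
  have hε1 : ∀ k, ε k < T - ε k := fun k => by
    have : ε k ≤ T / 3 := by
      simp only [ε]; gcongr; linarith [k.cast_nonneg (α := ℝ)]
    linarith
  have hεlim : Tendsto ε atTop (𝓝 0) := by
    refine Tendsto.div_atTop tendsto_const_nhds ?_
    exact tendsto_atTop_add_const_right _ _ tendsto_natCast_atTop_atTop
  have hC1 : 1 ≤ C := by linarith
  have hs0 : 0 < s := lt_of_lt_of_le (by positivity) hs
  have hsub : ∀ k, Icc (ε k) (T - ε k) ⊆ Ioo 0 T := fun k t ht =>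
    ⟨(hε0 k).trans_le ht.1, by linarith [ht.2, hε0 k]⟩
  have hsub' : ∀ k, Ioo (ε k) (T - ε k) ⊆ Ioo 0 T := fun k => Ioo_subset_Icc_self.trans (hsub k)
  have hd : ∀ t ∈ Ioo 0 T, HasDerivAt G (deriv G t) t := fun t ht =>
    ((hG.differentiableOn (by norm_num)).differentiableAt (isOpen_Ioo.mem_nhds ht)).hasDerivAt
  have hdc : ContinuousOn (deriv G) (Ioo 0 T) :=
    hG.continuousOn_deriv_of_isOpen isOpen_Ioo (by norm_num)
  have hcw : ∀ k, ContinuousOn (fun t => s * timeWeight (ε k) (T - ε k) t)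
      (Ioo (ε k) (T - ε k)) := fun k t ht =>
    ((hasDerivAt_timeWeight ht).const_mul s).continuousAt.continuousWithinAt
  set RHS : ℝ → ℝ≥0∞ := fun t =>
    ((∫⁻ x in I, ENNReal.ofReal (‖((deriv G t).toL2 - (G t).op : L2) x‖ ^ 2 *
          exp (-2 * (s * timeWeight 0 T t) * W.β x))) +
        ENNReal.ofReal W.obsConst * ∫⁻ x in Ioo (-b) b, ENNReal.ofReal (‖(G t).toL2 x‖ ^ 2 *
          ((s * timeWeight 0 T t) ^ 3 * exp (-2 * (s * timeWeight 0 T t) * W.β x))))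
  set f : ℕ → ℝ → ℝ≥0∞ := fun k => (Ioo (ε k) (T - ε k)).indicator fun t =>
    ENNReal.ofReal (W.lowConst * W.lhsDensity hn (s * timeWeight (ε k) (T - ε k) t) (G t))
  have hlim : ∀ t ∈ Ioo 0 T, Tendsto (fun k => f k t) atTop
      (𝓝 (ENNReal.ofReal (W.lowConst * W.lhsDensity hn (s * timeWeight 0 T t) (G t)))) := by
    intro t ht
    have h1 : Tendsto (fun k => s * timeWeight (ε k) (T - ε k) t) atTop
        (𝓝 (s * timeWeight 0 T t)) := by
      have hne : (t - 0) * (T - 0 - t) ≠ 0 := by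
        have : 0 < t * (T - t) := mul_pos ht.1 (by linarith [ht.2])
        simpa using this.ne'
      have := ((hεlim.const_sub t).mul ((hεlim.const_sub T).sub_const t)).inv₀ hne
      simpa [timeWeight] using this.const_mul s
    have h2 : Continuous (fun σ => W.lhsDensity hn σ (G t)) := by
      rw [← continuousOn_univ]
      exact W.continuousOn_lhsDensity hn continuousOn_id continuousOn_const
    refine (ENNReal.tendsto_ofReal (((h2.tendsto _).comp h1).const_mul W.lowConst)).congr' ?_
    filter_upwards [hεlim.eventually_lt_const ht.1,
      hεlim.eventually_lt_const (show 0 < T - t by linarith [ht.2])] with k hk1 hk2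
    rw [show f k t = _ from indicator_of_mem (show t ∈ Ioo (ε k) (T - ε k) from
      ⟨hk1, by linarith⟩) _]
    rfl
  have hmeas : ∀ k, AEMeasurable (f k) (volume.restrict (Ioo 0 T)) := fun k => by
    refine AEMeasurable.restrict ?_
    rw [aemeasurable_indicator_iff measurableSet_Ioo]
    exact ((continuousOn_const.mul (W.continuousOn_lhsDensity hn (hcw k)
      (hG.continuousOn.mono (hsub' k)))).aemeasurable measurableSet_Ioo).ennreal_ofReal
  have hbound : ∀ k, ∫⁻ t in Ioo 0 T, f k t ≤ ∫⁻ t in Ioo 0 T, RHS t := by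
    intro k
    have hcomp := isCompact_Icc.exists_bound_of_continuousOn (hG.continuousOn.mono (hsub k))
    obtain ⟨N, hN⟩ := hcomp
    have hsk : C * ((T - ε k - ε k) + (T - ε k - ε k) ^ 2) ≤ s := by
      refine le_trans ?_ hs
      have h1 := hε0 k
      have h2 := hε1 k
      have h3 : T - ε k - ε k ≤ T := by linarith
      have h4 : 0 ≤ T - ε k - ε k := by linarith
      gcongr
    have key := W.lintegral_lhsDensity_le hn hb hC1 hCK (hε1 k) hsk
      (fun t ht => hd t (hsub' k ht)) (hdc.mono (hsub' k))
      (fun t ht => hN t (Ioo_subset_Icc_self ht))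
    rw [lintegral_indicator measurableSet_Ioo, Measure.restrict_restrict measurableSet_Ioo,
      inter_eq_left.2 (hsub' k)]
    refine key.trans (le_trans ?_ (lintegral_mono_set (hsub' k)))
    refine setLIntegral_mono' measurableSet_Ioo fun t ht => ?_
    have hle := mul_le_mul_of_nonneg_left (timeWeight_le (hε0 k) ht) hs0.le
    -- As C ≥ 2, this puts σ in the range [3/2, ∞) where σ³e^{-2σβ} decreases.
    have hb1 : C ≤ s * timeWeight 0 T t := by
      have := (timeWeight_bounds hC1 (hsub' k ht) (by simpa using hs)).2.1
      rwa [inv_mul_eq_div, le_div_iff₀ (by linarith), one_mul] at this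
    set σ := s * timeWeight 0 T t
    set σ' := s * timeWeight (ε k) (T - ε k) t
    have hσ' : 0 < σ' := by linarith
    rw [ENNReal.ofReal_add (by positivity) (_root_.mul_nonneg W.obsConst_nonneg
      (_root_.mul_nonneg (by positivity) (obs_nonneg _ _))), W.ofReal_norm_expW_sq,
      ENNReal.ofReal_mul W.obsConst_nonneg, W.ofReal_obs_expW hb hσ'.le]
    refine add_le_add (lintegral_mono fun x => ENNReal.ofReal_le_ofReal ?_)
      (mul_le_mul_right (lintegral_mono fun x => ENNReal.ofReal_le_ofReal ?_) _)
    · have := W.one_le x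
      have h2 : σ * W.β x ≤ σ' * W.β x := by gcongr
      gcongr ‖_‖ ^ 2 * exp ?_
      linarith
    · gcongr ‖_‖ ^ 2 * ?_
      exact pow_three_mul_exp_antitone (by linarith) hle (W.one_le x)
  calc _ = ∫⁻ t in Ioo 0 T, liminf (fun k => f k t) atTop :=
        setLIntegral_congr_fun measurableSet_Ioo fun t ht => (hlim t ht).liminf_eq.symm
    _ ≤ liminf (fun k => ∫⁻ t in Ioo 0 T, f k t) atTop := lintegral_liminf_le' hmeas
    _ ≤ _ := liminf_le_of_frequently_le' (.of_forall hbound)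

end Weight

/-! ### The Carleman estimate and observability. -/

lemma theta_eq_timeWeight (T t : ℝ) : theta T t = timeWeight 0 T t := by
  simp [theta, timeWeight]

lemma contDiff_succ_of_hasDerivAt {f f' : ℝ → ℝ} {k : ℕ} (h : ∀ x, HasDerivAt f (f' x) x)
    (hf' : ContDiff ℝ k f') : ContDiff ℝ ((k + 1 : ℕ) : WithTop ℕ∞) f := by
  have e : deriv f = f' := funext fun x => (h x).deriv
  have := contDiff_succ_iff_deriv (n := (k : WithTop ℕ∞)) (f := f)
  push_cast
  exact this.2 ⟨fun x => (h x).differentiableAt, by simp, e ▸ hf'⟩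

lemma Weight.contDiff {b : ℝ} (W : Weight b) : ContDiff ℝ 4 W.β := by
  have h0 : ContDiff ℝ ((0 : ℕ) : WithTop ℕ∞) W.β₄ := contDiff_zero.2 W.β₄.continuous
  exact contDiff_succ_of_hasDerivAt W.hasDerivAt (contDiff_succ_of_hasDerivAt W.hasDerivAt₁
    (contDiff_succ_of_hasDerivAt W.hasDerivAt₂ (contDiff_succ_of_hasDerivAt W.hasDerivAt₃ h0)))

namespace InClass

variable {n : ℕ} {T : ℝ} {g : ℝ → L2} {G : ℝ → DomM n}

lemma hasDerivAt_curve (h : InClass n T g G) {t : ℝ} (ht : t ∈ Ioo 0 T) :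
    HasDerivAt G (deriv G t) t :=
  ((h.contDiffOn.differentiableOn (by norm_num)).differentiableAt
    (isOpen_Ioo.mem_nhds ht)).hasDerivAt

lemma hasDerivAt (h : InClass n T g G) {t : ℝ} (ht : t ∈ Ioo 0 T) :
    HasDerivAt g (deriv G t).toL2 t := by
  have h2 : HasDerivAt (fun t => (G t).toL2) (deriv G t).toL2 t :=
    (DomM.toL2L n).hasFDerivAt.comp_hasDerivAt t (h.hasDerivAt_curve ht)
  refine h2.congr_of_eventuallyEq ?_
  filter_upwards [isOpen_Ioo.mem_nhds ht] with r hr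
  exact (h.toL2_eq r hr).symm

lemma opP_eq (h : InClass n T g G) {t : ℝ} (ht : t ∈ Ioo 0 T) :
    opP g G t = (deriv G t).toL2 - (G t).op := by
  rw [opP, (h.hasDerivAt ht).deriv]

/-- Growth control for the equation `g' = M_n g`. -/
lemma norm_sq_le (h : InClass n T g G) (hn : 1 ≤ n) (hop : ∀ t ∈ Ioo 0 T, opP g G t = 0) {t : ℝ}
    (ht : t ∈ Ioo 0 T) : ‖g T‖ ^ 2 ≤ exp T * ‖g t‖ ^ 2 := by
  have hsub : Icc t T ⊆ Icc 0 T := Icc_subset_Icc_left ht.1.le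
  have hd : ∀ r ∈ Ioo t T, HasDerivAt (fun r => exp (-r) * ‖g r‖ ^ 2)
      (exp (-r) * -1 * ‖g r‖ ^ 2 + exp (-r) * (2 * inner ℝ (g r) (G r).op)) r := fun r hr => by
    have hr' : r ∈ Ioo 0 T := ⟨ht.1.trans hr.1, hr.2⟩
    have h1 := h.hasDerivAt hr'
    have h2 := h.opP_eq hr'
    rw [hop r hr', eq_comm, sub_eq_zero] at h2
    rw [h2] at h1
    exact (hasDerivAt_neg r).exp.mul h1.norm_sq
  have hanti : AntitoneOn (fun r => exp (-r) * ‖g r‖ ^ 2) (Icc t T) := by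
    refine antitoneOn_of_deriv_nonpos (convex_Icc t T) ?_ ?_ ?_
    · exact (by fun_prop : Continuous fun r : ℝ => exp (-r)).continuousOn.mul
        ((h.continuousOn.mono hsub).norm.pow 2)
    · rw [interior_Icc]
      exact fun r hr => (hd r hr).differentiableAt.differentiableWithinAt
    · rw [interior_Icc]
      intro r hr
      rw [(hd r hr).deriv]
      -- The energy inequality gives 2⟨g, M_n g⟩ ≤ ‖g‖², so e^{-r}‖g(r)‖² decreases.
      have he := (G r).energy hn
      rw [h.toL2_eq r ⟨ht.1.trans hr.1, hr.2⟩] at he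
      have h3 : 2 * inner ℝ (g r) (G r).op - ‖g r‖ ^ 2 ≤ 0 := by
        linarith [sq_nonneg ‖dxL hn (G r)‖]
      have := mul_nonpos_of_nonneg_of_nonpos (exp_pos (-r)).le h3
      linarith
  have h1 := hanti (left_mem_Icc.2 ht.2.le) (right_mem_Icc.2 ht.2.le) ht.2.le
  simp only at h1
  have h2 : exp (-t) * ‖g t‖ ^ 2 ≤ 1 * ‖g t‖ ^ 2 := by
    have : exp (-t) ≤ 1 := exp_le_one_iff.2 (by linarith [ht.1])
    gcongr
  have h3 : exp T * (exp (-T) * ‖g T‖ ^ 2) = ‖g T‖ ^ 2 := by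
    rw [← mul_assoc, ← exp_add]; simp
  rw [← h3]
  have := exp_pos T
  gcongr
  linarith

end InClass

namespace Weight

variable {b : ℝ} (W : Weight b) {n : ℕ} {T s : ℝ} {g : ℝ → L2} {G : ℝ → DomM n}

/-- The constant `C₀` for which the Carleman estimate holds when `s ≥ C₀ (T + T²)`. -/
def threshold : ℝ := max 2 (8 * W.K ^ 2 / W.κ)

/-- The constant in front of the left-hand side of the Carleman estimate. -/
def gain : ℝ := W.lowConst / (1 + W.obsConst)

lemma threshold_pos : 0 < W.threshold := lt_of_lt_of_le two_pos (le_max_left _ _)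

lemma gain_pos : 0 < W.gain := div_pos W.lowConst_pos (by linarith [W.obsConst_nonneg])

theorem carleman (hn : 1 ≤ n) (hb : b ∈ Ioo 0 (π / 2)) {c : ℝ} (hbc : b ≤ c) (hT : 0 < T)
    (hs : W.threshold * (T + T ^ 2) ≤ s) (h : InClass n T g G) :
    ENNReal.ofReal W.gain * (∫⁻ t in Ioo 0 T, ∫⁻ x in I,
        ENNReal.ofReal ((s * theta T t * ‖(G t).dx x‖ ^ 2
          + s ^ 3 * theta T t ^ 3 * ‖g t x‖ ^ 2) * exp (-2 * s * phi W.β T t x)))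
      ≤ (∫⁻ t in Ioo 0 T, ∫⁻ x in Ioo (-c) c,
          ENNReal.ofReal (s ^ 3 * theta T t ^ 3 * ‖g t x‖ ^ 2
            * exp (-2 * s * phi W.β T t x)))
        + ∫⁻ t in Ioo 0 T, ∫⁻ x in I,
          ENNReal.ofReal (‖opP g G t x‖ ^ 2 * exp (-2 * s * phi W.β T t x)) := by
  -- This uses the second entry of `threshold`; the entry 2 serves the truncation in time.
  have hthr : 8 * W.threshold⁻¹ * W.K ^ 2 ≤ W.κ := by
    have h1 : 8 * W.K ^ 2 ≤ W.threshold * W.κ :=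
      (div_le_iff₀ W.κ_pos).1 (le_max_right 2 (8 * W.K ^ 2 / W.κ))
    have h2 : 8 * W.threshold⁻¹ * W.K ^ 2 = 8 * W.K ^ 2 / W.threshold := by ring
    rw [h2, div_le_iff₀ W.threshold_pos]
    linarith
  have hs0 : 0 < s := lt_of_lt_of_le (mul_pos W.threshold_pos (by positivity)) hs
  have hσ : ∀ t ∈ Ioo 0 T, 0 ≤ s * timeWeight 0 T t := fun t ht =>
    (mul_pos hs0 (timeWeight_pos ht)).le
  have key := W.lintegral_lhsDensity_le_of_contDiffOn hn hb (le_max_left _ _) hthr hT hs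
    h.contDiffOn
  set X := ∫⁻ t in Ioo 0 T, ∫⁻ x in I,
        ENNReal.ofReal ((s * theta T t * ‖(G t).dx x‖ ^ 2
          + s ^ 3 * theta T t ^ 3 * ‖g t x‖ ^ 2) * exp (-2 * s * phi W.β T t x))
  set Y := ∫⁻ t in Ioo 0 T, ∫⁻ x in Ioo (-c) c,
          ENNReal.ofReal (s ^ 3 * theta T t ^ 3 * ‖g t x‖ ^ 2
            * exp (-2 * s * phi W.β T t x))
  set Z := ∫⁻ t in Ioo 0 T, ∫⁻ x in I,
          ENNReal.ofReal (‖opP g G t x‖ ^ 2 * exp (-2 * s * phi W.β T t x))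
  have hX : ∫⁻ t in Ioo 0 T, ENNReal.ofReal
      (W.lowConst * W.lhsDensity hn (s * timeWeight 0 T t) (G t)) =
        ENNReal.ofReal W.lowConst * X := by
    rw [← lintegral_const_mul' _ _ ENNReal.ofReal_ne_top]
    refine setLIntegral_congr_fun measurableSet_Ioo fun t ht => ?_
    rw [ENNReal.ofReal_mul W.lowConst_pos.le, W.ofReal_lhsDensity hn (hσ t ht), h.toL2_eq t ht]
    congr 1
    refine lintegral_congr fun x => ?_
    rw [phi, theta_eq_timeWeight]
    congr 1
    ring_nf
  have hmeas : AEMeasurable (fun t => ∫⁻ x in I,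
      ENNReal.ofReal (‖((deriv G t).toL2 - (G t).op : L2) x‖ ^ 2 *
        exp (-2 * (s * timeWeight 0 T t) * W.β x))) (volume.restrict (Ioo 0 T)) := by
    simp only [← ofReal_norm_expW_sq]
    have hdc : ContinuousOn (deriv G) (Ioo 0 T) :=
      h.contDiffOn.continuousOn_deriv_of_isOpen isOpen_Ioo (by norm_num)
    have hcw : ContinuousOn (fun t => s * timeWeight 0 T t) (Ioo 0 T) := fun t ht =>
      ((hasDerivAt_timeWeight ht).const_mul s).continuousAt.continuousWithinAt
    exact (((W.continuousOn_mulL_expW hcw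
      (((DomM.toL2L n).continuous.comp_continuousOn hdc).sub
        ((DomM.opL n).continuous.comp_continuousOn h.contDiffOn.continuousOn))).norm.pow
          2).aemeasurable measurableSet_Ioo).ennreal_ofReal
  have hZ : ∫⁻ t in Ioo 0 T, ∫⁻ x in I,
      ENNReal.ofReal (‖((deriv G t).toL2 - (G t).op : L2) x‖ ^ 2 *
        exp (-2 * (s * timeWeight 0 T t) * W.β x)) = Z := by
    refine setLIntegral_congr_fun measurableSet_Ioo fun t ht => ?_
    rw [h.opP_eq ht]
    refine lintegral_congr fun x => ?_
    rw [phi, theta_eq_timeWeight]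
    congr 3
    ring
  have hY : ∫⁻ t in Ioo 0 T, ∫⁻ x in Ioo (-b) b, ENNReal.ofReal (‖(G t).toL2 x‖ ^ 2 *
      ((s * timeWeight 0 T t) ^ 3 * exp (-2 * (s * timeWeight 0 T t) * W.β x))) ≤ Y := by
    refine setLIntegral_mono' measurableSet_Ioo fun t ht => ?_
    rw [h.toL2_eq t ht]
    refine (lintegral_mono_set (Ioo_subset_Ioo (neg_le_neg hbc) hbc)).trans
      (lintegral_mono fun x => le_of_eq ?_)
    rw [phi, theta_eq_timeWeight]
    congr 1
    ring_nf
  rw [hX, lintegral_add_left' hmeas, lintegral_const_mul' _ _ ENNReal.ofReal_ne_top, hZ] at key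
  have ho := W.obsConst_nonneg
  have hc : 0 < 1 + W.obsConst := by linarith
  have hfin : ENNReal.ofReal W.lowConst * X ≤ ENNReal.ofReal (1 + W.obsConst) * (Y + Z) := by
    refine key.trans ?_
    rw [mul_add, add_comm]
    refine add_le_add ?_ ?_
    · exact mul_le_mul' (ENNReal.ofReal_le_ofReal (by linarith)) hY
    · exact le_mul_of_one_le_left' (ENNReal.one_le_ofReal.2 (by linarith))
  have hg : ENNReal.ofReal W.gain =
      ENNReal.ofReal (1 + W.obsConst)⁻¹ * ENNReal.ofReal W.lowConst := by
    rw [← ENNReal.ofReal_mul (by positivity), gain, div_eq_inv_mul]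
  calc ENNReal.ofReal W.gain * X
      = ENNReal.ofReal (1 + W.obsConst)⁻¹ * (ENNReal.ofReal W.lowConst * X) := by
        rw [hg, mul_assoc]
    _ ≤ ENNReal.ofReal (1 + W.obsConst)⁻¹ * (ENNReal.ofReal (1 + W.obsConst) * (Y + Z)) := by
        gcongr
    _ = Y + Z := by
        rw [← mul_assoc, ← ENNReal.ofReal_mul (by positivity), inv_mul_cancel₀ hc.ne',
          ENNReal.ofReal_one, one_mul]

lemma pow_three_mul_exp_le_one {σ β : ℝ} (hσ : 0 ≤ σ) (hβ : 1 ≤ β) :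
    σ ^ 3 * exp (-2 * σ * β) ≤ 1 := by
  have h1 := pow_div_factorial_le_exp (2 * σ) (by positivity) 3
  have h2 : exp (2 * σ) ≤ exp (2 * σ * β) := exp_le_exp.2 (by nlinarith)
  have h3 : σ ^ 3 ≤ exp (2 * σ * β) := by
    have : (2 * σ) ^ 3 / (Nat.factorial 3 : ℝ) = 4 / 3 * σ ^ 3 := by
      norm_num [Nat.factorial]; ring
    have : 0 ≤ σ ^ 3 := by positivity
    linarith
  calc σ ^ 3 * exp (-2 * σ * β) ≤ exp (2 * σ * β) * exp (-2 * σ * β) := by gcongr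
    _ = 1 := by rw [← exp_add]; ring_nf; simp

/-- A lower bound for the weight `σ³ e^{-2σβ}`, `σ = sθ`, in the middle third of `(0, T)`. -/
def middleWeight (T s : ℝ) : ℝ := (s * (4 / T ^ 2)) ^ 3 * exp (-2 * (s * (9 / (2 * T ^ 2))) * W.K)

lemma middleWeight_pos (hT : 0 < T) (hs : 0 < s) : 0 < W.middleWeight T s := by
  unfold middleWeight; positivity

lemma middleWeight_le (hs : 0 < s) {t : ℝ} (ht : t ∈ Ioo (T / 3) (2 * T / 3)) (x : ℝ) :
    W.middleWeight T s ≤ (s * timeWeight 0 T t) ^ 3 * exp (-2 * (s * timeWeight 0 T t) * W.β x) := by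
  have hT : 0 < T := by linarith [ht.1, ht.2]
  have ht' : t ∈ Ioo 0 T := ⟨by linarith [ht.1], by linarith [ht.2]⟩
  have hθ := timeWeight_pos ht'
  have h1 : 4 / T ^ 2 ≤ timeWeight 0 T t := by
    rw [div_le_iff₀ (by positivity)]; simpa using four_le_timeWeight ht'
  -- In the middle third t(T - t) ≥ 2T²/9.
  have h2 : timeWeight 0 T t ≤ 9 / (2 * T ^ 2) := by
    have hp : 0 < t * (T - t) := mul_pos ht'.1 (by linarith [ht'.2])
    rw [timeWeight, sub_zero, div_le_div_iff₀ hp (by positivity)]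
    nlinarith [mul_pos (sub_pos.2 ht.1) (sub_pos.2 ht.2)]
  have hβ : W.β x ≤ W.K := (le_abs_self _).trans (W.bound x)
  have hβ0 : 0 ≤ W.β x := by linarith [W.one_le x]
  have h3 : s * timeWeight 0 T t * W.β x ≤ s * (9 / (2 * T ^ 2)) * W.K := by gcongr
  unfold middleWeight
  refine mul_le_mul ?_ (exp_le_exp.2 (by linarith)) (exp_pos _).le (by positivity)
  gcongr

/-- The constant in the observability inequality on `(0, T)`. -/
def observabilityConst (T : ℝ) : ℝ :=
  (W.gain * (W.middleWeight T (W.threshold * (T + T ^ 2)) * exp (-T) * (T / 3)))⁻¹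

lemma observabilityConst_pos (hT : 0 < T) : 0 < W.observabilityConst T := by
  have h1 := W.gain_pos
  have h2 := W.middleWeight_pos hT (mul_pos W.threshold_pos (show 0 < T + T ^ 2 by positivity))
  unfold observabilityConst; positivity

/-- Apply `carleman` with the least admissible s. The source vanishes, the observed weight is at
most 1, and on the middle third the left side is bounded below by a multiple of e^{-T}‖g(T)‖². -/
theorem observability (hn : 1 ≤ n) (hb : b ∈ Ioo 0 (π / 2)) {c : ℝ} (hbc : b ≤ c) (hT : 0 < T)
    (h : InClass n T g G) (hop : ∀ t ∈ Ioo 0 T, opP g G t = 0) :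
    ∫⁻ x in I, ENNReal.ofReal (‖g T x‖ ^ 2) ≤
      ENNReal.ofReal (W.observabilityConst T) * ∫⁻ t in Ioo 0 T, ∫⁻ x in Ioo (-c) c,
        ENNReal.ofReal (‖g t x‖ ^ 2) := by
  set s := W.threshold * (T + T ^ 2)
  have hs0 : 0 < s := mul_pos W.threshold_pos (by positivity)
  have key := W.carleman hn hb hbc hT le_rfl h
  set X := ∫⁻ t in Ioo 0 T, ∫⁻ x in I,
        ENNReal.ofReal ((s * theta T t * ‖(G t).dx x‖ ^ 2
          + s ^ 3 * theta T t ^ 3 * ‖g t x‖ ^ 2) * exp (-2 * s * phi W.β T t x))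
  set Y := ∫⁻ t in Ioo 0 T, ∫⁻ x in Ioo (-c) c, ENNReal.ofReal (‖g t x‖ ^ 2)
  have hσ : ∀ t ∈ Ioo 0 T, 0 < s * timeWeight 0 T t := fun t ht =>
    mul_pos hs0 (timeWeight_pos ht)
  have hZ : ∫⁻ t in Ioo 0 T, ∫⁻ x in I,
      ENNReal.ofReal (‖opP g G t x‖ ^ 2 * exp (-2 * s * phi W.β T t x)) = 0 := by
    rw [setLIntegral_congr_fun (g := fun _ => 0) measurableSet_Ioo, lintegral_zero]
    intro t ht
    simp only
    rw [hop t ht, lintegral_congr_ae (g := fun _ => 0), lintegral_zero]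
    filter_upwards [Lp.coeFn_zero ℂ 2 μI] with x hx
    rw [hx]; simp
  have hY : ∫⁻ t in Ioo 0 T, ∫⁻ x in Ioo (-c) c, ENNReal.ofReal (s ^ 3 * theta T t ^ 3 *
      ‖g t x‖ ^ 2 * exp (-2 * s * phi W.β T t x)) ≤ Y := by
    refine setLIntegral_mono' measurableSet_Ioo fun t ht =>
      lintegral_mono fun x => ENNReal.ofReal_le_ofReal ?_
    have h1 := mul_le_mul_of_nonneg_left
      (pow_three_mul_exp_le_one (hσ t ht).le (W.one_le x)) (sq_nonneg ‖g t x‖)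
    rw [phi, theta_eq_timeWeight]
    calc _ = ‖g t x‖ ^ 2 * ((s * timeWeight 0 T t) ^ 3 *
          exp (-2 * (s * timeWeight 0 T t) * W.β x)) := by ring_nf
      _ ≤ _ := by linarith
  have hm := W.middleWeight_pos hT hs0
  have hX : ENNReal.ofReal (W.middleWeight T s * exp (-T) * (T / 3)) *
      ENNReal.ofReal (‖g T‖ ^ 2) ≤ X := by
    have hsub : Ioo (T / 3) (2 * T / 3) ⊆ Ioo 0 T := Ioo_subset_Ioo (by linarith) (by linarith)
    have hvol : ENNReal.ofReal (T / 3) = volume (Ioo (T / 3) (2 * T / 3)) := by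
      rw [Real.volume_Ioo]; congr 1; ring
    refine le_trans ?_ (lintegral_mono_set hsub)
    rw [ENNReal.ofReal_mul (by positivity), mul_right_comm, hvol, ← setLIntegral_const]
    refine setLIntegral_mono' measurableSet_Ioo fun t ht => ?_
    have ht' := hsub ht
    calc ENNReal.ofReal (W.middleWeight T s * exp (-T)) * ENNReal.ofReal (‖g T‖ ^ 2)
        = ENNReal.ofReal (W.middleWeight T s * (exp (-T) * ‖g T‖ ^ 2)) := by
          rw [← ENNReal.ofReal_mul (by positivity), mul_assoc]
      _ ≤ ENNReal.ofReal (W.middleWeight T s * ‖g t‖ ^ 2) := by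
          refine ENNReal.ofReal_le_ofReal (mul_le_mul_of_nonneg_left ?_ hm.le)
          have := mul_le_mul_of_nonneg_left (h.norm_sq_le hn hop ht') (exp_pos (-T)).le
          rwa [← mul_assoc (exp (-T)) (exp T), ← exp_add, neg_add_cancel, exp_zero,
            one_mul] at this
      _ = ∫⁻ x in I, ENNReal.ofReal (W.middleWeight T s * ‖g t x‖ ^ 2) := by
          rw [ENNReal.ofReal_mul hm.le, ofReal_norm_sq_eq,
            ← lintegral_const_mul' _ _ ENNReal.ofReal_ne_top]
          simp only [ENNReal.ofReal_mul hm.le]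
      _ ≤ _ := by
          refine lintegral_mono fun x => ENNReal.ofReal_le_ofReal ?_
          rw [phi, theta_eq_timeWeight]
          have h1 := mul_le_mul_of_nonneg_right (W.middleWeight_le hs0 ht x)
            (sq_nonneg ‖g t x‖)
          have h2 : 0 ≤ s * timeWeight 0 T t * ‖(G t).dx x‖ ^ 2 *
              exp (-2 * s * (timeWeight 0 T t * W.β x)) :=
            _root_.mul_nonneg (_root_.mul_nonneg (hσ t ht').le (sq_nonneg _)) (exp_pos _).le
          have e : -2 * (s * timeWeight 0 T t) * W.β x =
            -2 * s * (timeWeight 0 T t * W.β x) := by ring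
          rw [e] at h1
          linarith
  rw [hZ, add_zero] at key
  have hg := W.gain_pos
  set D := W.gain * (W.middleWeight T s * exp (-T) * (T / 3))
  have hD : 0 < D := by positivity
  have hfin : ENNReal.ofReal D * ENNReal.ofReal (‖g T‖ ^ 2) ≤ Y := by
    rw [ENNReal.ofReal_mul hg.le, mul_assoc]
    exact (mul_le_mul_right hX _).trans (key.trans hY)
  rw [← ofReal_norm_sq_eq]
  calc ENNReal.ofReal (‖g T‖ ^ 2)
      = ENNReal.ofReal D⁻¹ * (ENNReal.ofReal D * ENNReal.ofReal (‖g T‖ ^ 2)) := by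
        rw [← mul_assoc, ← ENNReal.ofReal_mul (by positivity), inv_mul_cancel₀ hD.ne',
          ENNReal.ofReal_one, one_mul]
    _ ≤ ENNReal.ofReal D⁻¹ * Y := by gcongr

end Weight

end Carleman

end

theorem mainTheorem4 (b : ℝ) (hb₀ : 0 < b) (hb : b ≤ π / 2) :
    (∃ β : ℝ → ℝ, ContDiffOn ℝ 4 β (Icc (-(π / 2)) (π / 2)) ∧
      (∀ x ∈ Icc (-(π / 2)) (π / 2), 0 < β x) ∧
      ∃ C₀ C₁ : ℝ, 0 < C₀ ∧ 0 < C₁ ∧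
        ∀ T : ℝ, 0 < T → ∀ s : ℝ, C₀ * (T + T ^ 2) ≤ s → ∀ n : ℕ, 1 ≤ n →
          ∀ (g : ℝ → L2) (G : ℝ → DomM n), InClass n T g G →
            ENNReal.ofReal C₁ * (∫⁻ t in Ioo 0 T, ∫⁻ x in I,
                ENNReal.ofReal ((s * theta T t * ‖(G t).dx x‖ ^ 2
                  + s ^ 3 * theta T t ^ 3 * ‖g t x‖ ^ 2) * exp (-2 * s * phi β T t x)))
              ≤ (∫⁻ t in Ioo 0 T, ∫⁻ x in Ioo (-b) b,
                  ENNReal.ofReal (s ^ 3 * theta T t ^ 3 * ‖g t x‖ ^ 2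
                    * exp (-2 * s * phi β T t x)))
                + ∫⁻ t in Ioo 0 T, ∫⁻ x in I,
                  ENNReal.ofReal (‖opP g G t x‖ ^ 2 * exp (-2 * s * phi β T t x))) ∧
    (∀ T : ℝ, 0 < T → ∃ C : ℝ, 0 < C ∧ ∀ n : ℕ, 1 ≤ n →
      ∀ (g : ℝ → L2) (G : ℝ → DomM n), InClass n T g G → (∀ t ∈ Ioo 0 T, opP g G t = 0) →
        ∫⁻ x in I, ENNReal.ofReal (‖g T x‖ ^ 2)
          ≤ ENNReal.ofReal C * ∫⁻ t in Ioo 0 T, ∫⁻ x in Ioo (-b) b,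
              ENNReal.ofReal (‖g t x‖ ^ 2)) := by
  -- The weight needs an observation interval strictly inside (-π/2, π/2), whereas b = π/2 is
  -- allowed; observing on the smaller (-c, c) suffices.
  set c := min b (π / 4)
  have hc : c ∈ Ioo 0 (π / 2) :=
    ⟨lt_min hb₀ (by positivity), (min_le_right _ _).trans_lt (by linarith [pi_pos])⟩
  have hcb : c ≤ b := min_le_left _ _
  obtain ⟨W⟩ := exists_weight hc
  refine ⟨⟨W.β, W.contDiff.contDiffOn, fun x _ => by linarith [W.one_le x], W.threshold, W.gain,
    W.threshold_pos, W.gain_pos, fun T hT s hs n hn g G h => W.carleman hn hc hcb hT hs h⟩,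
    fun T hT => ⟨W.observabilityConst T, W.observabilityConst_pos hT,
      fun n hn g G h hop => W.observability hn hc hcb hT h hop⟩⟩
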